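/- Notation. A finite specialization is a finite list $X=(x_1,\dots,x_n)$ of elements of a commutative $\mathbb C$-algebra (complex numbers and/or formal variables); $(X,Y)$ is concatenation. Let $s_\lambda=\det(h_{\lambda_i-i+j})$, $s_{\lambda/\mu}=\det(h_{\lambda_i-\mu_j-i+j})$, $\tau_\lambda=\sum_{\mu\subseteq\lambda,\ \mu'\text{ even}}s_{\lambda/\mu}$ ($\mu'$ even: all parts of the transpose are even), and $$F(X;Y)=\sum_\lambda s_\lambda(X)s_\lambda(Y),\qquad Z(X;Y)=\sum_\lambda \tau_\lambda(Y)s_\lambda(X),\qquad H_0(X)=\prod_{i<j}\frac1{1-x_ix_j},$$ $$H^{(1)}_q(X;z)=\prod_i\frac{1-zx_i}{1-qzx_i},\qquad H^{(2)}_q(X;z)=\prod_i\frac{1-(qz)^{-1}x_i}{1-z^{-1}x_i}.$$ Sums over partitions that involve formal variables converge coefficientwise, and $1/(1-c\,\xi)$ for a formal variable $\xi$ is the geometric series. For $\xi=(\xi_1,\dots,\xi_u)$ let $\langle\cdot,\cdot\rangle^{\xi}_u$ be the bilinear form on symmetric power series in $\xi$ (linear over series in the other variables) with $\langle p_\lambda,p_\mu\rangle_u^{\xi}=\mathbf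 1_{\lambda=\mu}\mathbf 1_{|\mu|\le u}\prod_{i\ge1}i^{m_i(\lambda)}m_i(\lambda)!$ for partitions of weight at most $u$, components of degree larger than $u$ being discarded. Setting. Let $m\ge1$, let $\rho^+_1,\dots,\rho^+_m$ and $\rho^-_0,\dots,\rho^-_{m-1}$ be finite lists (possibly empty) of complex numbers of modulus less than $1$, let $d_1,\dots,d_m\ge0$, and let $z_{i,j},q_{i,j}$ ($1\le i\le m$, $1\le j\le d_i$) be nonzero complex numbers with $|z_{i,j}|\le\Upsilon<1$ and $|q_{i,j}z_{i,j}|<1$. Assume that $z_{i,j}$ is not an entry of $\rho^+_i$, and that for all $1\le i<k\le m$ and all $j,l$ $$|x|<|z_{i,j}|\ \text{ for every entry } x \text{ of }\rho^+_k,\qquad |z_{k,l}|<|q_{i,j}z_{i,j}|,\qquad |q_{k,l}z_{k,l}|<|z_{i,j}| .$$ For positive integers $u_{i,1},u_{i,2}$ ($1\le i\le m-1$) let $\xi^-_i$ and $\xi^+_i$ be sets of $u_{i,1}$, respectively $u_{i,2}$, formal variables, let $\xi^-_m=\emptyset$, and put $$A_1=Z(\rho^+_1,\xi^-_1;\rho^-_0)\prod_{j=1}^{d_1}H^{(1)}_{q_{1,j}}(\rho^+_1,\xi^-_1,\rho^-_0;z_{1,j})\,H^{(2)}_{q_{1,j}}(\rho^+_1,\xi^-_1;z_{1,j}),$$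 $$B_i=F(\rho^+_i,\xi^-_i;\rho^-_{i-1},\xi^+_{i-1})\prod_{j=1}^{d_i}H^{(1)}_{q_{i,j}}(\rho^-_{i-1},\xi^+_{i-1};z_{i,j})\,H^{(2)}_{q_{i,j}}(\rho^+_i,\xi^-_i;z_{i,j})\quad(2\le i\le m),$$ $$A_{i+1}=\Big\langle\big\langle A_i,\,F(\xi^-_i;\xi^+_i)\big\rangle^{\xi^-_i}_{u_{i,1}},\ B_{i+1}\Big\rangle^{\xi^+_i}_{u_{i,2}}\quad(1\le i\le m-1).$$ Thus $A_m=A_m(u)$ is a complex number, the nested inner product. Theorem. All the successive limits in $$\lim_{u_{m-1,2}\to\infty}\lim_{u_{m-1,1}\to\infty}\cdots\lim_{u_{1,2}\to\infty}\lim_{u_{1,1}\to\infty}A_m(u)$$ exist (the limit in $u_{1,1}$ is taken first), and the final value is, with $\rho^+_{[1,m]}=(\rho^+_1,\dots,\rho^+_m)$, $$\begin{aligned} &H_0(\rho^+_{[1,m]})\prod_{j=0}^{m-1}\prod_{k=j+1}^{m}F(\rho^+_k;\rho^-_j)\ \prod_{i=2}^m\prod_{j=1}^{d_i}\frac{1-q_{i,j}z_{i,j}^2}{1-z_{i,j}^2}\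 \prod_{i=2}^m\prod_{1\le j<k\le d_i}\frac{(1-q_{i,j}z_{i,j}z_{i,k})(1-q_{i,k}z_{i,k}z_{i,j})}{(1-q_{i,j}z_{i,j}q_{i,k}z_{i,k})(1-z_{i,j}z_{i,k})}\\ &\times\prod_{k=1}^m\prod_{i=1}^m\prod_{j=1}^{d_k}H^{(1)}_{q_{k,j}}(\rho^+_i;z_{k,j})\ \prod_{k=1}^m\prod_{i=0}^{k-1}\prod_{j=1}^{d_k}H^{(1)}_{q_{k,j}}(\rho^-_i;z_{k,j})\ \prod_{k=1}^m\prod_{i=k}^m\prod_{j=1}^{d_k}H^{(2)}_{q_{k,j}}(\rho^+_i;z_{k,j})\\ &\times\prod_{1\le a<b\le m}\prod_{j=1}^{d_a}\prod_{k=1}^{d_b}\frac{(q_{a,j}z_{a,j}-q_{b,k}z_{b,k})(z_{a,j}-z_{b,k})}{(z_{a,j}-q_{b,k}z_{b,k})(q_{a,j}z_{a,j}-z_{b,k})}\cdot\frac{(1-q_{a,j}z_{a,j}z_{b,k})(1-q_{b,k}z_{b,k}z_{a,j})}{(1-q_{a,j}z_{a,j}q_{b,k}z_{b,k})(1-z_{b,k}z_{a,j})}.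 \end{aligned}$$ -/

import Mathlib

open Filter Topology
open scoped MvPowerSeries.WithPiTopology

noncomputable section

namespace PfaffianSchur

/-! ### Schur functions of a finite alphabet

A finite alphabet `(a i)_{i ∈ ι}` in a commutative ring `R` is a family `a : ι → R` over a finite
index type.  The union of two alphabets is `Sum.elim a b`.  Partitions are Young diagrams:
`Λ.rowLen i` is the `i`-th part (counted from `0`) and `Λ.colLen 0` is the length. -/

/-- The complete homogeneous symmetric function `h_k` at the alphabet `a`, for `k ∈ ℤ`
(with `h_k = 0` for `k < 0`). -/
def complete {R : Type*} [CommRing R] {ι : Type*} [Fintype ι] [DecidableEq ι]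
    (a : ι → R) (k : ℤ) : R :=
  if 0 ≤ k then MvPolynomial.eval a (MvPolynomial.hsymm ι R k.toNat) else 0

/-- The skew Schur function `s_{Λ/M} = det (h_{Λ_i - M_j - i + j})` at the alphabet `a`, for
`M ⊆ Λ`. The determinant has size the length of `Λ`. -/
def skewSchur {R : Type*} [CommRing R] {ι : Type*} [Fintype ι] [DecidableEq ι]
    (Λ M : YoungDiagram) (a : ι → R) : R :=
  Matrix.det (Matrix.of fun i j : Fin (Λ.colLen 0) =>
    complete a ((Λ.rowLen i : ℤ) - (M.rowLen j : ℤ) - (i : ℤ) + (j : ℤ)))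

/-- The Schur function `s_Λ = det (h_{Λ_i - i + j})` at the alphabet `a`. -/
def schur {R : Type*} [CommRing R] {ι : Type*} [Fintype ι] [DecidableEq ι]
    (Λ : YoungDiagram) (a : ι → R) : R :=
  skewSchur Λ ⊥ a

/-- `τ_Λ = ∑ s_{Λ/M}`, the (finite) sum over all `M ⊆ Λ` whose transpose is even, that is, has only
even parts. -/
def tau {R : Type*} [CommRing R] {ι : Type*} [Fintype ι] [DecidableEq ι]
    (Λ : YoungDiagram) (a : ι → R) : R :=
  ∑ᶠ (M : YoungDiagram) (_ : M ≤ Λ ∧ ∀ j, Even (M.transpose.rowLen j)), skewSchur Λ M a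

/-- The partition function `F(X; Y) = ∑_Λ s_Λ(X) s_Λ(Y)` of the Schur measure. -/
def partitionF {R : Type*} [CommRing R] [TopologicalSpace R]
    {ι κ : Type*} [Fintype ι] [DecidableEq ι] [Fintype κ] [DecidableEq κ]
    (X : ι → R) (Y : κ → R) : R :=
  ∑' Λ : YoungDiagram, schur Λ X * schur Λ Y

/-- The partition function `Z(X; Y) = ∑_Λ τ_Λ(Y) s_Λ(X)` of the Pfaffian Schur measure. -/
def partitionZ {R : Type*} [CommRing R] [TopologicalSpace R]
    {ι κ : Type*} [Fintype ι] [DecidableEq ι] [Fintype κ] [DecidableEq κ]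
    (X : ι → R) (Y : κ → R) : R :=
  ∑' Λ : YoungDiagram, tau Λ Y * schur Λ X

/-- `H_0(X) = ∏_{i < j} 1 / (1 - x_i x_j)`. -/
def H0 {ι : Type*} [Fintype ι] [LinearOrder ι] (X : ι → ℂ) : ℂ :=
  ∏ p ∈ Finset.univ.filter (fun p : ι × ι => p.1 < p.2), 1 / (1 - X p.1 * X p.2)

/-- `H^{(1)}_q(X; z) = ∏_i (1 - z x_i) / (1 - q z x_i)` for an alphabet in a `ℂ`-algebra (complex
numbers, or formal power series over `ℂ`, where `1 / (1 - c ξ)` is the geometric series). -/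
def H1 {R : Type*} [CommRing R] [Algebra ℂ R] {ι : Type*} [Fintype ι]
    (q z : ℂ) (X : ι → R) : R :=
  ∏ i, (1 - z • X i) * Ring.inverse (1 - (q * z) • X i)

/-- `H^{(2)}_q(X; z) = ∏_i (1 - (q z)⁻¹ x_i) / (1 - z⁻¹ x_i)`. -/
def H2 {R : Type*} [CommRing R] [Algebra ℂ R] {ι : Type*} [Fintype ι]
    (q z : ℂ) (X : ι → R) : R :=
  ∏ i, (1 - (q * z)⁻¹ • X i) * Ring.inverse (1 - z⁻¹ • X i)

/-! ### The finite inner product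

`MvPowerSeries (Fin u) A` holds the formal power series in the variables `ξ_1, …, ξ_u` with
coefficients in `A`.  The power sum products `p_ν` with `|ν| ≤ u` are linearly independent, and
a symmetric series over a `ℚ`-algebra is, up to degree `u`, a combination of them. -/

/-- `f = ∑_{|ν| ≤ u} c_ν p_ν(ξ_1, …, ξ_u)` up to terms of degree larger than `u`. -/
def IsPowerSumExpansion {A : Type*} [CommRing A] {u : ℕ} (f : MvPowerSeries (Fin u) A)
    (c : (k : ℕ) → k.Partition → A) : Prop :=
  ∀ e : Fin u →₀ ℕ, e.degree ≤ u →
    MvPowerSeries.coeff e f =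
      ∑ k ∈ Finset.range (u + 1), ∑ ν : k.Partition,
        c k ν * MvPolynomial.coeff e (MvPolynomial.psumPart (Fin u) A ν)

open Classical in
/-- The coefficients `c_ν`, `|ν| ≤ u`, of the expansion of a symmetric series in the `p_ν`. -/
def powerSumCoeff {A : Type*} [CommRing A] {u : ℕ} (f : MvPowerSeries (Fin u) A) :
    (k : ℕ) → k.Partition → A :=
  if h : ∃ c, IsPowerSumExpansion f c then h.choose else 0

/-- `z_ν = ∏_i i^{m_i} m_i!`, where `m_i` is the multiplicity of `i` in `ν`. -/
def zFactor {k : ℕ} (ν : k.Partition) : ℕ :=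
  ∏ i ∈ ν.parts.toFinset, i ^ ν.parts.count i * (ν.parts.count i).factorial

/-- The finite inner product `⟨f, g⟩_u` in the variables `ξ_1, …, ξ_u`: the `A`-bilinear form with
`⟨p_ν, p_κ⟩_u = 1_{ν = κ} 1_{|ν| ≤ u} z_ν`. -/
def finiteInner {A : Type*} [CommRing A] {u : ℕ} (f g : MvPowerSeries (Fin u) A) : A :=
  ∑ k ∈ Finset.range (u + 1), ∑ ν : k.Partition,
    (zFactor ν : A) * (powerSumCoeff f k ν * powerSumCoeff g k ν)

/-! ### The nested inner products

In this section `x i`, `y i` are the alphabets `ρ⁺_i` and `ρ⁻_i`.  A series in the variables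
`ξ⁻` (or `ξ⁺`) alone is regarded as a series in both sets of variables through
`MvPowerSeries.map MvPowerSeries.C`. -/

/-- Complex numbers as constants of a `ℂ`-algebra. -/
def const {ι : Type*} (R : Type*) [CommRing R] [Algebra ℂ R] (a : ι → ℂ) : ι → R :=
  fun i => algebraMap ℂ R (a i)

/-- The innermost left entry, a series in `ξ = ξ⁻_1` (`v = u_{1,1}` variables):
`Z(ρ⁺_1, ξ; ρ⁻_0) ∏_j H^{(1)}_{q_j}(ρ⁺_1, ξ, ρ⁻_0; z_j) H^{(2)}_{q_j}(ρ⁺_1, ξ; z_j)`. -/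
def firstEntry {a b d : ℕ} (x : Fin a → ℂ) (y : Fin b → ℂ) (z q : Fin d → ℂ) (v : ℕ) :
    MvPowerSeries (Fin v) ℂ :=
  let ξ : Fin v → MvPowerSeries (Fin v) ℂ := MvPowerSeries.X
  let X := Sum.elim (const (MvPowerSeries (Fin v) ℂ) x) ξ
  let Y := const (MvPowerSeries (Fin v) ℂ) y
  partitionZ X Y * ∏ j, H1 (q j) (z j) (Sum.elim X Y) * H2 (q j) (z j) X

/-- `F(ξ⁻; ξ⁺)`, as a series in `ξ⁻` (`v` variables) over the series in `ξ⁺` (`w` variables). -/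
def linkEntry (v w : ℕ) : MvPowerSeries (Fin v) (MvPowerSeries (Fin w) ℂ) :=
  let ξm : Fin v → MvPowerSeries (Fin v) (MvPowerSeries (Fin w) ℂ) := MvPowerSeries.X
  let ξp : Fin w → MvPowerSeries (Fin v) (MvPowerSeries (Fin w) ℂ) :=
    fun j => MvPowerSeries.C (MvPowerSeries.X j)
  partitionF ξm ξp

/-- The right entry at level `i ≥ 2`, as a series in `ξ⁺ = ξ⁺_{i-1}` (`w` variables) over the series
in `ξ⁻ = ξ⁻_i` (`v` variables), where `x, y, z, q` stand for `ρ⁺_i, ρ⁻_{i-1}, z_i, q_i`: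
`F(ρ⁺_i, ξ⁻; ρ⁻_{i-1}, ξ⁺) ∏_j H^{(1)}_{q_j}(ρ⁻_{i-1}, ξ⁺; z_j) H^{(2)}_{q_j}(ρ⁺_i, ξ⁻; z_j)`. -/
def levelEntry {a b d : ℕ} (x : Fin a → ℂ) (y : Fin b → ℂ) (z q : Fin d → ℂ) (w v : ℕ) :
    MvPowerSeries (Fin w) (MvPowerSeries (Fin v) ℂ) :=
  let ξp : Fin w → MvPowerSeries (Fin w) (MvPowerSeries (Fin v) ℂ) := MvPowerSeries.X
  let ξm : Fin v → MvPowerSeries (Fin w) (MvPowerSeries (Fin v) ℂ) :=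
    fun j => MvPowerSeries.C (MvPowerSeries.X j)
  let X := Sum.elim (const (MvPowerSeries (Fin w) (MvPowerSeries (Fin v) ℂ)) x) ξm
  let Y := Sum.elim (const (MvPowerSeries (Fin w) (MvPowerSeries (Fin v) ℂ)) y) ξp
  partitionF X Y * ∏ j, H1 (q j) (z j) Y * H2 (q j) (z j) X

/-- The nested inner products through the right entry of level `k + 1`, as a series in `ξ⁻_{k+1}`
(`u₁ (k + 1)` variables).  Here `u₁ i = u_{i,1}` and `u₂ i = u_{i,2}`. -/
def nested {n n' d : ℕ → ℕ} (x : (i : ℕ) → Fin (n i) → ℂ) (y : (i : ℕ) → Fin (n' i) → ℂ)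
    (z q : (i : ℕ) → Fin (d i) → ℂ) (u₁ u₂ : ℕ → ℕ) :
    (k : ℕ) → MvPowerSeries (Fin (u₁ (k + 1))) ℂ
  | 0 => firstEntry (x 1) (y 0) (z 1) (q 1) (u₁ 1)
  | k + 1 =>
    let inner : MvPowerSeries (Fin (u₂ (k + 1))) ℂ :=
      finiteInner (MvPowerSeries.map MvPowerSeries.C (nested x y z q u₁ u₂ k))
        (linkEntry (u₁ (k + 1)) (u₂ (k + 1)))
    finiteInner (MvPowerSeries.map MvPowerSeries.C inner)
      (levelEntry (x (k + 2)) (y (k + 1)) (z (k + 2)) (q (k + 2))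
        (u₂ (k + 1)) (u₁ (k + 2)))

/-- The value of the `2 (m - 1)`-fold nested inner product, a complex number.  The truncation
parameters are listed as `u = (u_{1,1}, u_{1,2}, u_{2,1}, u_{2,2}, …, u_{m-1,1}, u_{m-1,2})`.
There are no variables `ξ⁻_m`, that is, `u_{m,1} = 0`. -/
def nestedValue {n n' d : ℕ → ℕ} (m : ℕ) (x : (i : ℕ) → Fin (n i) → ℂ)
    (y : (i : ℕ) → Fin (n' i) → ℂ) (z q : (i : ℕ) → Fin (d i) → ℂ)
    (u : Fin (2 * (m - 1)) → ℕ) : ℂ :=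
  let param : ℕ → ℕ := fun k => if h : k < 2 * (m - 1) then u ⟨k, h⟩ else 0
  MvPowerSeries.constantCoeff
    (nested x y z q (fun i => param (2 * (i - 1))) (fun i => param (2 * (i - 1) + 1)) (m - 1))

/-- `lim_{u_N → ∞} ⋯ lim_{u_2 → ∞} lim_{u_1 → ∞} E(u_1, …, u_N) = L`: all the successive limits exist,
the one in the first variable being taken first, and the last one is `L`. -/
def IsIteratedLimit : (N : ℕ) → ((Fin N → ℕ) → ℂ) → ℂ → Prop
  | 0, E, L => E Fin.elim0 = L
  | N + 1, E, L => ∃ g : (Fin N → ℕ) → ℂ,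
      (∀ v : Fin N → ℕ, Tendsto (fun a : ℕ => E (Fin.cons a v)) atTop (𝓝 (g v))) ∧
        IsIteratedLimit N g L

end PfaffianSchur

end

/-! # Iterated limits of nested inner products of Pfaffian Schur type

Call a symmetric series `c ∏_{i < j} 1 / (1 - ξ_i ξ_j) ∏ 1 / (1 - ξ_i p) ∏ (1 - ξ_i q)`, with
finite alphabets `p` and `q` of complex numbers, a Gaussian series (`gauss`). The theorem holds
because the nested pairings start from a Gaussian series and, in the limit, each level turns a
Gaussian series into another one, in the next set of variables: the alphabets grow by those of the
level, and the constant `c` is multiplied by the interactions of the old alphabets with the new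
ones. The constant after the last level is the limit.

*The entries are products.* The Cauchy identity `F(X; Y) = ∏ 1 / (1 - x y)` (`partitionF_eq`) and
the identity `Z(X; Y) = ∏_{i < j} 1 / (1 - x_i x_j) ∏ 1 / (1 - x y)` (`partitionZ_eq`) both follow
from `∑_λ s_{λ/μ}(Y) s_λ(X) = s_μ(X) ∏ 1 / (1 - x y)` (`hasSum_skew`) and Littlewood's identity
(`hasSum_even`). Partitions with at most `N` parts are encoded as strictly increasing `N`-tuples,
and Schur functions as minors of a Toeplitz matrix. Convergence is controlled by families of
submultiplicative seminorms, which treat complex numbers and formal power series alike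
(`IsSummabilityFamily`). Hence the innermost entry is a Gaussian series (`firstEntry_eq`), while
the other entries are, as series in the variables to be paired, Cauchy kernels
`K ∏ 1 / (1 - ξ b) ∏ (1 - ξ b')` (`linkEntry_eq`, `levelEntry_eq`).

*Pairing with a Cauchy kernel is a substitution.* The products `p_ν` with `|ν| ≤ u` are linearly
independent in `u` variables (`IsPowerSumExpansion.unique`), and the coefficient of `p_ν` in a
Cauchy kernel is `K z_ν⁻¹` times the value of `p_ν` at the formal difference of the alphabets `b`
and `b'` (`isPowerSumExpansion_kernel`). So pairing `f` with the kernel evaluates the truncated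
power sum expansion of `f` at this difference (`finiteInner_kernel`). In particular the pairing
with `F(ξ⁻; ξ⁺)` replaces `ξ⁻` by `ξ⁺`; if there are at least as many variables `ξ⁻` as `ξ⁺`, the
result is the same Gaussian series up to the degrees which matter for the next pairing. The limit
in the number of variables `ξ⁻` is therefore attained (`pairBoth_series`).

*The limit in the number of variables `ξ⁺`.* The power sum coefficients of a Gaussian series do
not depend on the number of variables (`exists_gauss_expansion`), because a Gaussian series is the
exponential of a universal expression in the power sums (`IsPlethysticExp`). Its pairings with a
kernel are thus the partial sums, at `t = 1`, of one power series in `t`, which is the graded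
product `gaussSeries`. Each factor is absolutely summable at `t = 1` by the inequalities between
the moduli, so the limit exists and is the product of the values of the factors
(`hasEval_gaussSeries`, `tendsto_pairLevel`). It is a Gaussian series with the parameters
`LevelData.step`. The remaining pairings are continuous, because they involve only finitely many
coefficients (`nestedFrom_tendsto`), and induction on the number of levels gives all the limits
(`isIteratedLimit_valueFrom`). The final constant is rearranged into the closed form in
`gaussIter_c`. -/

open Filter Topology
open scoped MvPowerSeries.WithPiTopology

noncomputable section

namespace PfaffianSchur

/-! ### Multiplicative pairings of alphabets and complete homogeneous functions -/

section Pairings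

variable {R : Type*} [CommRing R]

/-- `∏_{x ∈ X, y ∈ Y} 1 / (1 - x y)` for finite alphabets given as multisets. -/
def cauchyProd (X Y : Multiset R) : R :=
  (X.map fun x => (Y.map fun y => Ring.inverse (1 - x * y)).prod).prod

/-- `∏_{x ∈ X, y ∈ Y} (1 - x y)` for finite alphabets given as multisets. -/
def dualProd (X Y : Multiset R) : R :=
  (X.map fun x => (Y.map fun y => (1 - x * y)).prod).prod

/-- `∏_{i < j} 1 / (1 - x_i x_j)` for a finite alphabet given as a multiset. -/
def pairProd (X : Multiset R) : R :=
  ((X.powersetCard 2).map fun s => Ring.inverse (1 - s.prod)).prod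

lemma cauchyProd_add_left (X X' Y : Multiset R) :
    cauchyProd (X + X') Y = cauchyProd X Y * cauchyProd X' Y := by
  simp [cauchyProd]

lemma cauchyProd_comm (X Y : Multiset R) : cauchyProd X Y = cauchyProd Y X := by
  unfold cauchyProd
  rw [Multiset.prod_map_prod_map]
  simp_rw [mul_comm]

lemma cauchyProd_add_right (X Y Y' : Multiset R) :
    cauchyProd X (Y + Y') = cauchyProd X Y * cauchyProd X Y' := by
  simp [cauchyProd, Multiset.prod_map_mul]

lemma dualProd_add_left (X X' Y : Multiset R) :
    dualProd (X + X') Y = dualProd X Y * dualProd X' Y := by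
  simp [dualProd]

lemma dualProd_comm (X Y : Multiset R) : dualProd X Y = dualProd Y X := by
  unfold dualProd
  rw [Multiset.prod_map_prod_map]
  simp_rw [mul_comm]

lemma dualProd_add_right (X Y Y' : Multiset R) :
    dualProd X (Y + Y') = dualProd X Y * dualProd X Y' := by
  simp [dualProd, Multiset.prod_map_mul]

@[simp] lemma cauchyProd_zero_left (Y : Multiset R) : cauchyProd 0 Y = 1 := by simp [cauchyProd]

@[simp] lemma cauchyProd_zero_right (Y : Multiset R) : cauchyProd Y 0 = 1 := by simp [cauchyProd]

@[simp] lemma dualProd_zero_left (Y : Multiset R) : dualProd 0 Y = 1 := by simp [dualProd]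

@[simp] lemma dualProd_zero_right (Y : Multiset R) : dualProd Y 0 = 1 := by simp [dualProd]

lemma cauchyProd_cons_left (x : R) (X Y : Multiset R) :
    cauchyProd (x ::ₘ X) Y = cauchyProd {x} Y * cauchyProd X Y := by
  rw [← Multiset.singleton_add, cauchyProd_add_left]

@[simp] lemma pairProd_zero : pairProd (0 : Multiset R) = 1 := by
  simp [pairProd, Multiset.powersetCard_zero_right]

lemma pairProd_cons (x : R) (X : Multiset R) :
    pairProd (x ::ₘ X) = pairProd X * cauchyProd {x} X := by
  simp [pairProd, Multiset.powersetCard_cons, Multiset.powersetCard_one, cauchyProd]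

lemma pairProd_add (X Y : Multiset R) :
    pairProd (X + Y) = pairProd X * pairProd Y * cauchyProd X Y := by
  induction X using Multiset.induction_on with
  | empty => simp
  | cons x X ih =>
    rw [Multiset.cons_add, pairProd_cons, ih, pairProd_cons, cauchyProd_add_right,
      cauchyProd_cons_left x X Y]
    ring

end Pairings

section Complete

variable {R : Type*} [CommRing R]

/-- The generating series `∏_{x ∈ X} 1 / (1 - x t)` of the complete homogeneous functions. -/
def hSeries (X : Multiset R) : PowerSeries R :=
  (X.map fun x => PowerSeries.mk fun n => x ^ n).prod

/-- The complete homogeneous function `h_k(X)`, `k ∈ ℤ`, of a multiset. -/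
def hZ (X : Multiset R) (k : ℤ) : R :=
  if 0 ≤ k then PowerSeries.coeff k.toNat (hSeries X) else 0

lemma hZ_natCast (X : Multiset R) (k : ℕ) : hZ X k = PowerSeries.coeff k (hSeries X) := by
  simp [hZ]

lemma hZ_of_neg (X : Multiset R) {k : ℤ} (hk : k < 0) : hZ X k = 0 := by
  simp [hZ, hk]

lemma hSeries_cons (x : R) (X : Multiset R) :
    hSeries (x ::ₘ X) = PowerSeries.mk (fun n => x ^ n) * hSeries X := by
  simp [hSeries]

lemma hSeries_add (X Y : Multiset R) : hSeries (X + Y) = hSeries X * hSeries Y := by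
  simp [hSeries]

lemma geom_mul_one_sub (x : R) :
    PowerSeries.mk (fun n => x ^ n) * (1 - PowerSeries.C x * PowerSeries.X) = 1 := by
  ext n
  rw [mul_sub, mul_one, mul_left_comm, map_sub, PowerSeries.coeff_C_mul]
  cases n with
  | zero => simp
  | succ n => rw [PowerSeries.coeff_succ_mul_X]; simp [pow_succ']

lemma hZ_zero (X : Multiset R) : hZ X 0 = 1 := by
  have : hZ X 0 = PowerSeries.coeff 0 (hSeries X) := by simp [hZ]
  rw [this]
  induction X using Multiset.induction_on with
  | empty => simp [hSeries]
  | cons x X ih => rw [hSeries_cons]; simpa using ih (by simp [hZ])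

lemma hZ_empty (k : ℤ) : hZ (0 : Multiset R) k = if k = 0 then 1 else 0 := by
  unfold hZ
  by_cases hk : 0 ≤ k
  · lift k to ℕ using hk
    simp [hSeries, PowerSeries.coeff_one]
  · rw [if_neg hk, if_neg (by omega)]

lemma hZ_cons (x : R) (X : Multiset R) (k : ℤ) :
    hZ (x ::ₘ X) k = hZ X k + x * hZ (x ::ₘ X) (k - 1) := by
  have key : hSeries (x ::ₘ X) = hSeries X
      + PowerSeries.C x * (hSeries (x ::ₘ X) * PowerSeries.X) := by
    have := geom_mul_one_sub x
    rw [hSeries_cons]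
    linear_combination (hSeries X) * this
  rcases lt_trichotomy k 0 with hk | hk | hk
  · rw [hZ_of_neg _ hk, hZ_of_neg _ hk, hZ_of_neg _ (by omega)]; simp
  · subst hk; rw [hZ_zero, hZ_zero, hZ_of_neg _ (by omega)]; simp
  · obtain ⟨n, rfl⟩ : ∃ n : ℕ, k = ((n + 1 : ℕ) : ℤ) := ⟨(k - 1).toNat, by omega⟩
    have h1 : ((n + 1 : ℕ) : ℤ) - 1 = (n : ℤ) := by push_cast; ring
    rw [h1, hZ_natCast, hZ_natCast, hZ_natCast]
    conv_lhs => rw [key]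
    rw [map_add, PowerSeries.coeff_C_mul, PowerSeries.coeff_succ_mul_X]

lemma hZ_singleton (x : R) (k : ℤ) : hZ {x} k = if 0 ≤ k then x ^ k.toNat else 0 := by
  simp [hZ, hSeries]

lemma hZ_cons_zero (X : Multiset R) (k : ℤ) : hZ ((0 : R) ::ₘ X) k = hZ X k := by
  rw [hZ_cons]; simp

lemma hZ_add_natCast (X Y : Multiset R) (n : ℕ) :
    hZ (X + Y) n = ∑ p ∈ Finset.HasAntidiagonal.antidiagonal n, hZ X p.1 * hZ Y p.2 := by
  rw [hZ_natCast, hSeries_add, PowerSeries.coeff_mul]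
  simp_rw [hZ_natCast]

/-- Convolution over a window `[0, L]` of intermediate indices. -/
lemma hZ_add_window (X Y : Multiset R) (a b L : ℕ) (ha : a ≤ L) :
    hZ (X + Y) ((a : ℤ) - b) =
      ∑ c ∈ Finset.range (L + 1), hZ X ((a : ℤ) - c) * hZ Y ((c : ℤ) - b) := by
  by_cases hab : b ≤ a
  · have e : ((a : ℤ) - b) = ((a - b : ℕ) : ℤ) := by omega
    rw [e, hZ_add_natCast]
    rw [← Finset.sum_subset (s₁ := Finset.Icc b a) (fun c hc => by simp at hc ⊢; omega)]
    · refine Finset.sum_bij' (fun p _ => p.2 + b) (fun c _ => (a - c, c - b)) ?_ ?_ ?_ ?_ ?_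
      · intro p hp; simp at hp ⊢; omega
      · intro c hc; simp at hc ⊢; omega
      · intro p hp; simp at hp; ext <;> simp; omega
      · intro c hc; simp at hc ⊢; omega
      · intro p hp
        simp at hp
        congr 2 <;> push_cast <;> omega
    · intro c _ hc
      simp at hc
      by_cases h : b ≤ c
      · have := hc h
        rw [hZ_of_neg X (by omega)]; simp
      · rw [hZ_of_neg Y (by omega)]; simp
  · rw [hZ_of_neg _ (by omega)]
    symm
    refine Finset.sum_eq_zero fun c _ => ?_
    by_cases h : b ≤ c
    · rw [hZ_of_neg X (by omega)]; simp
    · rw [hZ_of_neg Y (by omega)]; simp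

lemma complete_eq_hZ {ι : Type*} [Fintype ι] [DecidableEq ι] (a : ι → R) (k : ℤ) :
    complete a k = hZ (Finset.univ.val.map a) k := by
  unfold complete hZ
  split_ifs with hk
  · generalize k.toNat = n
    have h1 : hSeries (Finset.univ.val.map a) = ∏ i, PowerSeries.mk fun n => a i ^ n := by
      simp [hSeries]
    rw [h1, PowerSeries.coeff_prod, MvPolynomial.hsymm, map_sum]
    refine Finset.sum_bij (fun (s : Sym ι n) _ => Multiset.toFinsupp s.1) ?_ ?_ ?_ ?_
    · intro s _
      rw [Finset.mem_finsuppAntidiag]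
      refine ⟨?_, Finset.subset_univ _⟩
      show ∑ i, Multiset.count i s.1 = n
      rw [Multiset.sum_count_eq_card (fun _ _ => Finset.mem_univ _)]
      exact s.2
    · intro s _ t _ h
      exact Sym.ext (Multiset.toFinsupp.injective h)
    · intro l hl
      rw [Finset.mem_finsuppAntidiag] at hl
      refine ⟨⟨Finsupp.toMultiset l, ?_⟩, Finset.mem_univ _, by simp⟩
      rw [Finsupp.card_toMultiset, ← hl.1, Finsupp.sum_fintype _ _ (fun _ => rfl)]
      rfl
    · intro s _
      rw [map_multiset_prod, Multiset.map_map]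
      simp only [Function.comp_def, MvPolynomial.eval_X, PowerSeries.coeff_mk,
        Multiset.toFinsupp_apply]
      rw [Finset.prod_multiset_map_count]
      refine Finset.prod_subset (Finset.subset_univ _) fun i _ hi => ?_
      rw [Multiset.mem_toFinset, ← Multiset.count_eq_zero] at hi
      rw [hi, pow_zero]
  · rfl

end Complete

/-! ### The Cauchy–Binet formula and minors of complete homogeneous functions -/

section CauchyBinet

variable {R : Type*} [CommRing R] {N : ℕ}

open Classical in
/-- The strictly increasing `N`-tuples with entries at most `L`. -/
def strictTuples (N L : ℕ) : Finset (Fin N → ℕ) :=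
  (Fintype.piFinset fun _ => Finset.range (L + 1)).filter StrictMono

lemma mem_strictTuples {L : ℕ} {l : Fin N → ℕ} :
    l ∈ strictTuples N L ↔ (∀ i, l i ≤ L) ∧ StrictMono l := by
  simp [strictTuples]

/-- The Cauchy–Binet formula, with the intermediate index running over `[0, L]`. -/
lemma sum_strictTuples_det_mul_det (A B : ℕ → Fin N → R) (L : ℕ) :
    ∑ l ∈ strictTuples N L,
        (Matrix.of fun i j => A (l i) j).det * (Matrix.of fun i j => B (l i) j).det =
      (Matrix.of fun j k => ∑ c ∈ Finset.range (L + 1), A c j * B c k).det := by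
  classical
  have h1 : (Matrix.of fun j k => ∑ c ∈ Finset.range (L + 1), A c j * B c k).det =
      ∑ f ∈ Fintype.piFinset (fun _ : Fin N => Finset.range (L + 1)),
        (∏ j, A (f j) j) * (Matrix.of fun i j => B (f i) j).det := by
    have : (Matrix.of fun j k => ∑ c ∈ Finset.range (L + 1), A c j * B c k) =
        fun j => ∑ c ∈ Finset.range (L + 1), A c j • B c := by
      ext j k; simp [Finset.sum_apply]
    rw [this]
    show Matrix.detRowAlternating.toMultilinearMap _ = _
    rw [MultilinearMap.map_sum_finset]
    refine Finset.sum_congr rfl fun f _ => ?_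
    rw [MultilinearMap.map_smul_univ]
    rfl
  have h2 : ∑ f ∈ Fintype.piFinset (fun _ : Fin N => Finset.range (L + 1)),
        (∏ j, A (f j) j) * (Matrix.of fun i j => B (f i) j).det =
      ∑ f ∈ (Fintype.piFinset (fun _ : Fin N => Finset.range (L + 1))).filter
          Function.Injective, (∏ j, A (f j) j) * (Matrix.of fun i j => B (f i) j).det := by
    rw [Finset.sum_filter]
    refine Finset.sum_congr rfl fun f _ => ?_
    split_ifs with hf
    · rfl
    · simp only [Function.Injective] at hf
      push Not at hf
      obtain ⟨a, b, hab, hne⟩ := hf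
      rw [Matrix.det_zero_of_row_eq hne (by ext k; simp [hab]), mul_zero]
  rw [h1, h2]
  have h3 : ∀ l ∈ strictTuples N L,
      (Matrix.of fun i j => A (l i) j).det * (Matrix.of fun i j => B (l i) j).det =
      ∑ σ : Equiv.Perm (Fin N), (∏ j, A (l (σ j)) j) *
        (Matrix.of fun i j => B (l (σ i)) j).det := by
    intro l _
    rw [Matrix.det_apply, Finset.sum_mul]
    refine Finset.sum_congr rfl fun σ _ => ?_
    have := Matrix.det_permute σ (Matrix.of fun i j => B (l i) j)
    have h : (Matrix.of fun i j => B (l (σ i)) j) =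
      (Matrix.of fun i j => B (l i) j).submatrix σ id := by ext; rfl
    rw [h, this]
    simp only [Matrix.of_apply, Units.smul_def, zsmul_eq_mul]
    ring
  rw [Finset.sum_congr rfl h3, ← Finset.sum_product']
  refine Finset.sum_bij (fun p _ => p.1 ∘ p.2) ?_ ?_ ?_ ?_
  · rintro ⟨l, σ⟩ h
    simp only [Finset.mem_product, mem_strictTuples, Finset.mem_univ, and_true] at h
    simp only [Finset.mem_filter, Fintype.mem_piFinset, Finset.mem_range, Function.comp]
    exact ⟨fun i => Nat.lt_succ_of_le (h.1 _), h.2.injective.comp σ.injective⟩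
  · rintro ⟨l, σ⟩ h ⟨l', σ'⟩ h' heq
    simp only [Finset.mem_product, mem_strictTuples, Finset.mem_univ, and_true] at h h'
    simp only at heq
    have hl : l = l' := by
      refine StrictMono.range_inj h.2 h'.2 |>.mp ?_
      have := congrArg Set.range heq
      rwa [EquivLike.range_comp, EquivLike.range_comp] at this
    subst hl
    refine Prod.ext rfl (Equiv.ext fun i => h.2.injective (congrFun heq i))
  · intro f hf
    simp only [Finset.mem_filter, Fintype.mem_piFinset, Finset.mem_range] at hf
    refine ⟨(f ∘ Tuple.sort f, (Tuple.sort f)⁻¹), ?_, ?_⟩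
    · simp only [Finset.mem_product, mem_strictTuples, Finset.mem_univ, and_true]
      exact ⟨fun i => Nat.le_of_lt_succ (hf.1 _), (Tuple.monotone_sort f).strictMono_of_injective
        (hf.2.comp (Equiv.injective _))⟩
    · ext i; simp
  · rintro ⟨l, σ⟩ _; rfl

/-- The minor `det (h_{l_i - m_j}(X))`. With `l_i = λ_{N - i} + i` and `m_j = μ_{N - j} + j`,
`0 ≤ i, j < N`, it is the skew Schur function `s_{λ/μ}(X)`. -/
def hMinor (X : Multiset R) (l m : Fin N → ℕ) : R :=
  (Matrix.of fun i j => hZ X ((l i : ℤ) - (m j : ℤ))).det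

/-- The tuple `(0, 1, …, N - 1)`, which encodes the empty partition. -/
def emptyTuple (N : ℕ) : Fin N → ℕ := fun i => i

lemma emptyTuple_strictMono : StrictMono (emptyTuple N) := fun _ _ h => h

lemma le_of_strictMono {l : Fin N → ℕ} (hl : StrictMono l) (i : Fin N) : (i : ℕ) ≤ l i := by
  obtain ⟨i, hi⟩ := i
  induction i with
  | zero => simp
  | succ k ih =>
    have h1 := ih (by omega)
    have h2 : l ⟨k, by omega⟩ < l ⟨k + 1, hi⟩ := hl (by simp)
    simp only at h1 ⊢
    omega

/-- A square matrix with a zero block of size `r × s`, `r + s > N`, has determinant zero. -/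
lemma det_eq_zero_of_zero_block (M : Matrix (Fin N) (Fin N) R) (k : Fin N)
    (h : ∀ i j, i ≤ k → k ≤ j → M i j = 0) : M.det = 0 := by
  rw [Matrix.det_apply']
  refine Finset.sum_eq_zero fun σ _ => ?_
  -- the columns `≥ k` cannot all be matched with rows `> k`
  obtain ⟨j, hj, hσ⟩ : ∃ j, k ≤ j ∧ σ j ≤ k := by
    by_contra! hcon
    have hsub : (Finset.Ici k).map σ.toEmbedding ⊆ Finset.Ioi k := by
      intro x hx
      simp only [Finset.mem_map, Finset.mem_Ici] at hx
      obtain ⟨j, hj, rfl⟩ := hx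
      exact Finset.mem_Ioi.mpr (hcon j hj)
    have := Finset.card_le_card hsub
    rw [Finset.card_map, Fin.card_Ici, Fin.card_Ioi] at this
    omega
  exact mul_eq_zero_of_right _ (Finset.prod_eq_zero (Finset.mem_univ j) (h _ _ hσ hj))

lemma hMinor_eq_zero (X : Multiset R) {l m : Fin N → ℕ} (hl : StrictMono l) (hm : StrictMono m)
    (k : Fin N) (hk : l k < m k) : hMinor X l m = 0 := by
  refine det_eq_zero_of_zero_block _ k fun i j hi hj => ?_
  have h1 := hl.monotone hi
  have h2 := hm.monotone hj
  exact hZ_of_neg _ (by omega)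

lemma le_of_hMinor_ne_zero {X : Multiset R} {l m : Fin N → ℕ} (hl : StrictMono l)
    (hm : StrictMono m) (h : hMinor X l m ≠ 0) (k : Fin N) : m k ≤ l k := by
  by_contra! hk
  exact h (hMinor_eq_zero X hl hm k hk)

lemma hMinor_empty {l m : Fin N → ℕ} (hl : StrictMono l) (hm : StrictMono m) :
    hMinor (0 : Multiset R) l m = if l = m then 1 else 0 := by
  split_ifs with h
  · subst h
    unfold hMinor
    convert Matrix.det_one (R := R) (n := Fin N) using 2
    ext i j
    simp only [Matrix.of_apply, hZ_empty, Matrix.one_apply]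
    have : ((l i : ℤ) - (l j : ℤ) = 0) ↔ i = j := by
      rw [sub_eq_zero, Nat.cast_inj, hl.injective.eq_iff]
    simp [this]
  · by_contra hne
    have hle := le_of_hMinor_ne_zero hl hm hne
    apply hne
    by_cases hall : ∃ i, ∀ j, l i ≠ m j
    · obtain ⟨i, hi⟩ := hall
      refine Matrix.det_eq_zero_of_row_eq_zero i fun j => ?_
      have := hi j
      simp only [Matrix.of_apply, hZ_empty]
      rw [if_neg (by omega)]
    · push Not at hall
      exfalso
      apply h
      refine (StrictMono.range_inj hl hm).mp ?_
      refine Set.eq_of_subset_of_ncard_le ?_ ?_ (Set.finite_range _)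
      · rintro _ ⟨i, rfl⟩
        obtain ⟨j, hj⟩ := hall i
        exact ⟨j, hj.symm⟩
      · rw [← Set.image_univ, ← Set.image_univ, Set.ncard_image_of_injective _ hl.injective,
          Set.ncard_image_of_injective _ hm.injective]

/-- Branching `s_{λ/μ}(X, Y) = ∑_κ s_{λ/κ}(X) s_{κ/μ}(Y)`. -/
lemma hMinor_add (X Y : Multiset R) {l m : Fin N → ℕ} {L : ℕ} (hL : ∀ i, l i ≤ L) :
    hMinor (X + Y) l m = ∑ k ∈ strictTuples N L, hMinor X l k * hMinor Y k m := by
  have h := sum_strictTuples_det_mul_det (fun c i => hZ X ((l i : ℤ) - c))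
    (fun c j => hZ Y ((c : ℤ) - m j)) L
  unfold hMinor
  have e : (Matrix.of fun i j => hZ (X + Y) ((l i : ℤ) - m j)) =
      Matrix.of fun j k => ∑ c ∈ Finset.range (L + 1),
        hZ X ((l j : ℤ) - c) * hZ Y ((c : ℤ) - m k) := by
    ext i j
    exact hZ_add_window X Y _ _ L (hL i)
  rw [e, ← h]
  refine Finset.sum_congr rfl fun k _ => ?_
  congr 1
  rw [← Matrix.det_transpose]
  rfl

/-- Minors of a one-variable alphabet: interlacing tuples. -/
lemma hMinor_singleton_of_interlace (x : R) {l m : Fin N → ℕ} (h1 : ∀ i, m i ≤ l i)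
    (h2 : ∀ i j, i < j → l i < m j) :
    hMinor {x} l m = x ^ (∑ i, (l i - m i)) := by
  unfold hMinor
  rw [Matrix.det_of_isLowerTriangular]
  · rw [← Finset.prod_pow_eq_pow_sum]
    refine Finset.prod_congr rfl fun i _ => ?_
    have := h1 i
    rw [Matrix.of_apply, hZ_singleton, if_pos (by omega)]
    congr 1
    omega
  · intro i j hij
    have := h2 i j (by simpa using hij)
    exact hZ_of_neg _ (by omega)

/-- If `l` and `m` do not interlace, two neighbouring rows of the one-variable minor are
proportional. -/
lemma interlace_of_hMinor_singleton_ne_zero {x : R} {l m : Fin N → ℕ} (hl : StrictMono l)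
    (hm : StrictMono m) (h : hMinor {x} l m ≠ 0) {i j : Fin N} (hij : i < j) : l i < m j := by
  by_contra! hcon
  apply h
  -- it is enough to treat neighbours, and the last pair of neighbours at fault
  have hex : ∃ a : ℕ, ∃ ha : a + 1 < N, m ⟨a + 1, ha⟩ ≤ l ⟨a, by omega⟩ := by
    refine ⟨i, by omega, ?_⟩
    refine le_trans (hm.monotone ?_) hcon
    rw [Fin.le_def]; simp only; omega
  have hbdd : ∀ a : ℕ, (∃ ha : a + 1 < N, m ⟨a + 1, ha⟩ ≤ l ⟨a, by omega⟩) → a ≤ N := by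
    rintro a ⟨ha, _⟩; omega
  classical
  obtain ⟨a, ⟨ha, hle⟩, hmax⟩ : ∃ a : ℕ, (∃ ha : a + 1 < N, m ⟨a + 1, ha⟩ ≤ l ⟨a, by omega⟩) ∧
      ∀ b, (∃ hb : b + 1 < N, m ⟨b + 1, hb⟩ ≤ l ⟨b, by omega⟩) → b ≤ a := by
    obtain ⟨a0, h0⟩ := hex
    exact ⟨_, Nat.findGreatest_spec
      (P := fun a => ∃ ha : a + 1 < N, m ⟨a + 1, ha⟩ ≤ l ⟨a, by omega⟩) (hbdd a0 h0) h0,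
      fun b hb => Nat.le_findGreatest (hbdd b hb) hb⟩
  set r : Fin N := ⟨a, by omega⟩
  set s : Fin N := ⟨a + 1, ha⟩
  have hrs : r ≠ s := by simp [r, s]
  set M : Matrix (Fin N) (Fin N) R := Matrix.of fun i j => hZ {x} ((l i : ℤ) - (m j : ℤ))
  have hls : l r < l s := hl (by simp [r, s, Fin.lt_def])
  -- row `s` is a multiple of row `r`
  have hrow : M s = x ^ (l s - l r) • M r := by
    ext j
    simp only [Pi.smul_apply, smul_eq_mul, M, Matrix.of_apply, hZ_singleton]
    by_cases hj : j ≤ s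
    · have := hm.monotone hj
      rw [if_pos (by omega), if_pos (by omega), ← pow_add]
      congr 1
      omega
    · have hlt : l s < m j := by
        have hsucc : a + 1 + 1 < N := by
          have : (s : ℕ) < j := by simpa using hj
          have := j.2
          simp only [s] at *
          omega
        by_contra! hc
        have h3 := hmax (a + 1) ⟨hsucc, ?_⟩
        · omega
        · refine le_trans (hm.monotone ?_) hc
          have : (s : ℕ) < j := by simpa using hj
          simp only [s] at this
          rw [Fin.le_def]; simp only; omega
      rw [if_neg (by omega), if_neg (by omega), mul_zero]
  have : M = M.updateRow s (x ^ (l s - l r) • M r) := by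
    rw [← hrow, Matrix.updateRow_eq_self]
  show M.det = 0
  rw [this, Matrix.det_updateRow_smul, Matrix.det_updateRow_eq_zero hrs, mul_zero]

/-- The Schur function of an alphabet `X` vanishes on partitions with more than `#X` parts. -/
lemma eq_of_hMinor_emptyTuple_ne_zero {X : Multiset R} {l : Fin N → ℕ} (hl : StrictMono l)
    (h : hMinor X l (emptyTuple N) ≠ 0) (i : Fin N) (hi : (i : ℕ) + X.card < N) : l i = i := by
  induction X using Multiset.induction_on generalizing l i with
  | empty =>
    rw [hMinor_empty hl emptyTuple_strictMono] at h
    have : l = emptyTuple N := by by_contra hc; simp [hc] at h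
    rw [this]; rfl
  | cons x X ih =>
    rw [← Multiset.singleton_add, hMinor_add _ _ (fun i => Finset.le_sup
      (f := l) (Finset.mem_univ i))] at h
    obtain ⟨k, hk, hne⟩ := Finset.exists_ne_zero_of_sum_ne_zero h
    rw [mem_strictTuples] at hk
    rw [Multiset.card_cons] at hi
    have h1 := ih hk.2 (right_ne_zero_of_mul hne) ⟨i + 1, by omega⟩ (by simp only; omega)
    have h2 := interlace_of_hMinor_singleton_ne_zero hl hk.2 (left_ne_zero_of_mul hne)
      (i := i) (j := ⟨i + 1, by omega⟩) (by simp [Fin.lt_def])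
    have h3 := le_of_strictMono hl i
    simp only at h1
    omega

end CauchyBinet

/-! ### Absolute summability and evaluation of power series at one -/

section Summability

/-- A family of submultiplicative seminorms on a topological ring such that every family of
elements which is summable in all of them is summable. The examples are the norm of `ℂ` and
truncated weighted `ℓ¹`-seminorms on rings of formal power series. -/
structure IsSummabilityFamily {R : Type*} [CommRing R] [TopologicalSpace R]
    (P : Set (RingSeminorm R)) : Prop where
  one_le : ∀ p ∈ P, p 1 ≤ 1
  summable : ∀ {ι : Type} (f : ι → R), (∀ p ∈ P, Summable fun i => p (f i)) → Summable f

/-- An element all of whose seminorms are smaller than one. -/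
def Small {R : Type*} [CommRing R] (P : Set (RingSeminorm R)) (c : R) : Prop :=
  ∀ p ∈ P, p c < 1

/-- The power series `F` is absolutely summable at `1`, with value `r`. -/
def HasEval {R : Type*} [CommRing R] [TopologicalSpace R] (P : Set (RingSeminorm R))
    (F : PowerSeries R) (r : R) : Prop :=
  (∀ p ∈ P, Summable fun n => p (PowerSeries.coeff n F)) ∧
    HasSum (fun n => PowerSeries.coeff n F) r

lemma seminorm_sum_le {R ι : Type*} [CommRing R] (p : RingSeminorm R) (s : Finset ι) (f : ι → R) :
    p (∑ i ∈ s, f i) ≤ ∑ i ∈ s, p (f i) :=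
  Finset.le_sum_of_subadditive p (map_zero p).le (map_add_le_add p) s f

lemma seminorm_pow_le {R : Type*} [CommRing R] (p : RingSeminorm R) (hp : p 1 ≤ 1) (c : R)
    (n : ℕ) : p (c ^ n) ≤ p c ^ n := by
  induction n with
  | zero => simpa using hp
  | succ n ih =>
    rw [pow_succ, pow_succ]
    exact (map_mul_le_mul p _ _).trans (mul_le_mul_of_nonneg_right ih (apply_nonneg p c))

lemma seminorm_prod_le {R ι : Type*} [CommRing R] (p : RingSeminorm R) (hp : p 1 ≤ 1)
    (s : Finset ι) (f : ι → R) : p (∏ i ∈ s, f i) ≤ ∏ i ∈ s, p (f i) := by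
  classical
  induction s using Finset.induction_on with
  | empty => simpa using hp
  | insert a s ha ih =>
    rw [Finset.prod_insert ha, Finset.prod_insert ha]
    exact (map_mul_le_mul p _ _).trans (mul_le_mul_of_nonneg_left ih (apply_nonneg p _))

lemma isSummabilityFamily_complex : IsSummabilityFamily {normRingSeminorm ℂ} where
  one_le := by rintro p rfl; exact (norm_one (α := ℂ)).le
  summable f h := Summable.of_norm (h _ rfl)

lemma small_complex_iff (c : ℂ) : Small {normRingSeminorm ℂ} c ↔ ‖c‖ < 1 :=
  ⟨fun h => h _ rfl, by rintro h p rfl; exact h⟩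

/-- The seminorm `∑_{e ≤ E} p(f_e) ρ^{|e|}` on formal power series. -/
def boxSeminorm {σ R : Type*} [CommRing R] (p : RingSeminorm R) (ρ : ℝ) (hρ : 0 < ρ)
    (E : σ →₀ ℕ) : RingSeminorm (MvPowerSeries σ R) := by
  classical
  exact
  { toFun := fun f => ∑ e ∈ Finset.Iic E, p (MvPowerSeries.coeff e f) * ρ ^ e.degree
    map_zero' := by simp
    add_le' := fun f g => by
      rw [← Finset.sum_add_distrib]
      refine Finset.sum_le_sum fun e _ => ?_
      rw [← add_mul, map_add]
      exact mul_le_mul_of_nonneg_right (map_add_le_add p _ _) (by positivity)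
    neg' := fun f => by simp
    mul_le' := fun f g => by
      have h1 : ∀ e ∈ Finset.Iic E, p (MvPowerSeries.coeff e (f * g)) * ρ ^ e.degree ≤
          ∑ x ∈ Finset.HasAntidiagonal.antidiagonal e,
            (p (MvPowerSeries.coeff x.1 f) * ρ ^ x.1.degree) *
              (p (MvPowerSeries.coeff x.2 g) * ρ ^ x.2.degree) := by
        intro e _
        rw [MvPowerSeries.coeff_mul]
        refine (mul_le_mul_of_nonneg_right (seminorm_sum_le p _ _) (by positivity)).trans ?_
        rw [Finset.sum_mul]
        refine Finset.sum_le_sum fun x hx => ?_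
        rw [Finset.HasAntidiagonal.mem_antidiagonal] at hx
        rw [← hx, map_add, pow_add]
        calc p (MvPowerSeries.coeff x.1 f * MvPowerSeries.coeff x.2 g) *
              (ρ ^ x.1.degree * ρ ^ x.2.degree)
            ≤ (p (MvPowerSeries.coeff x.1 f) * p (MvPowerSeries.coeff x.2 g)) *
              (ρ ^ x.1.degree * ρ ^ x.2.degree) :=
              mul_le_mul_of_nonneg_right (map_mul_le_mul p _ _) (by positivity)
          _ = _ := by ring
      refine (Finset.sum_le_sum h1).trans ?_
      rw [Finset.sum_mul_sum, ← Finset.sum_product', Finset.sum_sigma']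
      refine le_of_eq_of_le (Finset.sum_bij (t := ((Finset.Iic E).sigma fun e =>
        Finset.HasAntidiagonal.antidiagonal e).image fun y => y.2)
        (g := fun x => (p (MvPowerSeries.coeff x.1 f) * ρ ^ x.1.degree) *
              (p (MvPowerSeries.coeff x.2 g) * ρ ^ x.2.degree))
        (fun y _ => y.2) (fun y hy => Finset.mem_image_of_mem _ hy) ?_ ?_ (fun _ _ => rfl)) ?_
      · rintro ⟨e, x⟩ h ⟨e', x'⟩ h' heq
        simp only [Finset.mem_sigma, Finset.HasAntidiagonal.mem_antidiagonal] at h h' heq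
        subst heq
        obtain rfl : e = e' := h.2.symm.trans h'.2
        rfl
      · intro x hx
        simpa using hx
      · refine Finset.sum_le_sum_of_subset_of_nonneg ?_ fun x _ _ => ?_
        · intro x hx
          simp only [Finset.mem_image, Finset.mem_sigma, Finset.mem_Iic,
            Finset.HasAntidiagonal.mem_antidiagonal] at hx
          obtain ⟨⟨e, y⟩, ⟨h1, h2⟩, rfl⟩ := hx
          simp only at h1 h2 ⊢
          rw [Finset.mem_product, Finset.mem_Iic, Finset.mem_Iic]
          exact ⟨(h2 ▸ le_self_add : y.1 ≤ e).trans h1, (h2 ▸ le_add_self : y.2 ≤ e).trans h1⟩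
        · have := apply_nonneg p (MvPowerSeries.coeff x.1 f)
          have := apply_nonneg p (MvPowerSeries.coeff x.2 g)
          positivity }

lemma boxSeminorm_apply {σ R : Type*} [CommRing R] (p : RingSeminorm R) (ρ : ℝ) (hρ : 0 < ρ)
    (E : σ →₀ ℕ) (f : MvPowerSeries σ R) [LocallyFiniteOrderBot (σ →₀ ℕ)] :
    boxSeminorm p ρ hρ E f = ∑ e ∈ Finset.Iic E, p (MvPowerSeries.coeff e f) * ρ ^ e.degree := by
  classical
  show Finset.sum _ _ = _
  refine Finset.sum_congr ?_ fun _ _ => rfl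
  ext; simp

/-- The family of all truncated weighted `ℓ¹`-seminorms over a given family on the coefficients. -/
def boxFamily {σ R : Type*} [CommRing R] (P : Set (RingSeminorm R)) (ρ : ℝ) (hρ : 0 < ρ) :
    Set (RingSeminorm (MvPowerSeries σ R)) :=
  {s | ∃ p ∈ P, ∃ E : σ →₀ ℕ, s = boxSeminorm p ρ hρ E}

lemma boxSeminorm_C {σ R : Type*} [CommRing R] (p : RingSeminorm R) (ρ : ℝ) (hρ : 0 < ρ)
    (E : σ →₀ ℕ) (a : R) : boxSeminorm p ρ hρ E (MvPowerSeries.C a) = p a := by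
  classical
  rw [boxSeminorm_apply, Finset.sum_eq_single 0]
  · simp
  · intro e _ he
    rw [MvPowerSeries.coeff_C, if_neg he]
    simp
  · simp

lemma boxSeminorm_X_le {σ R : Type*} [CommRing R] (p : RingSeminorm R) (hp : p 1 ≤ 1) (ρ : ℝ)
    (hρ : 0 < ρ) (E : σ →₀ ℕ) (i : σ) :
    boxSeminorm p ρ hρ E (MvPowerSeries.X i : MvPowerSeries σ R) ≤ ρ := by
  classical
  rw [boxSeminorm_apply]
  calc _ ≤ ∑ e ∈ Finset.Iic E, if e = Finsupp.single i 1 then ρ else 0 := by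
        refine Finset.sum_le_sum fun e _ => ?_
        rw [MvPowerSeries.coeff_X]
        split_ifs with h
        · subst h
          rw [Finsupp.degree_single, pow_one]
          exact mul_le_of_le_one_left hρ.le hp
        · simp
    _ ≤ ρ := by
        rw [Finset.sum_ite_eq']
        split_ifs
        · exact le_rfl
        · exact hρ.le

lemma isSummabilityFamily_box {σ R : Type*} [CommRing R] [TopologicalSpace R]
    {P : Set (RingSeminorm R)} (hP : IsSummabilityFamily P) (ρ : ℝ) (hρ : 0 < ρ) :
    IsSummabilityFamily (boxFamily (σ := σ) P ρ hρ) where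
  one_le := by
    rintro _ ⟨p, hp, E, rfl⟩
    rw [← map_one MvPowerSeries.C, boxSeminorm_C]
    exact hP.one_le p hp
  summable f h := by
    classical
    rw [MvPowerSeries.WithPiTopology.summable_iff_summable_coeff]
    intro d
    refine hP.summable _ fun p hp => ?_
    have h1 := (h _ ⟨p, hp, d, rfl⟩).mul_right ((ρ ^ d.degree)⁻¹)
    refine Summable.of_nonneg_of_le (fun _ => apply_nonneg p _) (fun i => ?_) h1
    rw [le_mul_inv_iff₀ (by positivity), boxSeminorm_apply]
    exact Finset.single_le_sum (f := fun e => p (MvPowerSeries.coeff e (f i)) * ρ ^ e.degree)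
      (fun e _ => mul_nonneg (apply_nonneg p _) (by positivity)) (by simp)

lemma Small.box_C {σ R : Type*} [CommRing R] {P : Set (RingSeminorm R)} {ρ : ℝ} {hρ : 0 < ρ}
    {a : R} (ha : Small P a) :
    Small (boxFamily (σ := σ) P ρ hρ) (MvPowerSeries.C a) := by
  rintro _ ⟨p, hp, E, rfl⟩
  rw [boxSeminorm_C]
  exact ha p hp

lemma small_box_X {σ R : Type*} [CommRing R] [TopologicalSpace R] {P : Set (RingSeminorm R)}
    (hP : IsSummabilityFamily P) {ρ : ℝ} {hρ : 0 < ρ} (hρ1 : ρ < 1) (i : σ) :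
    Small (boxFamily (σ := σ) P ρ hρ) (MvPowerSeries.X i) := by
  rintro _ ⟨p, hp, E, rfl⟩
  exact (boxSeminorm_X_le p (hP.one_le p hp) ρ hρ E i).trans_lt hρ1

lemma Small.mul {R : Type*} [CommRing R] {P : Set (RingSeminorm R)} {a b : R} (ha : Small P a)
    (hb : Small P b) : Small P (a * b) := fun p hp =>
  (map_mul_le_mul p a b).trans_lt (mul_lt_one_of_nonneg_of_lt_one_left (apply_nonneg p a)
    (ha p hp) (hb p hp).le)

lemma summable_mul_coeff {R : Type*} [CommRing R] {F G : PowerSeries R} {p : RingSeminorm R}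
    (hF : Summable fun n => p (PowerSeries.coeff n F))
    (hG : Summable fun n => p (PowerSeries.coeff n G)) : Summable fun x : ℕ × ℕ =>
      p (PowerSeries.coeff x.1 F) * p (PowerSeries.coeff x.2 G) :=
  Summable.mul_of_nonneg (f := fun n => p (PowerSeries.coeff n F))
    (g := fun n => p (PowerSeries.coeff n G)) hF hG (fun _ => apply_nonneg p _)
      (fun _ => apply_nonneg p _)

variable {R : Type*} [CommRing R] [TopologicalSpace R] {P : Set (RingSeminorm R)}

lemma hasEval_one (P : Set (RingSeminorm R)) : HasEval P (1 : PowerSeries R) 1 := by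
  constructor
  · intro p _
    refine summable_of_ne_finset_zero (s := {0}) fun n hn => ?_
    rw [PowerSeries.coeff_one, if_neg (by simpa using hn), map_zero]
  · have := hasSum_single (f := fun n => PowerSeries.coeff n (1 : PowerSeries R)) 0
      (fun n hn => by rw [PowerSeries.coeff_one, if_neg hn])
    simpa using this

lemma hasEval_one_sub (P : Set (RingSeminorm R)) (c : R) (r : ℕ) (hr : 0 < r) :
    HasEval P (1 - PowerSeries.C c * PowerSeries.X ^ r) (1 - c) := by
  have h0 : ∀ n ∉ ({0, r} : Finset ℕ),
      PowerSeries.coeff n (1 - PowerSeries.C c * PowerSeries.X ^ r) = 0 := by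
    intro n hn
    simp only [Finset.mem_insert, Finset.mem_singleton, not_or] at hn
    rw [map_sub, PowerSeries.coeff_one, if_neg hn.1, PowerSeries.coeff_C_mul,
      PowerSeries.coeff_X_pow, if_neg hn.2]
    simp
  refine ⟨fun p _ => summable_of_ne_finset_zero (s := {0, r}) fun n hn => ?_, ?_⟩
  · rw [h0 n hn, map_zero]
  · have := hasSum_sum_of_ne_finset_zero (L := SummationFilter.unconditional ℕ) h0
    rw [Finset.sum_pair hr.ne] at this
    convert this using 1
    simp [PowerSeries.coeff_X_pow, PowerSeries.coeff_one, hr.ne', sub_eq_add_neg]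

lemma Small.summable_pow {c : R} (hP : IsSummabilityFamily P) (hc : Small P c) (p : RingSeminorm R)
    (hp : p ∈ P) : Summable fun n : ℕ => p (c ^ n) :=
  Summable.of_nonneg_of_le (fun _ => apply_nonneg p _)
    (fun n => seminorm_pow_le p (hP.one_le p hp) c n)
    (summable_geometric_of_lt_one (apply_nonneg p c) (hc p hp))

variable [IsTopologicalRing R] [T2Space R]

lemma HasEval.mul (hP : IsSummabilityFamily P) {F G : PowerSeries R} {r s : R}
    (hF : HasEval P F r) (hG : HasEval P G s) : HasEval P (F * G) (r * s) := by
  have hreg : RegularSpace R := IsTopologicalAddGroup.regularSpace R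
  have hT3 : T3Space R := {}
  have hsum : Summable fun x : ℕ × ℕ => PowerSeries.coeff x.1 F * PowerSeries.coeff x.2 G :=
    hP.summable _ fun p hp => Summable.of_nonneg_of_le (fun _ => apply_nonneg p _)
      (fun x => map_mul_le_mul p _ _) (summable_mul_coeff (hF.1 p hp) (hG.1 p hp))
  refine ⟨fun p hp => ?_, ?_⟩
  · have h1 := summable_sum_mul_antidiagonal_of_summable_mul
      (f := fun n => p (PowerSeries.coeff n F)) (g := fun n => p (PowerSeries.coeff n G))
      (summable_mul_coeff (hF.1 p hp) (hG.1 p hp))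
    refine Summable.of_nonneg_of_le (fun _ => apply_nonneg p _) (fun n => ?_) h1
    rw [PowerSeries.coeff_mul]
    exact (seminorm_sum_le p _ _).trans (Finset.sum_le_sum fun x _ => map_mul_le_mul p _ _)
  · have h1 := hF.2.summable.tsum_mul_tsum_eq_tsum_sum_antidiagonal hG.2.summable hsum
    rw [hF.2.tsum_eq, hG.2.tsum_eq] at h1
    rw [h1]
    have h2 := (summable_sum_mul_antidiagonal_of_summable_mul
      (f := fun n => PowerSeries.coeff n F) (g := fun n => PowerSeries.coeff n G) hsum).hasSum
    simpa only [PowerSeries.coeff_mul] using h2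

lemma HasEval.multiset_prod (hP : IsSummabilityFamily P) {ι : Type*} (s : Multiset ι)
    (F : ι → PowerSeries R) (r : ι → R) (h : ∀ i ∈ s, HasEval P (F i) (r i)) :
    HasEval P (s.map F).prod (s.map r).prod := by
  induction s using Multiset.induction_on with
  | empty => simpa using hasEval_one P
  | cons a s ih =>
    rw [Multiset.map_cons, Multiset.map_cons, Multiset.prod_cons, Multiset.prod_cons]
    exact (h a (by simp)).mul hP (ih fun i hi => h i (Multiset.mem_cons_of_mem hi))

lemma Small.one_sub_mul_tsum {c : R} (hP : IsSummabilityFamily P) (hc : Small P c) :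
    (1 - c) * ∑' n : ℕ, c ^ n = 1 := by
  have hs : Summable fun n : ℕ => c ^ n := hP.summable _ (hc.summable_pow hP)
  have h1 := hs.tsum_eq_zero_add
  rw [sub_mul, one_mul, ← hs.tsum_mul_left]
  simp_rw [← pow_succ']
  rw [h1]
  simp

lemma Small.isUnit_one_sub {c : R} (hP : IsSummabilityFamily P) (hc : Small P c) :
    IsUnit (1 - c) :=
  IsUnit.of_mul_eq_one _ (hc.one_sub_mul_tsum hP)

lemma inverse_eq_of_mul_eq_one {S : Type*} [CommRing S] {a b : S} (h : a * b = 1) :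
    Ring.inverse a = b := by
  have := Ring.inverse_mul_cancel a (IsUnit.of_mul_eq_one _ h)
  calc Ring.inverse a = Ring.inverse a * (a * b) := by rw [h, mul_one]
    _ = b := by rw [← mul_assoc, this, one_mul]

lemma Small.hasSum_pow {c : R} (hP : IsSummabilityFamily P) (hc : Small P c) :
    HasSum (fun n : ℕ => c ^ n) (Ring.inverse (1 - c)) := by
  rw [inverse_eq_of_mul_eq_one (hc.one_sub_mul_tsum hP)]
  exact (hP.summable _ (hc.summable_pow hP)).hasSum

/-- The geometric series `1 / (1 - c t^r)`. -/
def geomPow {S : Type*} [CommRing S] (r : ℕ) (c : S) : PowerSeries S :=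
  PowerSeries.mk fun n => if r ∣ n then c ^ (n / r) else 0

lemma one_sub_mul_geomPow {S : Type*} [CommRing S] (r : ℕ) (hr : 0 < r) (c : S) :
    (1 - PowerSeries.C c * PowerSeries.X ^ r) * geomPow r c = 1 := by
  ext n
  rw [sub_mul, one_mul, mul_assoc, map_sub, PowerSeries.coeff_C_mul, PowerSeries.coeff_X_pow_mul',
    PowerSeries.coeff_one]
  simp only [geomPow, PowerSeries.coeff_mk]
  by_cases hn : r ≤ n
  · obtain ⟨m, rfl⟩ := Nat.exists_eq_add_of_le hn
    rw [if_pos hn, if_neg (by omega : r + m ≠ 0), Nat.add_sub_cancel_left]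
    have : r ∣ r + m ↔ r ∣ m := by simp
    by_cases hm : r ∣ m
    · rw [if_pos (this.mpr hm), if_pos hm, Nat.add_div_left _ hr, pow_succ']
      simp
    · rw [if_neg (this.not.mpr hm), if_neg hm]
      simp
  · rw [if_neg hn]
    by_cases h0 : n = 0
    · subst h0
      simp
    · rw [if_neg (fun h => hn (Nat.le_of_dvd (Nat.pos_of_ne_zero h0) h)), if_neg h0]
      simp

lemma hasEval_geomPow (hP : IsSummabilityFamily P) {c : R} (hc : Small P c) (r : ℕ) (hr : 0 < r) :
    HasEval P (geomPow r c) (Ring.inverse (1 - c)) := by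
  have hinj : Function.Injective fun k : ℕ => r * k := fun a b h => by
    simpa [hr.ne'] using h
  have hz : ∀ n ∉ Set.range (fun k : ℕ => r * k), PowerSeries.coeff n (geomPow r c) = 0 := by
    intro n hn
    simp only [geomPow, PowerSeries.coeff_mk]
    rw [if_neg]
    rintro ⟨k, rfl⟩
    exact hn ⟨k, rfl⟩
  have hco : (fun k => PowerSeries.coeff (r * k) (geomPow r c)) = fun k => c ^ k := by
    ext k
    simp [geomPow, Nat.mul_div_cancel_left _ hr]
  constructor
  · intro p hp
    rw [← hinj.summable_iff]
    · have := hc.summable_pow hP p hp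
      simpa [Function.comp_def, congrFun hco] using this
    · intro n hn
      rw [hz n hn, map_zero]
  · rw [← hinj.hasSum_iff hz]
    have := hc.hasSum_pow hP
    rw [← hco] at this
    exact this

end Summability

/-! ### Bounds for minors and summability over tuples -/

section Bounds

variable {R : Type*} [CommRing R]

/-- If all variables have seminorm smaller than `r`, then `h_k` is of order `r ^ k`. -/
lemma exists_hZ_bound (p : RingSeminorm R) (hp : p 1 ≤ 1) {r : ℝ} (hr : 0 < r) (X : Multiset R)
    (hX : ∀ x ∈ X, p x < r) : ∃ C : ℝ, 0 ≤ C ∧ ∀ k : ℤ, p (hZ X k) ≤ C * r ^ k := by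
  induction X using Multiset.induction_on with
  | empty =>
    refine ⟨1, zero_le_one, fun k => ?_⟩
    rw [hZ_empty]
    split_ifs with hk
    · subst hk; simpa using hp
    · rw [map_zero]; positivity
  | cons x X ih =>
    obtain ⟨C, hC0, hC⟩ := ih fun y hy => hX y (Multiset.mem_cons_of_mem hy)
    have hx : p x < r := hX x (by simp)
    have hx0 : 0 ≤ p x := apply_nonneg p x
    have hrx : 0 < r - p x := by linarith
    -- the constant solves `C + p(x) C' / r = C'`
    refine ⟨C * r / (r - p x), by positivity, fun k => ?_⟩
    rcases lt_or_ge k 0 with hk | hk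
    · rw [hZ_of_neg _ hk, map_zero]; positivity
    lift k to ℕ using hk
    have step : ∀ k : ℤ, p (hZ (x ::ₘ X) (k - 1)) ≤ C * r / (r - p x) * r ^ (k - 1) →
        p (hZ (x ::ₘ X) k) ≤ C * r / (r - p x) * r ^ k := by
      intro k h
      rw [hZ_cons]
      calc p (hZ X k + x * hZ (x ::ₘ X) (k - 1))
          ≤ p (hZ X k) + p x * p (hZ (x ::ₘ X) (k - 1)) :=
            (map_add_le_add p _ _).trans (add_le_add le_rfl (map_mul_le_mul p _ _))
        _ ≤ C * r ^ k + p x * (C * r / (r - p x) * r ^ (k - 1)) :=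
            add_le_add (hC k) (mul_le_mul_of_nonneg_left h hx0)
        _ = C * r / (r - p x) * r ^ k := by
            rw [zpow_sub_one₀ hr.ne']
            field_simp
            ring
    induction k with
    | zero =>
      apply step
      rw [hZ_of_neg _ (by simp), map_zero]; positivity
    | succ n ih =>
      apply step
      convert ih using 3 <;> push_cast <;> ring

lemma exists_lt_one_of_forall_lt_one (p : RingSeminorm R) (X : Multiset R) (hX : ∀ x ∈ X, p x < 1) :
    ∃ r : ℝ, 0 < r ∧ r < 1 ∧ ∀ x ∈ X, p x < r := by
  induction X using Multiset.induction_on with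
  | empty => exact ⟨1 / 2, by norm_num, by norm_num, by simp⟩
  | cons x X ih =>
    obtain ⟨r, h0, h1, h⟩ := ih fun y hy => hX y (Multiset.mem_cons_of_mem hy)
    obtain ⟨s, hs, hs1⟩ := exists_between (max_lt h1 (hX x (by simp)))
    refine ⟨s, h0.trans ((le_max_left _ _).trans_lt hs), hs1, fun y hy => ?_⟩
    rcases Multiset.mem_cons.mp hy with rfl | hy
    · exact (le_max_right _ _).trans_lt hs
    · exact (h y hy).trans ((le_max_left _ _).trans_lt hs)

/-- All terms in the expansion of the determinant have the same total degree `∑ l_i - ∑ m_i`. -/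
lemma hMinor_bound (p : RingSeminorm R) (hp : p 1 ≤ 1) {r C : ℝ} (hr : 0 < r) {X : Multiset R}
    (hC : ∀ k : ℤ, p (hZ X k) ≤ C * r ^ k) {N : ℕ} (l m : Fin N → ℕ) :
    p (hMinor X l m) ≤ N.factorial * C ^ N * r ^ ((∑ i, (l i : ℤ)) - ∑ i, (m i : ℤ)) := by
  unfold hMinor
  rw [Matrix.det_apply]
  refine (seminorm_sum_le p _ _).trans ?_
  have h : ∀ σ : Equiv.Perm (Fin N), p (Equiv.Perm.sign σ • ∏ i,
      (Matrix.of fun i j => hZ X ((l i : ℤ) - (m j : ℤ))) (σ i) i) ≤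
      C ^ N * r ^ ((∑ i, (l i : ℤ)) - ∑ i, (m i : ℤ)) := by
    intro σ
    have h1 : ∀ a : R, p (Equiv.Perm.sign σ • a) = p a := by
      intro a
      rcases Int.units_eq_one_or (Equiv.Perm.sign σ) with h | h <;> rw [h] <;> simp
    rw [h1]
    refine (seminorm_prod_le p hp _ _).trans ?_
    refine (Finset.prod_le_prod (fun i _ => apply_nonneg p _) fun i _ => hC _).trans ?_
    rw [Finset.prod_mul_distrib, Finset.prod_const, Finset.card_univ, Fintype.card_fin]
    refine le_of_eq ?_
    congr 1
    have h2 : ∑ i, (l i : ℤ) = ∑ i, (l (σ i) : ℤ) :=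
      (Equiv.sum_comp σ fun i => (l i : ℤ)).symm
    rw [h2, ← Finset.sum_sub_distrib]
    generalize (Finset.univ : Finset (Fin N)) = s
    induction s using Finset.induction_on with
    | empty => simp
    | insert a s ha ih => rw [Finset.prod_insert ha, Finset.sum_insert ha, zpow_add₀ hr.ne', ih]
  refine (Finset.sum_le_sum fun σ _ => h σ).trans ?_
  rw [Finset.sum_const, Finset.card_univ, Fintype.card_perm, Fintype.card_fin, nsmul_eq_mul,
    mul_assoc]

/-- Strictly increasing `N`-tuples, which encode the partitions with at most `N` parts. -/
abbrev StrictTuple (N : ℕ) : Type := {l : Fin N → ℕ // StrictMono l}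

lemma summable_prod_pow {s : ℝ} (h0 : 0 ≤ s) (h1 : s < 1) (N : ℕ) :
    Summable fun l : Fin N → ℕ => ∏ i, s ^ l i := by
  classical
  refine summable_of_sum_le (c := ((1 - s)⁻¹) ^ N) (fun l => by positivity) fun u => ?_
  obtain ⟨B, hB⟩ : ∃ B : ℕ, ∀ l ∈ u, ∀ i, l i < B := by
    refine ⟨(u.sup fun l => Finset.univ.sup l) + 1, fun l hl i => Nat.lt_succ_of_le ?_⟩
    exact (Finset.le_sup (f := l) (Finset.mem_univ i)).trans
      (Finset.le_sup (f := fun l : Fin N → ℕ => Finset.univ.sup l) hl)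
  calc ∑ l ∈ u, ∏ i, s ^ l i
      ≤ ∑ l ∈ Fintype.piFinset fun _ : Fin N => Finset.range B, ∏ i, s ^ l i :=
        Finset.sum_le_sum_of_subset_of_nonneg (fun l hl => by simpa using hB l hl)
          fun l _ _ => by positivity
    _ = ∏ _i : Fin N, ∑ k ∈ Finset.range B, s ^ k := (Finset.prod_univ_sum _ _).symm
    _ ≤ ((1 - s)⁻¹) ^ N := by
        rw [Finset.prod_const, Finset.card_univ, Fintype.card_fin]
        refine pow_le_pow_left₀ (by positivity) ?_ N
        rw [← tsum_geometric_of_lt_one h0 h1]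
        exact (summable_geometric_of_lt_one h0 h1).sum_le_tsum _ (fun _ _ => by positivity)

/-- A family on pairs of tuples which is supported on `m ≤ l` and decays geometrically in `l` is
summable. -/
lemma summable_pair {N : ℕ} (p : RingSeminorm R) {r K : ℝ} (hr0 : 0 < r) (hr1 : r < 1)
    (hK : 0 ≤ K) (f : StrictTuple N × StrictTuple N → R)
    (h0 : ∀ l m, f (l, m) ≠ 0 → ∀ i, m.1 i ≤ l.1 i)
    (hb : ∀ l m, (∀ i, m.1 i ≤ l.1 i) → p (f (l, m)) ≤ K * r ^ (∑ i, l.1 i)) :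
    Summable fun x => p (f x) := by
  -- by `m ≤ l`, half of the decay in `l` can be given to `m`
  set s := √r with hs
  have hs0 : 0 < s := Real.sqrt_pos.mpr hr0
  have hs1 : s < 1 := by rw [hs, Real.sqrt_lt' one_pos]; simpa using hr1
  have hsr : s ^ 2 = r := Real.sq_sqrt hr0.le
  have h1 : Summable fun l : StrictTuple N => ∏ i, s ^ l.1 i :=
    (summable_prod_pow hs0.le hs1 N).subtype _
  have h2 := (Summable.mul_of_nonneg h1 h1 (fun _ => by positivity)
    (fun _ => by positivity)).mul_left K
  refine Summable.of_nonneg_of_le (fun _ => apply_nonneg p _) (fun x => ?_) h2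
  obtain ⟨l, m⟩ := x
  by_cases hf : f (l, m) = 0
  · rw [hf, map_zero]
    exact mul_nonneg hK (by positivity)
  · have hle := h0 l m hf
    refine (hb l m hle).trans (mul_le_mul_of_nonneg_left ?_ hK)
    rw [← hsr, ← pow_mul, Finset.prod_pow_eq_pow_sum, Finset.prod_pow_eq_pow_sum, ← pow_add]
    refine pow_le_pow_of_le_one hs0.le hs1.le ?_
    rw [two_mul]
    exact Nat.add_le_add_left (Finset.sum_le_sum fun i _ => hle i) _

lemma summable_single {N : ℕ} (p : RingSeminorm R) {r K : ℝ} (hr0 : 0 < r) (hr1 : r < 1)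
    (f : StrictTuple N → R) (hb : ∀ l, p (f l) ≤ K * r ^ (∑ i, l.1 i)) :
    Summable fun x => p (f x) := by
  have h1 : Summable fun l : StrictTuple N => ∏ i, r ^ l.1 i :=
    (summable_prod_pow hr0.le hr1 N).subtype _
  refine Summable.of_nonneg_of_le (fun _ => apply_nonneg p _) (fun x => ?_) (h1.mul_left K)
  rw [Finset.prod_pow_eq_pow_sum]
  exact hb x

/-- A product of two minors of small alphabets decays geometrically in the total degree. -/
lemma exists_hMinor_mul_bound (p : RingSeminorm R) (hp : p 1 ≤ 1) (X Y : Multiset R)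
    (hX : ∀ x ∈ X, p x < 1) (hY : ∀ y ∈ Y, p y < 1) (N : ℕ) :
    ∃ r K : ℝ, 0 < r ∧ r < 1 ∧ 0 ≤ K ∧
      ∀ l k k' m : Fin N → ℕ,
        p (hMinor Y l k' * hMinor X k m) ≤
          K * r ^ ((∑ i, (l i : ℤ)) + (∑ i, (k i : ℤ)) - (∑ i, (k' i : ℤ)) - ∑ i, (m i : ℤ)) := by
  obtain ⟨r, hr0, hr1, hr⟩ := exists_lt_one_of_forall_lt_one p (X + Y) fun x hx => by
    rcases Multiset.mem_add.mp hx with h | h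
    exacts [hX x h, hY x h]
  obtain ⟨C, hC0, hC⟩ := exists_hZ_bound p hp hr0 X fun x hx => hr x (by simp [hx])
  obtain ⟨D, hD0, hD⟩ := exists_hZ_bound p hp hr0 Y fun x hx => hr x (by simp [hx])
  refine ⟨r, (N.factorial * D ^ N) * (N.factorial * C ^ N), hr0, hr1, by positivity,
    fun l k k' m => ?_⟩
  refine (map_mul_le_mul p _ _).trans ((mul_le_mul (hMinor_bound p hp hr0 hD l k')
    (hMinor_bound p hp hr0 hC k m) (apply_nonneg p _) (by positivity)).trans (le_of_eq ?_))
  have e : (∑ i, (l i : ℤ)) + (∑ i, (k i : ℤ)) - (∑ i, (k' i : ℤ)) - ∑ i, (m i : ℤ) =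
    ((∑ i, (l i : ℤ)) - ∑ i, (k' i : ℤ)) + ((∑ i, (k i : ℤ)) - ∑ i, (m i : ℤ)) := by ring
  rw [e, zpow_add₀ hr0.ne']
  ring

end Bounds

/-! ### The summation formula for skew Schur functions -/

section SkewSum

variable {R : Type*} [CommRing R] {N : ℕ}

/-- Column operations with a lower bidiagonal matrix. -/
lemma det_lower_bidiagonal (w w' : Fin N → ℕ → R) (a b : ℕ → R) (hb : ∀ j, N ≤ j + 1 → b j = 0)
    (h : ∀ i (j : ℕ), j < N → w' i j = a j * w i j + b j * w i (j + 1)) :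
    (Matrix.of fun i j : Fin N => w' i j).det =
      (∏ j : Fin N, a j) * (Matrix.of fun i j : Fin N => w i j).det := by
  set U : Matrix (Fin N) (Fin N) R := Matrix.of fun k j =>
    (if k = j then a j else 0) + (if (k : ℕ) = j + 1 then b j else 0) with hU
  have hmul : (Matrix.of fun i j : Fin N => w' i j) = (Matrix.of fun i j : Fin N => w i j) * U := by
    ext i j
    simp only [Matrix.mul_apply, Matrix.of_apply, hU, mul_add, Finset.sum_add_distrib, mul_ite,
      mul_zero, Finset.sum_ite_eq', Finset.mem_univ, if_true]
    rw [h i j j.2, mul_comm (a j)]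
    congr 1
    by_cases hj : (j : ℕ) + 1 < N
    · rw [Finset.sum_eq_single ⟨j + 1, hj⟩]
      · simp [mul_comm]
      · intro k _ hk
        rw [if_neg]
        intro hc
        exact hk (Fin.ext hc)
      · simp
    · rw [hb j (by omega), zero_mul]
      symm
      refine Finset.sum_eq_zero fun k _ => ?_
      rw [if_neg]
      have := k.2
      omega
  have hdet : U.det = ∏ j : Fin N, a j := by
    rw [Matrix.det_of_isLowerTriangular]
    · simp [hU]
    · intro i j hij
      have hij' : (i : ℕ) < j := by simpa using hij
      simp only [hU, Matrix.of_apply]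
      rw [if_neg (by rintro rfl; omega), if_neg (by omega), add_zero]
  rw [hmul, Matrix.det_mul, hdet, mul_comm]

/-- Column operations with an upper bidiagonal matrix. -/
lemma det_upper_bidiagonal (w w' : Fin N → ℕ → R) (a b : ℕ → R)
    (h0 : ∀ i, w' i 0 = a 0 * w i 0)
    (h : ∀ i (j : ℕ), w' i (j + 1) = a (j + 1) * w i (j + 1) + b j * w i j) :
    (Matrix.of fun i j : Fin N => w' i j).det =
      (∏ j : Fin N, a j) * (Matrix.of fun i j : Fin N => w i j).det := by
  set U : Matrix (Fin N) (Fin N) R := Matrix.of fun k j =>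
    (if k = j then a j else 0) + (if (k : ℕ) + 1 = j then b k else 0) with hU
  have hmul : (Matrix.of fun i j : Fin N => w' i j) = (Matrix.of fun i j : Fin N => w i j) * U := by
    ext i j
    simp only [Matrix.mul_apply, Matrix.of_apply, hU, mul_add, Finset.sum_add_distrib, mul_ite,
      mul_zero, Finset.sum_ite_eq', Finset.mem_univ, if_true]
    obtain ⟨j, hj⟩ := j
    cases j with
    | zero => simp [h0, mul_comm]
    | succ j =>
      simp only
      rw [h i j, mul_comm (a _)]
      congr 1
      rw [Finset.sum_eq_single ⟨j, by omega⟩]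
      · simp [mul_comm]
      · intro k _ hk
        rw [if_neg]
        intro hc
        exact hk (Fin.ext (by simpa using hc))
      · simp
  have hdet : U.det = ∏ j : Fin N, a j := by
    rw [Matrix.det_of_isUpperTriangular]
    · simp [hU]
    · intro i j hij
      have hij' : (j : ℕ) < i := by simpa using hij
      simp only [hU, Matrix.of_apply]
      rw [if_neg (by rintro rfl; omega), if_neg (by omega), add_zero]
  rw [hmul, Matrix.det_mul, hdet, mul_comm]

/-- The alphabet formed by the first `k` entries of a sequence. -/
def firstVars (x : ℕ → R) (k : ℕ) : Multiset R := (Multiset.range k).map x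

lemma hZ_firstVars_succ (x : ℕ → R) (k : ℕ) (n : ℤ) :
    hZ (firstVars x (k + 1)) n =
      hZ (firstVars x k) n + x k * hZ (firstVars x (k + 1)) (n - 1) := by
  have : firstVars x (k + 1) = x k ::ₘ firstVars x k := by simp [firstVars, Multiset.range_succ]
  rw [this, hZ_cons]

/-- A Schur function as a determinant in which column `j` only involves the first `j + 1`
variables: by `h_n(x_0, …, x_r) - x_r h_{n-1}(x_0, …, x_r) = h_n(x_0, …, x_{r-1})`, column
operations remove the last variable from all columns but one, and so on. -/
lemma hMinor_emptyTuple_eq_flagged (x : ℕ → R) (l : Fin N → ℕ) :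
    hMinor (firstVars x N) l (emptyTuple N) =
      (Matrix.of fun i j : Fin N => hZ (firstVars x (j + 1)) ((l i : ℤ) - (j : ℤ))).det := by
  -- in `key`, column `j` involves the first `max (j + 1) r` variables
  have key : ∀ r, r ≤ N →
      (Matrix.of fun i j : Fin N => hZ (firstVars x (max (j + 1) r)) ((l i : ℤ) - (j : ℤ))).det =
      (Matrix.of fun i j : Fin N => hZ (firstVars x (j + 1)) ((l i : ℤ) - (j : ℤ))).det := by
    intro r
    induction r with
    | zero => intro _; simp
    | succ r ih =>
      intro hr
      rw [← ih (by omega)]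
      have := det_lower_bidiagonal (N := N)
        (fun i j => hZ (firstVars x (max (j + 1) (r + 1))) ((l i : ℤ) - (j : ℤ)))
        (fun i j => hZ (firstVars x (max (j + 1) r)) ((l i : ℤ) - (j : ℤ)))
        (fun _ => 1) (fun j => if j < r then - x r else 0)
        (fun j hj => by rw [if_neg (by omega)]) (fun i j hj => ?_)
      · rw [this]; simp
      · split_ifs with hjr
        · rw [max_eq_right (by omega), max_eq_right (by omega), max_eq_right (by omega),
            hZ_firstVars_succ]
          push_cast
          ring_nf
        · rw [max_eq_left (by omega), max_eq_left (by omega)]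
          ring
  rw [← key N le_rfl]
  unfold hMinor
  congr 1
  ext i j
  have := j.2
  simp only [Matrix.of_apply, emptyTuple]
  rw [max_eq_right (by omega)]

/-- The subtype version of `strictTuples`. -/
def strictTupleWindow (N L : ℕ) : Finset (StrictTuple N) := by
  classical exact (strictTuples N L).subtype StrictMono

lemma tendsto_strictTupleWindow (N : ℕ) : Tendsto (strictTupleWindow N) atTop atTop := by
  refine tendsto_atTop_finset_of_monotone ?_ fun l => ⟨Finset.univ.sup l.1, ?_⟩
  · intro a b hab l hl
    simp only [strictTupleWindow, Finset.mem_subtype, mem_strictTuples] at hl ⊢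
    exact ⟨fun i => (hl.1 i).trans hab, hl.2⟩
  · simp only [strictTupleWindow, Finset.mem_subtype, mem_strictTuples]
    exact ⟨fun i => Finset.le_sup (f := l.1) (Finset.mem_univ i), l.2⟩

lemma sum_strictTupleWindow (N L : ℕ) (f : (Fin N → ℕ) → R) :
    ∑ l ∈ strictTupleWindow N L, f l.1 = ∑ l ∈ strictTuples N L, f l := by
  unfold strictTupleWindow
  rw [Finset.sum_subtype_of_mem]
  intro l hl
  exact (mem_strictTuples.mp hl).2

/-- An alphabet may be padded by zeros to one with `N` entries. -/
lemma exists_firstVars_eq (X : Multiset R) (hX0 : X.card ≤ N) :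
    ∃ x : ℕ → R, (∀ i, x i = 0 ∨ x i ∈ X) ∧ (∀ k, hZ (firstVars x N) k = hZ X k) ∧
      ∀ Y, cauchyProd (firstVars x N) Y = cauchyProd X Y := by
  set l := X.toList
  have hl : l.length ≤ N := by simpa [l] using hX0
  refine ⟨fun i => l.getD i 0, fun i => ?_, ?_⟩
  · rcases lt_or_ge i l.length with h | h
    · right
      simp only [List.getD_eq_getElem _ _ h]
      rw [← Multiset.mem_toList]
      exact List.getElem_mem h
    · left
      simp only [List.getD_eq_default _ _ h]
  · have h : firstVars (fun i => l.getD i 0) N = Multiset.replicate (N - l.length) 0 + X := by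
      obtain ⟨d, rfl⟩ := Nat.exists_eq_add_of_le hl
      rw [Nat.add_sub_cancel_left]
      have hX : X = (l : Multiset R) := (Multiset.coe_toList X).symm
      conv_rhs => rw [hX]
      clear hX
      clear hl hX0
      induction d with
      | zero =>
        simp only [add_zero, Multiset.replicate_zero, zero_add, firstVars]
        rw [← Multiset.coe_range, Multiset.map_coe]
        congr 1
        apply List.ext_getElem
        · simp
        · intro i h1 h2
          simp [h2]
      | succ d ih =>
        rw [← add_assoc, firstVars, Multiset.range_succ, Multiset.map_cons]
        rw [Multiset.replicate_succ, Multiset.cons_add, ← ih, firstVars]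
        congr 1
        exact List.getD_eq_default _ _ (by omega)
    rw [h]
    generalize N - l.length = d
    constructor
    · intro k
      induction d generalizing k with
      | zero => simp
      | succ d ih => rw [Multiset.replicate_succ, Multiset.cons_add, hZ_cons_zero, ih]
    · intro Y
      rw [cauchyProd_add_left]
      simp [cauchyProd]

variable {P : Set (RingSeminorm R)}

lemma small_firstVars {x : ℕ → R} (hx : ∀ i, Small P (x i)) (k : ℕ) :
    ∀ a ∈ firstVars x k, Small P a := by
  intro a ha
  simp only [firstVars, Multiset.mem_map] at ha
  obtain ⟨i, _, rfl⟩ := ha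
  exact hx i

variable [TopologicalSpace R]

lemma summable_hZ_mul (hP : IsSummabilityFamily P) (X Y : Multiset R) (hX : ∀ x ∈ X, Small P x)
    (hY : ∀ y ∈ Y, Small P y) (m k : ℕ) :
    Summable fun c : ℕ => hZ Y ((c : ℤ) - m) * hZ X ((c : ℤ) - k) := by
  refine hP.summable _ fun p hp => ?_
  obtain ⟨r, hr0, hr1, hr⟩ := exists_lt_one_of_forall_lt_one p (X + Y) fun x hx => by
    rcases Multiset.mem_add.mp hx with h | h
    exacts [hX x h p hp, hY x h p hp]
  obtain ⟨C, hC0, hC⟩ := exists_hZ_bound p (hP.one_le p hp) hr0 X fun x hx => hr x (by simp [hx])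
  obtain ⟨D, hD0, hD⟩ := exists_hZ_bound p (hP.one_le p hp) hr0 Y fun x hx => hr x (by simp [hx])
  have hg : Summable fun c : ℕ => (D * C * r ^ (-(m : ℤ) - k)) * (r ^ 2) ^ c :=
    (summable_geometric_of_lt_one (by positivity) (by nlinarith)).mul_left _
  refine Summable.of_nonneg_of_le (fun _ => apply_nonneg p _) (fun c => ?_) hg
  refine (map_mul_le_mul p _ _).trans ((mul_le_mul (hD _) (hC _) (apply_nonneg p _)
    (by positivity)).trans (le_of_eq ?_))
  rw [← zpow_natCast, ← zpow_natCast, ← zpow_mul]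
  rw [show D * r ^ ((c : ℤ) - m) * (C * r ^ ((c : ℤ) - k)) =
    D * C * (r ^ ((c : ℤ) - m) * r ^ ((c : ℤ) - k)) by ring, mul_assoc (D * C),
    ← zpow_add₀ hr0.ne', ← zpow_add₀ hr0.ne']
  congr 2
  push_cast
  ring

/-- The entries `∑_c h_{c - m}(Y) h_{c - k}(x_0, …, x_k)`. -/
def flaggedSum (x : ℕ → R) (Y : Multiset R) (m k : ℕ) : R :=
  ∑' c : ℕ, hZ Y ((c : ℤ) - m) * hZ (firstVars x (k + 1)) ((c : ℤ) - k)

lemma flaggedSum_empty (x : ℕ → R) (m k : ℕ) :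
    flaggedSum x 0 m k = hZ (firstVars x (k + 1)) ((m : ℤ) - k) := by
  unfold flaggedSum
  rw [tsum_eq_single m]
  · rw [sub_self, hZ_zero, one_mul]
  · intro c hc
    rw [hZ_empty, if_neg (by omega), zero_mul]

variable [IsTopologicalRing R] [T2Space R]

lemma flaggedSum_cons (hP : IsSummabilityFamily P) {x : ℕ → R} (hx : ∀ i, Small P (x i)) (y : R)
    (Y : Multiset R) (hY : ∀ a ∈ y ::ₘ Y, Small P a) (m k : ℕ) :
    flaggedSum x (y ::ₘ Y) m k = flaggedSum x Y m k + y * flaggedSum x (y ::ₘ Y) (m + 1) k := by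
  unfold flaggedSum
  have h1 := summable_hZ_mul hP (firstVars x (k + 1)) Y (small_firstVars hx _)
    (fun a ha => hY a (Multiset.mem_cons_of_mem ha)) m k
  have h2 := summable_hZ_mul hP (firstVars x (k + 1)) (y ::ₘ Y) (small_firstVars hx _) hY (m + 1) k
  rw [← h2.tsum_mul_left, ← h1.tsum_add (h2.mul_left y)]
  congr 1
  ext c
  rw [hZ_cons]
  push_cast
  rw [show (c : ℤ) - (m + 1) = c - m - 1 by ring]
  ring

/-- The case `k = 0` of the next recursion: `h_c(x_0) = x_0 h_{c-1}(x_0)` for `c ≥ 1`. -/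
lemma flaggedSum_shift_zero (hP : IsSummabilityFamily P) {x : ℕ → R} (hx : ∀ i, Small P (x i))
    (Y : Multiset R) (hY : ∀ a ∈ Y, Small P a) (m : ℕ) :
    flaggedSum x Y (m + 1) 0 = x 0 * flaggedSum x Y m 0 := by
  unfold flaggedSum
  have h1 := summable_hZ_mul hP (firstVars x 1) Y (small_firstVars hx _) hY m 0
  have h2 := summable_hZ_mul hP (firstVars x 1) Y (small_firstVars hx _) hY (m + 1) 0
  rw [h2.tsum_eq_zero_add, hZ_of_neg Y (by push_cast; omega), zero_mul, zero_add,
    ← h1.tsum_mul_left]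
  congr 1
  ext c
  have := hZ_firstVars_succ x 0 (c + 1)
  have h0 : firstVars x 0 = 0 := rfl
  rw [h0, hZ_empty, if_neg (by omega)] at this
  push_cast
  simp only [sub_zero, zero_add] at this ⊢
  rw [this]
  rw [show (c : ℤ) + 1 - (m + 1) = c - m by ring, show (c : ℤ) + 1 - 1 = c by ring]
  ring

/-- Shifting the summation index and then splitting off the last variable `x_{k+1}`. -/
lemma flaggedSum_shift_succ (hP : IsSummabilityFamily P) {x : ℕ → R} (hx : ∀ i, Small P (x i))
    (Y : Multiset R) (hY : ∀ a ∈ Y, Small P a) (m k : ℕ) :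
    flaggedSum x Y (m + 1) (k + 1) =
      x (k + 1) * flaggedSum x Y m (k + 1) + flaggedSum x Y m k := by
  unfold flaggedSum
  have h1 := summable_hZ_mul hP (firstVars x (k + 1 + 1)) Y (small_firstVars hx _) hY m (k + 1)
  have h2 := summable_hZ_mul hP (firstVars x (k + 1 + 1)) Y (small_firstVars hx _) hY
    (m + 1) (k + 1)
  have h3 := summable_hZ_mul hP (firstVars x (k + 1)) Y (small_firstVars hx _) hY m k
  rw [h2.tsum_eq_zero_add, hZ_of_neg Y (by push_cast; omega), zero_mul, zero_add,
    ← h1.tsum_mul_left, ← (h1.mul_left _).tsum_add h3]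
  congr 1
  ext c
  rw [hZ_firstVars_succ x (k + 1)]
  push_cast
  rw [show (c : ℤ) + 1 - (m + 1) = c - m by ring, show (c : ℤ) + 1 - (k + 1) = c - k by ring,
    show (c : ℤ) - k - 1 = c - (k + 1) by ring]
  ring

/-- The determinant of the flagged sums is `s_μ(X) ∏ 1 / (1 - x y)`. On adding a variable `y` to
`Y`, the recursions express the old columns through the new ones by a triangular matrix with
diagonal `1 - x_j y`. -/
lemma det_flaggedSum (hP : IsSummabilityFamily P) {x : ℕ → R} (hx : ∀ i, Small P (x i))
    (Y : Multiset R) (hY : ∀ a ∈ Y, Small P a) (m : Fin N → ℕ) :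
    (Matrix.of fun i j : Fin N => flaggedSum x Y (m i) j).det =
      hMinor (firstVars x N) m (emptyTuple N) * cauchyProd (firstVars x N) Y := by
  induction Y using Multiset.induction_on with
  | empty =>
    rw [cauchyProd_zero_right, mul_one, hMinor_emptyTuple_eq_flagged]
    simp_rw [flaggedSum_empty]
  | cons y Y ih =>
    have hY' : ∀ a ∈ Y, Small P a := fun a ha => hY a (Multiset.mem_cons_of_mem ha)
    have hy : Small P y := hY y (by simp)
    have hdet := det_upper_bidiagonal (N := N) (fun i j => flaggedSum x (y ::ₘ Y) (m i) j)
      (fun i j => flaggedSum x Y (m i) j) (fun j => 1 - x j * y) (fun _ => - y) (fun i => ?_)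
      (fun i j => ?_)
    · rw [ih hY'] at hdet
      have hc : cauchyProd (firstVars x N) (y ::ₘ Y) =
          (∏ j : Fin N, Ring.inverse (1 - x j * y)) * cauchyProd (firstVars x N) Y := by
        rw [← Multiset.singleton_add, cauchyProd_add_right]
        congr 1
        simp only [cauchyProd, firstVars, Multiset.map_singleton, Multiset.prod_singleton,
          Multiset.map_map]
        exact Finset.prod_range (fun j => Ring.inverse (1 - x j * y))
      rw [hc, mul_left_comm, hdet, ← mul_assoc, ← Finset.prod_mul_distrib]
      rw [Finset.prod_eq_one fun (j : Fin N) _ => Ring.inverse_mul_cancel _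
        (((hx j).mul hy).isUnit_one_sub hP), one_mul]
    · have h1 := flaggedSum_cons hP hx y Y hY (m i) 0
      have h2 := flaggedSum_shift_zero hP hx (y ::ₘ Y) hY (m i)
      rw [h2] at h1
      linear_combination -h1
    · have h1 := flaggedSum_cons hP hx y Y hY (m i) (j + 1)
      have h2 := flaggedSum_shift_succ hP hx (y ::ₘ Y) hY (m i) j
      rw [h2] at h1
      linear_combination -h1

/-- `∑_λ s_{λ/μ}(Y) s_λ(X) = s_μ(X) ∏ 1 / (1 - x y)`. By the Cauchy–Binet formula the sum over `λ`
is a determinant of sums over a single index, which is the determinant of the flagged sums. -/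
lemma hasSum_skew (hP : IsSummabilityFamily P) (X Y : Multiset R) (hN : X.card ≤ N)
    (hX : ∀ x ∈ X, Small P x) (hY : ∀ y ∈ Y, Small P y) (m : StrictTuple N) :
    HasSum (fun l : StrictTuple N => hMinor Y l.1 m.1 * hMinor X l.1 (emptyTuple N))
      (hMinor X m.1 (emptyTuple N) * cauchyProd X Y) := by
  obtain ⟨x, hx, hxX, hcX⟩ := exists_firstVars_eq X hN
  have hmin : ∀ l, hMinor X l (emptyTuple N) = hMinor (firstVars x N) l (emptyTuple N) := by
    intro l; unfold hMinor; simp_rw [hxX]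
  have hxs : ∀ i, Small P (x i) := by
    intro i
    rcases hx i with h | h
    · rw [h]; intro p _; rw [map_zero]; exact one_pos
    · exact hX _ h
  have hsum : Summable fun l : StrictTuple N =>
      hMinor Y l.1 m.1 * hMinor X l.1 (emptyTuple N) := by
    refine hP.summable _ fun p hp => ?_
    obtain ⟨r, K, hr0, hr1, hK, hb⟩ := exists_hMinor_mul_bound p (hP.one_le p hp) X Y
      (fun x h => hX x h p hp) (fun x h => hY x h p hp) N
    refine summable_single p (r := r) (K := K * r ^ (-(∑ i, (m.1 i : ℤ)) - ∑ i,
      (emptyTuple N i : ℤ))) hr0 hr1 _ fun l => ?_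
    by_cases hle : ∀ i, m.1 i ≤ l.1 i
    · refine (hb l.1 l.1 m.1 (emptyTuple N)).trans ?_
      rw [mul_assoc]
      refine mul_le_mul_of_nonneg_left ?_ hK
      rw [← zpow_natCast, ← zpow_add₀ hr0.ne']
      refine zpow_le_zpow_right_of_le_one₀ hr0 hr1.le ?_
      have : (0 : ℤ) ≤ ∑ i, (l.1 i : ℤ) := Finset.sum_nonneg fun _ _ => by positivity
      push_cast
      linarith
    · push Not at hle
      obtain ⟨k, hk⟩ := hle
      rw [hMinor_eq_zero Y l.2 m.2 k hk, zero_mul, map_zero]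
      positivity
  have hlim1 := hsum.hasSum.comp (tendsto_strictTupleWindow N)
  have hlim2 : Tendsto (fun L => ∑ l ∈ strictTupleWindow N L,
      hMinor Y l.1 m.1 * hMinor X l.1 (emptyTuple N)) atTop
      (𝓝 (hMinor X m.1 (emptyTuple N) * cauchyProd X Y)) := by
    rw [hmin, ← hcX, ← det_flaggedSum hP hxs Y hY]
    have heq : ∀ L, ∑ l ∈ strictTupleWindow N L,
        hMinor Y l.1 m.1 * hMinor X l.1 (emptyTuple N) =
        (Matrix.of fun j k : Fin N => ∑ c ∈ Finset.range (L + 1), hZ Y ((c : ℤ) - m.1 j) *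
          hZ (firstVars x (k + 1)) ((c : ℤ) - (k : ℤ))).det := by
      intro L
      rw [sum_strictTupleWindow N L fun l => hMinor Y l m.1 * hMinor X l (emptyTuple N),
        ← sum_strictTuples_det_mul_det]
      refine Finset.sum_congr rfl fun l _ => ?_
      rw [hmin, hMinor_emptyTuple_eq_flagged]
      rfl
    simp_rw [heq, Matrix.det_apply]
    refine tendsto_finsetSum _ fun σ _ => ?_
    refine Tendsto.const_smul ?_ _
    refine tendsto_finsetProd _ fun i _ => ?_
    have := (summable_hZ_mul hP (firstVars x (i + 1)) Y (small_firstVars hxs _) hY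
      (m.1 (σ i)) i).hasSum.tendsto_sum_nat
    exact this.comp (tendsto_add_atTop_nat 1)
  have := tendsto_nhds_unique hlim1 hlim2
  rw [← this]
  exact hsum.hasSum

end SkewSum

/-! ### Littlewood's identity -/

section Littlewood

variable {R : Type*} [CommRing R] {N : ℕ}

/-- The tuples encoding the partitions `λ_1 = λ_2 ≥ λ_3 = λ_4 ≥ ⋯`, whose transpose is even (for
tuples of even size). -/
def EvenTuple (l : Fin N → ℕ) : Prop :=
  ∀ (i : ℕ) (h : i + 1 < N), Even i → l ⟨i + 1, h⟩ = l ⟨i, by omega⟩ + 1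

lemma hMinor_self (X : Multiset R) {l : Fin N → ℕ} (hl : StrictMono l) : hMinor X l l = 1 := by
  unfold hMinor
  rw [Matrix.det_of_isLowerTriangular]
  · simp [hZ_zero]
  · intro i j hij
    have : l i < l j := hl (by simpa using hij)
    exact hZ_of_neg _ (by omega)

lemma evenTuple_emptyTuple : EvenTuple (emptyTuple N) := fun _ _ _ => rfl

/-- The neighbour in the pairing `{0, 1}, {2, 3}, …` of positions. -/
def neighbour (hN : Even N) (i : Fin N) : Fin N :=
  if h : Even (i : ℕ) then ⟨i + 1, by
    have := i.2
    obtain ⟨a, ha⟩ := hN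
    obtain ⟨b, hb⟩ := h
    omega⟩ else ⟨i - 1, by have := i.2; omega⟩

lemma neighbour_of_even (hN : Even N) {i : Fin N} (h : Even (i : ℕ)) :
    (neighbour hN i : ℕ) = i + 1 := by simp [neighbour, h]

lemma neighbour_of_odd (hN : Even N) {i : Fin N} (h : ¬ Even (i : ℕ)) :
    (neighbour hN i : ℕ) = i - 1 := by simp [neighbour, h]

lemma neighbour_involutive (hN : Even N) : Function.Involutive (neighbour hN) := by
  intro i
  apply Fin.ext
  by_cases h : Even (i : ℕ)
  · have h1 := neighbour_of_even hN h
    rw [neighbour_of_odd hN (by rw [h1]; exact fun h' => (Nat.even_add_one.mp h') h), h1]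
    omega
  · have h1 := neighbour_of_odd hN h
    have hpos : (i : ℕ) ≠ 0 := by rintro h0; rw [h0] at h; simp at h
    have : Even ((i : ℕ) - 1) := by
      rw [Nat.not_even_iff_odd] at h
      obtain ⟨c, hc⟩ := h
      exact ⟨c, by omega⟩
    rw [neighbour_of_even hN (by rw [h1]; exact this), h1]
    omega

/-- The only even tuple which interlaces `k` from above. -/
def evenAbove (hN : Even N) (k : Fin N → ℕ) (i : Fin N) : ℕ :=
  if Even (i : ℕ) then k (neighbour hN i) - 1 else k i

/-- The only even tuple which interlaces `k` from below. -/
def evenBelow (hN : Even N) (k : Fin N → ℕ) (i : Fin N) : ℕ :=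
  if Even (i : ℕ) then k i else k (neighbour hN i) + 1

variable (hN : Even N) {k : Fin N → ℕ}

lemma even_lt_neighbour (hk : StrictMono k) {i : Fin N} (h : Even (i : ℕ)) :
    k i < k (neighbour hN i) :=
  hk (by rw [Fin.lt_def, neighbour_of_even hN h]; omega)

lemma neighbour_lt_odd (hk : StrictMono k) {i : Fin N} (h : ¬ Even (i : ℕ)) :
    k (neighbour hN i) < k i :=
  hk (by
    rw [Fin.lt_def, neighbour_of_odd hN h]
    have hpos : (i : ℕ) ≠ 0 := by rintro h0; rw [h0] at h; simp at h
    omega)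

lemma le_evenAbove (hk : StrictMono k) (i : Fin N) : k i ≤ evenAbove hN k i := by
  unfold evenAbove
  split_ifs with h
  · have := even_lt_neighbour hN hk h; omega
  · exact le_rfl

lemma evenAbove_lt (hk : StrictMono k) {i j : Fin N} (hij : i < j) : evenAbove hN k i < k j := by
  unfold evenAbove
  split_ifs with h
  · have h1 := even_lt_neighbour hN hk h
    have h2 : neighbour hN i ≤ j := by
      rw [Fin.le_def, neighbour_of_even hN h]; exact hij
    have := hk.monotone h2
    omega
  · exact hk hij

lemma evenBelow_le (hk : StrictMono k) (i : Fin N) : evenBelow hN k i ≤ k i := by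
  unfold evenBelow
  split_ifs with h
  · exact le_rfl
  · exact neighbour_lt_odd hN hk h

lemma lt_evenBelow (hk : StrictMono k) {i j : Fin N} (hij : i < j) : k i < evenBelow hN k j := by
  unfold evenBelow
  split_ifs with h
  · exact hk hij
  · have h2 : i ≤ neighbour hN j := by
      rw [Fin.le_def, neighbour_of_odd hN h]
      have : (i : ℕ) < j := hij
      omega
    have := hk.monotone h2
    omega

lemma evenAbove_strictMono (hk : StrictMono k) : StrictMono (evenAbove hN k) :=
  fun _ j hij => (evenAbove_lt hN hk hij).trans_le (le_evenAbove hN hk j)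

lemma evenBelow_strictMono (hk : StrictMono k) : StrictMono (evenBelow hN k) :=
  fun i _ hij => (evenBelow_le hN hk i).trans_lt (lt_evenBelow hN hk hij)

lemma evenTuple_evenAbove (hk : StrictMono k) : EvenTuple (evenAbove hN k) := by
  intro i h hi
  have h1 : ¬ Even (i + 1) := by rw [Nat.even_add_one]; exact fun hc => hc hi
  have h2 := even_lt_neighbour hN hk (i := ⟨i, by omega⟩) hi
  have h3 : neighbour hN ⟨i, by omega⟩ = ⟨i + 1, h⟩ :=
    Fin.ext (neighbour_of_even hN (i := ⟨i, by omega⟩) hi)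
  simp only [evenAbove, hi, h1, if_true, if_false, h3]
  rw [h3] at h2
  omega

lemma evenTuple_evenBelow : EvenTuple (evenBelow hN k) := by
  intro i h hi
  have h1 : ¬ Even (i + 1) := by rw [Nat.even_add_one]; exact fun hc => hc hi
  have h3 : neighbour hN ⟨i + 1, h⟩ = ⟨i, by omega⟩ :=
    Fin.ext (by rw [neighbour_of_odd hN (i := ⟨i + 1, h⟩) h1]; simp)
  simp only [evenBelow, hi, h1, if_true, if_false, h3]

lemma eq_evenAbove {l : Fin N → ℕ} (hl : EvenTuple l)
    (h1 : ∀ i, k i ≤ l i) (h2 : ∀ i j, i < j → l i < k j) : l = evenAbove hN k := by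
  have key : ∀ (i : ℕ) (h : i + 1 < N), Even i →
      l ⟨i, by omega⟩ + 1 = k ⟨i + 1, h⟩ ∧ l ⟨i + 1, h⟩ = k ⟨i + 1, h⟩ := by
    intro i h hi
    have a1 := hl i h hi
    have a2 := h1 ⟨i + 1, h⟩
    have a3 := h2 ⟨i, by omega⟩ ⟨i + 1, h⟩ (by simp)
    omega
  ext i
  unfold evenAbove
  split_ifs with h
  · have hn := neighbour_of_even hN h
    have := (neighbour hN i).2
    have h3 := (key i (by omega) h).1
    have e : neighbour hN i = ⟨i + 1, by omega⟩ := Fin.ext hn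
    rw [e, ← h3]
    rfl
  · have hpos : (i : ℕ) ≠ 0 := by rintro h0; rw [h0] at h; simp at h
    obtain ⟨c, hc⟩ := Nat.not_even_iff_odd.mp h
    have h3 := (key (i - 1) (by have := i.2; omega) ⟨c, by omega⟩).2
    have e : (⟨(i : ℕ) - 1 + 1, by have := i.2; omega⟩ : Fin N) = i := Fin.ext (by simp; omega)
    rwa [e] at h3

lemma eq_evenBelow {l : Fin N → ℕ} (hl : EvenTuple l)
    (h1 : ∀ i, l i ≤ k i) (h2 : ∀ i j, i < j → k i < l j) : l = evenBelow hN k := by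
  have key : ∀ (i : ℕ) (h : i + 1 < N), Even i →
      l ⟨i, by omega⟩ = k ⟨i, by omega⟩ ∧ l ⟨i + 1, h⟩ = k ⟨i, by omega⟩ + 1 := by
    intro i h hi
    have a1 := hl i h hi
    have a2 := h1 ⟨i, by omega⟩
    have a3 := h2 ⟨i, by omega⟩ ⟨i + 1, h⟩ (by simp)
    omega
  ext i
  unfold evenBelow
  split_ifs with h
  · have hn := neighbour_of_even hN h
    have := (neighbour hN i).2
    exact (key i (by omega) h).1
  · have hpos : (i : ℕ) ≠ 0 := by rintro h0; rw [h0] at h; simp at h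
    obtain ⟨c, hc⟩ := Nat.not_even_iff_odd.mp h
    have h3 := (key (i - 1) (by have := i.2; omega) ⟨c, by omega⟩).2
    have e : (⟨(i : ℕ) - 1 + 1, by have := i.2; omega⟩ : Fin N) = i := Fin.ext (by simp; omega)
    have e2 : neighbour hN i = ⟨i - 1, by have := i.2; omega⟩ := Fin.ext (neighbour_of_odd hN h)
    rw [e] at h3
    rw [e2]
    exact h3

lemma sum_evenAbove_sub :
    ∑ i, (evenAbove hN k i - k i) = ∑ i, (k i - evenBelow hN k i) := by
  refine Fintype.sum_equiv (neighbour_involutive hN).toPerm _ _ fun i => ?_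
  simp only [Function.Involutive.coe_toPerm]
  unfold evenAbove evenBelow
  by_cases h : Even (i : ℕ)
  · have h1 : ¬ Even (neighbour hN i : ℕ) := by
      rw [neighbour_of_even hN h]
      exact fun h' => (Nat.even_add_one.mp h') h
    rw [if_pos h, if_neg h1, neighbour_involutive hN i]
    omega
  · have h1 : Even (neighbour hN i : ℕ) := by
      rw [neighbour_of_odd hN h]
      obtain ⟨c, hc⟩ := Nat.not_even_iff_odd.mp h
      exact ⟨c, by omega⟩
    rw [if_neg h, if_pos h1]
    omega

/-- The only even tuple above `k` and the only even tuple below `k` are at the same distance from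
`k`: within a pair of positions both distances are the number of integers strictly between the two
entries. -/
lemma hMinor_evenAbove (hk : StrictMono k) (x : R) :
    hMinor {x} (evenAbove hN k) k = hMinor {x} k (evenBelow hN k) := by
  rw [hMinor_singleton_of_interlace x (le_evenAbove hN hk) (fun _ _ h => evenAbove_lt hN hk h),
    hMinor_singleton_of_interlace x (evenBelow_le hN hk) (fun _ _ h => lt_evenBelow hN hk h),
    sum_evenAbove_sub hN]

variable [TopologicalSpace R]

open Classical in
lemma hasSum_even_above (hk : StrictMono k) (x : R) :
    HasSum (fun l : StrictTuple N => if EvenTuple l.1 then hMinor {x} l.1 k else 0)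
      (hMinor {x} (evenAbove hN k) k) := by
  have := hasSum_single
    (f := fun l : StrictTuple N => if EvenTuple l.1 then hMinor {x} l.1 k else 0)
    ⟨evenAbove hN k, evenAbove_strictMono hN hk⟩ ?_
  · simpa [evenTuple_evenAbove hN hk] using this
  · intro l hl
    split_ifs with he
    · by_contra hne
      exact hl (Subtype.ext (eq_evenAbove hN he (le_of_hMinor_ne_zero l.2 hk hne)
        fun i j hij => interlace_of_hMinor_singleton_ne_zero l.2 hk hne hij))
    · rfl

open Classical in
lemma hasSum_even_below (hk : StrictMono k) (x : R) :
    HasSum (fun l : StrictTuple N => if EvenTuple l.1 then hMinor {x} k l.1 else 0)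
      (hMinor {x} k (evenBelow hN k)) := by
  have := hasSum_single
    (f := fun l : StrictTuple N => if EvenTuple l.1 then hMinor {x} k l.1 else 0)
    ⟨evenBelow hN k, evenBelow_strictMono hN hk⟩ ?_
  · simpa [evenTuple_evenBelow hN] using this
  · intro l hl
    split_ifs with he
    · by_contra hne
      exact hl (Subtype.ext (eq_evenBelow hN he (le_of_hMinor_ne_zero hk l.2 hne)
        fun i j hij => interlace_of_hMinor_singleton_ne_zero hk l.2 hne hij))
    · rfl

/-- Branching as an (actually finite) sum over tuples. -/
lemma hasSum_branch (X Y : Multiset R) (l m : StrictTuple N) :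
    HasSum (fun k : StrictTuple N => hMinor X l.1 k.1 * hMinor Y k.1 m.1)
      (hMinor (X + Y) l.1 m.1) := by
  set L := Finset.univ.sup l.1
  have hL : ∀ i, l.1 i ≤ L := fun i => Finset.le_sup (f := l.1) (Finset.mem_univ i)
  rw [hMinor_add X Y hL, ← sum_strictTupleWindow N L fun k => hMinor X l.1 k * hMinor Y k m.1]
  refine hasSum_sum_of_ne_finset_zero fun k hk => ?_
  by_contra hne
  apply hk
  simp only [strictTupleWindow, Finset.mem_subtype, mem_strictTuples]
  exact ⟨fun i => (le_of_hMinor_ne_zero l.2 k.2 (left_ne_zero_of_mul hne) i).trans (hL i), k.2⟩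

variable {P : Set (RingSeminorm R)}

lemma zpow_sub_le {r : ℝ} (hr0 : 0 < r) (hr1 : r ≤ 1) (a : ℕ) (b c : ℤ) (h : (a : ℤ) - c ≤ b) :
    r ^ b ≤ r ^ (-c) * r ^ a := by
  rw [← zpow_natCast, ← zpow_add₀ hr0.ne']
  exact zpow_le_zpow_right_of_le_one₀ hr0 hr1 (by linarith)

/-- Summability over pairs `m ≤ l` of a product of a skew and a straight minor, with the straight
minor at the larger (`Q = true`) or the smaller index. -/
lemma summable_hMinor_pair (hP : IsSummabilityFamily P) (X Y : Multiset R)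
    (hX : ∀ x ∈ X, Small P x) (hY : ∀ y ∈ Y, Small P y) (Q : Bool)
    (s : StrictTuple N × StrictTuple N → Prop) [DecidablePred s] :
    Summable fun x : StrictTuple N × StrictTuple N =>
      if s x then hMinor Y x.1.1 x.2.1 * hMinor X (if Q then x.1.1 else x.2.1) (emptyTuple N)
      else 0 := by
  refine hP.summable _ fun p hp => ?_
  obtain ⟨r, K, hr0, hr1, hK, hb⟩ := exists_hMinor_mul_bound p (hP.one_le p hp) X Y
    (fun x h => hX x h p hp) (fun x h => hY x h p hp) N
  refine summable_pair p (r := r) (K := K * r ^ (-∑ i, (emptyTuple N i : ℤ))) hr0 hr1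
    (by positivity) _ (fun l m hne i => ?_) (fun l m hle => ?_)
  · simp only [ne_eq, ite_eq_right_iff, not_forall] at hne
    exact le_of_hMinor_ne_zero l.2 m.2 (left_ne_zero_of_mul hne.2) i
  · simp only
    split_ifs
    · refine (hb l.1 l.1 m.1 (emptyTuple N)).trans ?_
      rw [mul_assoc]
      refine mul_le_mul_of_nonneg_left (zpow_sub_le hr0 hr1.le _ _ _ ?_) hK
      have : (∑ i, (m.1 i : ℤ)) ≤ ∑ i, (l.1 i : ℤ) :=
        Finset.sum_le_sum fun i _ => by exact_mod_cast hle i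
      push_cast
      linarith
    · refine (hb l.1 m.1 m.1 (emptyTuple N)).trans ?_
      rw [mul_assoc]
      refine mul_le_mul_of_nonneg_left (zpow_sub_le hr0 hr1.le _ _ _ ?_) hK
      push_cast
      linarith
    · rw [map_zero]; positivity

variable [IsTopologicalRing R] [T2Space R]

open Classical in
/-- Littlewood's identity: the sum of `s_λ(X)` over all `λ` with even transpose is
`∏_{i < j} 1 / (1 - x_i x_j)`. On adding a variable `x`, branching gives a double sum over even `λ`
and `κ` below `λ`. For fixed `κ` the even `λ` above may be exchanged for the even `ν` below, and
then the sum over `κ` is `s_ν(X) ∏ 1 / (1 - x x_i)` by `hasSum_skew`. -/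
lemma hasSum_even (hP : IsSummabilityFamily P) (hN : Even N) (X : Multiset R) (hX : X.card ≤ N)
    (hXs : ∀ x ∈ X, Small P x) :
    HasSum (fun l : StrictTuple N =>
      if EvenTuple l.1 then hMinor X l.1 (emptyTuple N) else 0) (pairProd X) := by
  have hreg : RegularSpace R := IsTopologicalAddGroup.regularSpace R
  set e : StrictTuple N := ⟨emptyTuple N, emptyTuple_strictMono⟩ with he
  induction X using Multiset.induction_on with
  | empty =>
    have := hasSum_single (f := fun l : StrictTuple N =>
      if EvenTuple l.1 then hMinor (0 : Multiset R) l.1 (emptyTuple N) else 0) e ?_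
    · simpa [he, evenTuple_emptyTuple, hMinor_self (0 : Multiset R) emptyTuple_strictMono]
        using this
    · intro l hl
      rw [hMinor_empty l.2 emptyTuple_strictMono, if_neg fun h => hl (Subtype.ext h), ite_self]
  | cons x X ih =>
    have hXs' : ∀ a ∈ X, Small P a := fun a ha => hXs a (Multiset.mem_cons_of_mem ha)
    have hx : ∀ a ∈ ({x} : Multiset R), Small P a := by
      intro a ha
      rw [Multiset.mem_singleton.mp ha]
      exact hXs x (by simp)
    rw [Multiset.card_cons] at hX
    have hX' : X.card ≤ N := by omega
    -- `f (l, k)` with `l` even, `l` above `k`; `g (k, v)` with `v` even, `k` above `v`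
    have hf := (summable_hMinor_pair (N := N) hP X {x} hXs' hx false
      (fun y => EvenTuple y.1.1)).hasSum
    have hg := (summable_hMinor_pair (N := N) hP X {x} hXs' hx true
      (fun y => EvenTuple y.2.1)).hasSum
    set S := ∑' y : StrictTuple N × StrictTuple N, if EvenTuple y.1.1 then
      hMinor {x} y.1.1 y.2.1 * hMinor X (if false then y.1.1 else y.2.1) (emptyTuple N) else 0
    set T := ∑' y : StrictTuple N × StrictTuple N, if EvenTuple y.2.1 then
      hMinor {x} y.1.1 y.2.1 * hMinor X (if true then y.1.1 else y.2.1) (emptyTuple N) else 0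
    have h1 : HasSum (fun l : StrictTuple N =>
        if EvenTuple l.1 then hMinor (x ::ₘ X) l.1 (emptyTuple N) else 0) S := by
      refine hf.prod_fiberwise fun l => ?_
      simp only [Bool.false_eq_true, if_false]
      split_ifs
      · exact hasSum_branch {x} X l e
      · exact hasSum_zero
    have h2 : HasSum (fun k : StrictTuple N =>
        hMinor {x} (evenAbove hN k.1) k.1 * hMinor X k.1 (emptyTuple N)) S := by
      have hf' := (Equiv.prodComm (StrictTuple N) (StrictTuple N)).hasSum_iff.mpr hf
      refine hf'.prod_fiberwise fun k => ?_
      have := (hasSum_even_above hN k.2 x).mul_right (hMinor X k.1 (emptyTuple N))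
      simpa [Function.comp_def, ite_mul] using this
    have h3 : HasSum (fun k : StrictTuple N =>
        hMinor {x} k.1 (evenBelow hN k.1) * hMinor X k.1 (emptyTuple N)) T := by
      refine hg.prod_fiberwise fun k => ?_
      have := (hasSum_even_below hN k.2 x).mul_right (hMinor X k.1 (emptyTuple N))
      simpa [ite_mul] using this
    have h4 : HasSum (fun v : StrictTuple N => if EvenTuple v.1 then
        hMinor X v.1 (emptyTuple N) * cauchyProd X {x} else 0) T := by
      have hg' := (Equiv.prodComm (StrictTuple N) (StrictTuple N)).hasSum_iff.mpr hg
      refine hg'.prod_fiberwise fun v => ?_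
      simp only [Function.comp_def, Equiv.prodComm_apply, Prod.fst_swap, Prod.snd_swap, if_true]
      by_cases hv : EvenTuple v.1
      · simpa only [hv, if_true] using hasSum_skew hP X {x} hX' hXs' hx v
      · simpa only [hv, if_false] using hasSum_zero
    have h5 : S = T := by
      refine h2.unique ?_
      simp_rw [fun k : StrictTuple N => hMinor_evenAbove hN k.2 x]
      exact h3
    have h6 : T = pairProd X * cauchyProd X {x} := by
      refine h4.unique ?_
      simpa [ite_mul] using (ih hX' hXs').mul_right (cauchyProd X {x})
    rw [pairProd_cons, cauchyProd_comm, ← h6, ← h5]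
    exact h1

open Classical in
/-- `∑_λ τ_λ(Y) s_λ(X) = ∏_{i < j} 1 / (1 - x_i x_j) ∏ 1 / (1 - x y)`, in terms of tuples. -/
lemma hasSum_tau (hP : IsSummabilityFamily P) (hN : Even N) (X Y : Multiset R) (hX : X.card ≤ N)
    (hXs : ∀ x ∈ X, Small P x) (hYs : ∀ y ∈ Y, Small P y) (t : StrictTuple N → R)
    (ht : ∀ l, HasSum (fun m : StrictTuple N =>
      if EvenTuple m.1 then hMinor Y l.1 m.1 else 0) (t l)) :
    HasSum (fun l : StrictTuple N => t l * hMinor X l.1 (emptyTuple N))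
      (pairProd X * cauchyProd X Y) := by
  have hreg : RegularSpace R := IsTopologicalAddGroup.regularSpace R
  have hg := (summable_hMinor_pair (N := N) hP X Y hXs hYs true
    (fun y => EvenTuple y.2.1)).hasSum
  set T := ∑' y : StrictTuple N × StrictTuple N, if EvenTuple y.2.1 then
    hMinor Y y.1.1 y.2.1 * hMinor X (if true then y.1.1 else y.2.1) (emptyTuple N) else 0
  have h3 : HasSum (fun l : StrictTuple N => t l * hMinor X l.1 (emptyTuple N)) T := by
    refine hg.prod_fiberwise fun l => ?_
    have := (ht l).mul_right (hMinor X l.1 (emptyTuple N))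
    simpa [ite_mul] using this
  have h4 : HasSum (fun v : StrictTuple N => if EvenTuple v.1 then
      hMinor X v.1 (emptyTuple N) * cauchyProd X Y else 0) T := by
    have hg' := (Equiv.prodComm (StrictTuple N) (StrictTuple N)).hasSum_iff.mpr hg
    refine hg'.prod_fiberwise fun v => ?_
    simp only [Function.comp_def, Equiv.prodComm_apply, Prod.fst_swap, Prod.snd_swap, if_true]
    by_cases hv : EvenTuple v.1
    · simpa only [hv, if_true] using hasSum_skew hP X Y hX hXs hYs v
    · simpa only [hv, if_false] using hasSum_zero
  have h6 : T = pairProd X * cauchyProd X Y := by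
    refine h4.unique ?_
    simpa [ite_mul] using (hasSum_even hP hN X hX hXs).mul_right (cauchyProd X Y)
  rw [← h6]
  exact h3

end Littlewood

/-! ### Young diagrams and the partition functions -/

section Diagrams

variable {R : Type*} [CommRing R] {N : ℕ}

/-- The strictly increasing `N`-tuple `λ_{N - 1 - i} + i` of a Young diagram (parts counted
from `0`). -/
def betaTuple (N : ℕ) (Λ : YoungDiagram) : Fin N → ℕ := fun i => Λ.rowLen (N - 1 - i) + i

lemma betaTuple_strictMono (Λ : YoungDiagram) : StrictMono (betaTuple N Λ) := by
  intro i j hij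
  have h1 : (i : ℕ) < j := hij
  have := Λ.rowLen_anti (N - 1 - j) (N - 1 - i) (by omega)
  simp only [betaTuple]
  omega

lemma rowLen_pos_iff (Λ : YoungDiagram) (i : ℕ) : 0 < Λ.rowLen i ↔ i < Λ.colLen 0 := by
  rw [← YoungDiagram.mem_iff_lt_rowLen, YoungDiagram.mem_iff_lt_colLen]

/-- Adding a part `0` to both partitions does not change the skew Schur function. -/
lemma hMinor_betaTuple_succ (X : Multiset R) (Λ M : YoungDiagram) (hΛ : Λ.colLen 0 ≤ N)
    (hM : M.colLen 0 ≤ N) :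
    hMinor X (betaTuple (N + 1) Λ) (betaTuple (N + 1) M) =
      hMinor X (betaTuple N Λ) (betaTuple N M) := by
  have h1 : Λ.rowLen N = 0 := by have := (rowLen_pos_iff Λ N).not.mpr (by omega); omega
  have h2 : M.rowLen N = 0 := by have := (rowLen_pos_iff M N).not.mpr (by omega); omega
  unfold hMinor
  rw [Matrix.det_succ_row_zero, Fin.sum_univ_succ, Finset.sum_eq_zero]
  · simp only [Fin.val_zero, pow_zero, Matrix.of_apply, betaTuple, Nat.add_sub_cancel, Nat.sub_zero,
      h1, h2, add_zero, Nat.cast_zero, sub_zero, hZ_zero, one_mul]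
    congr 1
    ext i j
    simp only [Matrix.submatrix_apply, Matrix.of_apply, Fin.succAbove_zero, Fin.val_succ]
    congr 1
    rw [show N - ((i : ℕ) + 1) = N - 1 - i by omega, show N - ((j : ℕ) + 1) = N - 1 - j by omega]
    push_cast
    ring
  · intro j _
    have : hZ X ((betaTuple (N + 1) Λ 0 : ℤ) - (betaTuple (N + 1) M j.succ : ℤ)) = 0 := by
      apply hZ_of_neg
      simp only [betaTuple, Fin.val_zero, Nat.add_sub_cancel, Nat.sub_zero, h1, Fin.val_succ]
      push_cast
      omega
    simp [this]

lemma skewSchur_eq_hMinor {ι : Type*} [Fintype ι] [DecidableEq ι] (a : ι → R)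
    (Λ M : YoungDiagram) (hΛ : Λ.colLen 0 ≤ N) (hM : M.colLen 0 ≤ Λ.colLen 0) :
    skewSchur Λ M a = hMinor (Finset.univ.val.map a) (betaTuple N Λ) (betaTuple N M) := by
  induction N, hΛ using Nat.le_induction with
  | base =>
    unfold skewSchur hMinor
    rw [← Matrix.det_submatrix_equiv_self Fin.revPerm]
    congr 1
    ext i j
    simp only [Matrix.submatrix_apply, Matrix.of_apply, complete_eq_hZ, Fin.revPerm_apply,
      Fin.val_rev, betaTuple]
    congr 1
    have := i.2
    have := j.2
    rw [show Λ.colLen 0 - (i + 1) = Λ.colLen 0 - 1 - i by omega,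
      show Λ.colLen 0 - (j + 1) = Λ.colLen 0 - 1 - j by omega]
    push_cast
    omega
  | succ n hn ih => rw [ih, hMinor_betaTuple_succ _ _ _ hn (hM.trans hn)]

/-- The `i`-th part of the partition encoded by a tuple. -/
def tuplePart (l : Fin N → ℕ) (i : ℕ) : ℕ :=
  if h : i < N then l ⟨N - 1 - i, by omega⟩ - (N - 1 - i) else 0

lemma tuplePart_anti {l : Fin N → ℕ} (hl : StrictMono l) {i j : ℕ} (hij : i ≤ j) :
    tuplePart l j ≤ tuplePart l i := by
  unfold tuplePart
  split_ifs with h1 h2 h2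
  · have key : ∀ d a : ℕ, ∀ h : a + d < N, l ⟨a, by omega⟩ + d ≤ l ⟨a + d, h⟩ := by
      intro d
      induction d with
      | zero => intro a h; simp
      | succ d ih =>
        intro a h
        have h3 := ih a (by omega)
        have h4 : l ⟨a + d, by omega⟩ < l ⟨a + (d + 1), h⟩ := hl (by simp)
        omega
    have h5 := key (j - i) (N - 1 - j) (by omega)
    have e : (⟨N - 1 - j + (j - i), by omega⟩ : Fin N) = ⟨N - 1 - i, by omega⟩ :=
      Fin.ext (by simp only; omega)
    rw [e] at h5
    omega
  · omega
  · omega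
  · exact le_rfl

/-- The Young diagram encoded by a strictly increasing tuple. -/
def tupleDiagram (l : StrictTuple N) : YoungDiagram where
  cells := (Finset.range N).biUnion fun i => (Finset.range (tuplePart l.1 i)).image fun j => (i, j)
  isLowerSet := by
    rintro ⟨i, j⟩ ⟨i', j'⟩ hle h
    obtain ⟨h1, h2⟩ := Prod.mk_le_mk.mp hle
    simp only [Finset.coe_biUnion, Finset.coe_range, Set.mem_Iio, Finset.coe_image, Set.mem_iUnion,
      Set.mem_image, Prod.mk.injEq, exists_prop] at h ⊢
    obtain ⟨a, ha, b, hb, rfl, rfl⟩ := h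
    exact ⟨i', by omega, j', by have := tuplePart_anti l.2 h1; omega, rfl, rfl⟩

lemma rowLen_tupleDiagram (l : StrictTuple N) (i : ℕ) :
    (tupleDiagram l).rowLen i = tuplePart l.1 i := by
  have h : ∀ j, j < (tupleDiagram l).rowLen i ↔ j < tuplePart l.1 i := by
    intro j
    rw [← YoungDiagram.mem_iff_lt_rowLen, ← YoungDiagram.mem_cells]
    simp only [tupleDiagram, Finset.mem_biUnion, Finset.mem_range, Finset.mem_image, Prod.mk.injEq]
    constructor
    · rintro ⟨a, _, b, hb, rfl, rfl⟩
      exact hb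
    · intro hj
      refine ⟨i, ?_, j, hj, rfl, rfl⟩
      by_contra hi
      simp [tuplePart, hi] at hj
  have h1 := h (tuplePart l.1 i)
  have h2 := h ((tupleDiagram l).rowLen i)
  omega

lemma betaTuple_tupleDiagram (l : StrictTuple N) : betaTuple N (tupleDiagram l) = l.1 := by
  ext i
  have := i.2
  have h := le_of_strictMono l.2 i
  simp only [betaTuple, rowLen_tupleDiagram, tuplePart]
  rw [dif_pos (by omega)]
  have e : (⟨N - 1 - (N - 1 - i), by omega⟩ : Fin N) = i := Fin.ext (by simp only; omega)
  rw [e]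
  omega

lemma tupleDiagram_injective : Function.Injective (tupleDiagram (N := N)) := fun l m h =>
  Subtype.ext (by rw [← betaTuple_tupleDiagram l, h, betaTuple_tupleDiagram])

lemma colLen_tupleDiagram_le (l : StrictTuple N) : (tupleDiagram l).colLen 0 ≤ N := by
  by_contra! h
  have := (rowLen_pos_iff (tupleDiagram l) N).mpr h
  rw [rowLen_tupleDiagram] at this
  simp [tuplePart] at this

lemma diagram_ext {Λ M : YoungDiagram} (h : ∀ i, Λ.rowLen i = M.rowLen i) : Λ = M := by
  ext ⟨i, j⟩
  rw [YoungDiagram.mem_cells, YoungDiagram.mem_cells, YoungDiagram.mem_iff_lt_rowLen,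
    YoungDiagram.mem_iff_lt_rowLen, h]

lemma diagram_le_iff {Λ M : YoungDiagram} : M ≤ Λ ↔ ∀ i, M.rowLen i ≤ Λ.rowLen i := by
  rw [← YoungDiagram.cells_subset_iff]
  constructor
  · intro h i
    by_contra! hlt
    have h1 : (i, Λ.rowLen i) ∈ M.cells := YoungDiagram.mem_iff_lt_rowLen.mpr hlt
    have h2 := YoungDiagram.mem_iff_lt_rowLen.mp (h h1)
    omega
  · rintro h ⟨i, j⟩ hij
    have h1 := YoungDiagram.mem_iff_lt_rowLen.mp hij
    exact YoungDiagram.mem_iff_lt_rowLen.mpr (h1.trans_le (h i))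

lemma tupleDiagram_betaTuple {Λ : YoungDiagram} (h : Λ.colLen 0 ≤ N) :
    tupleDiagram ⟨betaTuple N Λ, betaTuple_strictMono Λ⟩ = Λ := by
  refine diagram_ext fun i => ?_
  rw [rowLen_tupleDiagram]
  unfold tuplePart
  split_ifs with hi
  · simp only [betaTuple]
    rw [show N - 1 - (N - 1 - i) = i by omega]
    omega
  · have := (rowLen_pos_iff Λ i).not.mpr (by omega)
    omega

lemma mem_range_tupleDiagram {Λ : YoungDiagram} :
    Λ ∈ Set.range (tupleDiagram (N := N)) ↔ Λ.colLen 0 ≤ N :=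
  ⟨by rintro ⟨l, rfl⟩; exact colLen_tupleDiagram_le l, fun h => ⟨_, tupleDiagram_betaTuple h⟩⟩

lemma colLen_mono {Λ M : YoungDiagram} (h : M ≤ Λ) : M.colLen 0 ≤ Λ.colLen 0 := by
  by_contra! hlt
  have h1 := (rowLen_pos_iff M _).mpr hlt
  have h2 := (rowLen_pos_iff Λ (Λ.colLen 0)).not.mpr (by omega)
  have := diagram_le_iff.mp h (Λ.colLen 0)
  omega

lemma tupleDiagram_le_iff (l m : StrictTuple N) :
    tupleDiagram m ≤ tupleDiagram l ↔ ∀ i, m.1 i ≤ l.1 i := by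
  rw [diagram_le_iff]
  constructor
  · intro h i
    rw [← betaTuple_tupleDiagram l, ← betaTuple_tupleDiagram m]
    exact Nat.add_le_add_right (h _) _
  · intro h i
    rw [rowLen_tupleDiagram, rowLen_tupleDiagram]
    unfold tuplePart
    split_ifs
    · exact Nat.sub_le_sub_right (h _) _
    · exact le_rfl

/-- A diagram has even columns if and only if its rows pair up. -/
lemma even_transpose_iff (Λ : YoungDiagram) :
    (∀ j, Even (Λ.transpose.rowLen j)) ↔ ∀ k, Λ.rowLen (2 * k) = Λ.rowLen (2 * k + 1) := by
  simp only [YoungDiagram.rowLen_transpose]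
  have hmem : ∀ i j, i < Λ.colLen j ↔ j < Λ.rowLen i := fun i j => by
    rw [← YoungDiagram.mem_iff_lt_colLen, YoungDiagram.mem_iff_lt_rowLen]
  constructor
  · intro h k
    have hle := Λ.rowLen_anti (2 * k) (2 * k + 1) (by omega)
    by_contra hne
    have h1 := (hmem (2 * k) (Λ.rowLen (2 * k + 1))).mpr (by omega)
    have h2 := (hmem (2 * k + 1) (Λ.rowLen (2 * k + 1))).not.mpr (by omega)
    obtain ⟨c, hc⟩ := h (Λ.rowLen (2 * k + 1))
    omega
  · intro h j
    by_contra hodd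
    obtain ⟨k, hk⟩ := Nat.not_even_iff_odd.mp hodd
    have h1 := (hmem (2 * k) j).mp (by omega)
    have h2 := (hmem (2 * k + 1) j).not.mp (by omega)
    have := h k
    omega

lemma evenTuple_iff (hN : Even N) (l : StrictTuple N) :
    (∀ j, Even ((tupleDiagram l).transpose.rowLen j)) ↔ EvenTuple l.1 := by
  rw [even_transpose_iff]
  obtain ⟨n, hn⟩ := hN
  simp only [rowLen_tupleDiagram]
  constructor
  · rintro h i hi ⟨a, ha⟩
    have h1 := h (n - 1 - a)
    unfold tuplePart at h1
    rw [dif_pos (by omega), dif_pos (by omega)] at h1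
    have h2 := le_of_strictMono l.2 ⟨i, by omega⟩
    have h3 := le_of_strictMono l.2 ⟨i + 1, hi⟩
    have e1 : (⟨N - 1 - 2 * (n - 1 - a), by omega⟩ : Fin N) = ⟨i + 1, hi⟩ :=
      Fin.ext (by simp only; omega)
    have e2 : (⟨N - 1 - (2 * (n - 1 - a) + 1), by omega⟩ : Fin N) = ⟨i, by omega⟩ :=
      Fin.ext (by simp only; omega)
    rw [e1, e2] at h1
    simp only at h2 h3
    omega
  · intro h k
    unfold tuplePart
    by_cases hk : 2 * k < N
    · rw [dif_pos hk, dif_pos (by omega)]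
      have h1 := h (N - 1 - (2 * k + 1)) (by omega) ⟨n - 1 - k, by omega⟩
      have e : (⟨N - 1 - (2 * k + 1) + 1, by omega⟩ : Fin N) = ⟨N - 1 - 2 * k, by omega⟩ :=
        Fin.ext (by simp only; omega)
      rw [e] at h1
      omega
    · rw [dif_neg hk, dif_neg (by omega)]

lemma betaTuple_bot : betaTuple N ⊥ = emptyTuple N := by
  ext i
  have : (⊥ : YoungDiagram).rowLen (N - 1 - i) = 0 := by
    by_contra hne
    have := YoungDiagram.mem_iff_lt_rowLen.mpr (Nat.pos_of_ne_zero hne)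
    exact YoungDiagram.notMem_bot _ this
  simp [betaTuple, emptyTuple, this]

lemma schur_eq_hMinor {ι : Type*} [Fintype ι] [DecidableEq ι] (a : ι → R) (Λ : YoungDiagram)
    (hΛ : Λ.colLen 0 ≤ N) :
    schur Λ a = hMinor (Finset.univ.val.map a) (betaTuple N Λ) (emptyTuple N) := by
  rw [schur, skewSchur_eq_hMinor a Λ ⊥ hΛ (colLen_mono bot_le), betaTuple_bot]

lemma schur_eq_zero {ι : Type*} [Fintype ι] [DecidableEq ι] (a : ι → R) (Λ : YoungDiagram)
    (h : Fintype.card ι < Λ.colLen 0) : schur Λ a = 0 := by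
  by_contra hne
  rw [schur_eq_hMinor a Λ le_rfl] at hne
  have h1 := eq_of_hMinor_emptyTuple_ne_zero (betaTuple_strictMono Λ) hne ⟨0, by omega⟩
    (by simpa using h)
  have h2 := (rowLen_pos_iff Λ (Λ.colLen 0 - 1)).mpr (by omega)
  simp only [betaTuple] at h1
  simp at h1
  omega

open Classical in
/-- `τ_λ` as a sum over tuples. -/
lemma hasSum_tau_tuple [TopologicalSpace R] {ι : Type*} [Fintype ι] [DecidableEq ι] (a : ι → R)
    (hN : Even N) (l : StrictTuple N) :
    HasSum (fun m : StrictTuple N => if EvenTuple m.1 then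
      hMinor (Finset.univ.val.map a) l.1 m.1 else 0) (tau (tupleDiagram l) a) := by
  set Λ := tupleDiagram l
  set cond : YoungDiagram → Prop := fun M => M ≤ Λ ∧ ∀ j, Even (M.transpose.rowLen j)
  set g : YoungDiagram → R := fun M => if cond M then skewSchur Λ M a else 0 with hg
  have hfin : {M : YoungDiagram | M ≤ Λ}.Finite := by
    refine Set.Finite.of_finite_image (f := YoungDiagram.cells) ?_ fun M _ M' _ h =>
      YoungDiagram.ext h
    refine (Λ.cells.powerset.finite_toSet).subset ?_
    rintro _ ⟨M, hM, rfl⟩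
    simpa using hM
  have hsupp : (Function.support g).Finite := by
    refine hfin.subset fun M hM => ?_
    by_contra hle
    exact hM (if_neg fun h => hle h.1)
  have htau : tau Λ a = ∑ᶠ M, g M := by
    unfold tau
    refine finsum_congr fun M => ?_
    simp only [hg]
    split_ifs with h
    · rw [finsum_eq_if, if_pos h]
    · rw [finsum_eq_if, if_neg h]
  have hs : HasSum g (tau Λ a) := by
    rw [htau, finsum_eq_sum _ hsupp]
    refine hasSum_sum_of_ne_finset_zero fun M hM => ?_
    simpa using hM
  have hz : ∀ M ∉ Set.range (tupleDiagram (N := N)), g M = 0 := by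
    intro M hM
    refine if_neg fun h => hM (mem_range_tupleDiagram.mpr ?_)
    exact (colLen_mono h.1).trans (colLen_tupleDiagram_le l)
  rw [← tupleDiagram_injective.hasSum_iff hz] at hs
  convert hs using 1
  ext m
  simp only [Function.comp_apply, hg, cond, Λ, evenTuple_iff hN, tupleDiagram_le_iff]
  by_cases he : EvenTuple m.1
  · by_cases hle : ∀ i, m.1 i ≤ l.1 i
    · rw [if_pos he, if_pos ⟨hle, he⟩, skewSchur_eq_hMinor a _ _ (colLen_tupleDiagram_le l)
        (colLen_mono ((tupleDiagram_le_iff l m).mpr hle)), betaTuple_tupleDiagram,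
        betaTuple_tupleDiagram]
    · rw [if_pos he, if_neg fun h => hle h.1]
      push Not at hle
      obtain ⟨k, hk⟩ := hle
      exact hMinor_eq_zero _ l.2 m.2 k hk
  · rw [if_neg he, if_neg fun h => he h.2]

variable [TopologicalSpace R] [IsTopologicalRing R] [T2Space R] {P : Set (RingSeminorm R)}

/-- The Cauchy identity. -/
theorem partitionF_eq (hP : IsSummabilityFamily P) {ι κ : Type*} [Fintype ι] [DecidableEq ι]
    [Fintype κ] [DecidableEq κ] (X : ι → R) (Y : κ → R) (hX : ∀ i, Small P (X i))
    (hY : ∀ i, Small P (Y i)) :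
    partitionF X Y = cauchyProd (Finset.univ.val.map X) (Finset.univ.val.map Y) := by
  set N := Fintype.card ι
  have h := hasSum_skew (N := N) hP (Finset.univ.val.map X) (Finset.univ.val.map Y) (by simp [N])
    (by simpa using hX) (by simpa using hY) ⟨emptyTuple N, emptyTuple_strictMono⟩
  rw [hMinor_self _ emptyTuple_strictMono, one_mul] at h
  refine HasSum.tsum_eq ?_
  rw [← (tupleDiagram_injective (N := N)).hasSum_iff]
  · convert h using 2 with l
    rw [Function.comp_apply, schur_eq_hMinor X _ (colLen_tupleDiagram_le l),
      schur_eq_hMinor Y _ (colLen_tupleDiagram_le l), betaTuple_tupleDiagram, mul_comm]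
  · intro Λ hΛ
    rw [mem_range_tupleDiagram, not_le] at hΛ
    rw [schur_eq_zero X Λ hΛ, zero_mul]

/-- The partition function of the Pfaffian Schur measure in product form. -/
theorem partitionZ_eq (hP : IsSummabilityFamily P) {ι κ : Type*} [Fintype ι] [DecidableEq ι]
    [Fintype κ] [DecidableEq κ] (X : ι → R) (Y : κ → R) (hX : ∀ i, Small P (X i))
    (hY : ∀ i, Small P (Y i)) :
    partitionZ X Y = pairProd (Finset.univ.val.map X) *
      cauchyProd (Finset.univ.val.map X) (Finset.univ.val.map Y) := by
  set N := 2 * Fintype.card ι with hN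
  have hev : Even N := ⟨Fintype.card ι, by omega⟩
  have h := hasSum_tau (N := N) hP hev (Finset.univ.val.map X) (Finset.univ.val.map Y)
    (by simp [N]; omega) (by simpa using hX) (by simpa using hY) (fun l => tau (tupleDiagram l) Y)
    (fun l => hasSum_tau_tuple Y hev l)
  refine HasSum.tsum_eq ?_
  rw [← (tupleDiagram_injective (N := N)).hasSum_iff]
  · convert h using 2 with l
    rw [Function.comp_apply, schur_eq_hMinor X _ (colLen_tupleDiagram_le l),
      betaTuple_tupleDiagram]
  · intro Λ hΛ
    rw [mem_range_tupleDiagram, not_le] at hΛ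
    rw [schur_eq_zero X Λ (by omega), mul_zero]

end Diagrams

/-! ### Plethystic exponentials -/

section PlethysticExp

open scoped PowerSeries.derivative

variable {R : Type*} [CommRing R]

/-- The series `∑_{n ≥ 1} γ_n t^n`. -/
def logDerivSeries (γ : ℕ → R) : PowerSeries R :=
  PowerSeries.mk fun n => if n = 0 then 0 else γ n

/-- `F = exp (∑_{n ≥ 1} γ_n t^n / n)`, expressed through the logarithmic derivative of `F`. -/
def IsPlethysticExp (γ : ℕ → R) (F : PowerSeries R) : Prop :=
  PowerSeries.constantCoeff F = 1 ∧
    PowerSeries.X * PowerSeries.derivative R F = logDerivSeries γ * F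

lemma IsPlethysticExp.congr {γ δ : ℕ → R} {F : PowerSeries R} (h : IsPlethysticExp γ F)
    (hγ : ∀ n, n ≠ 0 → γ n = δ n) : IsPlethysticExp δ F := by
  have : logDerivSeries γ = logDerivSeries δ := by
    ext n
    simp only [logDerivSeries, PowerSeries.coeff_mk]
    split_ifs with hn
    · rfl
    · exact hγ n hn
  rwa [IsPlethysticExp, ← this]

lemma IsPlethysticExp.mul {γ δ : ℕ → R} {F G : PowerSeries R} (hF : IsPlethysticExp γ F)
    (hG : IsPlethysticExp δ G) : IsPlethysticExp (fun n => γ n + δ n) (F * G) := by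
  refine ⟨by rw [map_mul, hF.1, hG.1, one_mul], ?_⟩
  have : logDerivSeries (fun n => γ n + δ n) = logDerivSeries γ + logDerivSeries δ := by
    ext n
    simp only [logDerivSeries, PowerSeries.coeff_mk, map_add]
    split_ifs <;> simp
  rw [this, Derivation.leibniz, smul_eq_mul, smul_eq_mul]
  linear_combination G * hF.2 + F * hG.2

lemma isPlethysticExp_one : IsPlethysticExp (fun _ => (0 : R)) 1 := by
  refine ⟨by simp, ?_⟩
  have : logDerivSeries (fun _ => (0 : R)) = 0 := by
    ext n; simp [logDerivSeries]
  rw [this]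
  simp

lemma IsPlethysticExp.multiset_prod {ι : Type*} (s : Multiset ι) (γ : ι → ℕ → R)
    (F : ι → PowerSeries R) (h : ∀ i ∈ s, IsPlethysticExp (γ i) (F i)) :
    IsPlethysticExp (fun n => (s.map fun i => γ i n).sum) (s.map F).prod := by
  induction s using Multiset.induction_on with
  | empty => simpa using isPlethysticExp_one
  | cons a s ih =>
    simp only [Multiset.map_cons, Multiset.prod_cons, Multiset.sum_cons]
    exact (h a (by simp)).mul (ih fun i hi => h i (Multiset.mem_cons_of_mem hi))

lemma IsPlethysticExp.inv {γ : ℕ → R} {F G : PowerSeries R} (hF : IsPlethysticExp γ F)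
    (hFG : F * G = 1) : IsPlethysticExp (fun n => - γ n) G := by
  constructor
  · have := congrArg PowerSeries.constantCoeff hFG
    rwa [map_mul, hF.1, one_mul, map_one] at this
  · have h1 : logDerivSeries (fun n => - γ n) = - logDerivSeries γ := by
      ext n
      simp only [logDerivSeries, PowerSeries.coeff_mk, map_neg]
      split_ifs <;> simp
    have h2 := congrArg (PowerSeries.derivative R) hFG
    rw [Derivation.leibniz, smul_eq_mul, smul_eq_mul] at h2
    simp only [Derivation.map_one_eq_zero] at h2
    rw [h1]
    -- multiply the derivative of `F G = 1` by `t G`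
    linear_combination PowerSeries.X * G * h2 - PowerSeries.X * PowerSeries.derivative R G * hFG -
      G * G * hF.2 - logDerivSeries γ * G * hFG

lemma isPlethysticExp_one_sub (r : ℕ) (hr : 0 < r) (c : R) :
    IsPlethysticExp (fun n => if r ∣ n then -((r : R) * c ^ (n / r)) else 0)
      (1 - PowerSeries.C c * PowerSeries.X ^ r) := by
  refine ⟨by simp [hr.ne'], ?_⟩
  have hd : PowerSeries.X * PowerSeries.derivative R (1 - PowerSeries.C c * PowerSeries.X ^ r) =
      - ((r : PowerSeries R) * PowerSeries.C c * PowerSeries.X ^ r) := by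
    rw [map_sub, Derivation.map_one_eq_zero, Derivation.leibniz, PowerSeries.derivative_C,
      Derivation.leibniz_pow, PowerSeries.derivative_X]
    obtain ⟨r, rfl⟩ := Nat.exists_eq_succ_of_ne_zero hr.ne'
    simp only [smul_eq_mul, nsmul_eq_mul, Nat.succ_sub_one, pow_succ]
    ring
  rw [hd]
  ext n
  have e : (r : PowerSeries R) * PowerSeries.C c * PowerSeries.X ^ r =
      PowerSeries.C ((r : R) * c) * PowerSeries.X ^ r := by simp
  rw [e, mul_sub, mul_one, mul_left_comm, map_sub, map_neg, PowerSeries.coeff_C_mul,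
    PowerSeries.coeff_C_mul, PowerSeries.coeff_mul_X_pow', PowerSeries.coeff_X_pow]
  simp only [logDerivSeries, PowerSeries.coeff_mk]
  by_cases hn : r ≤ n
  · obtain ⟨m, rfl⟩ := Nat.exists_eq_add_of_le hn
    rw [if_pos hn, Nat.add_sub_cancel_left, if_neg (by omega : r + m ≠ 0)]
    have hdvd : r ∣ r + m ↔ r ∣ m := by simp
    by_cases h0 : m = 0
    · subst h0; simp [Nat.div_self hr]
    · rw [if_neg (by omega : ¬ r + m = r), if_neg h0]
      by_cases hm : r ∣ m
      · rw [if_pos (hdvd.mpr hm), if_pos hm, Nat.add_div_left _ hr, pow_succ']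
        ring
      · rw [if_neg (hdvd.not.mpr hm), if_neg hm]
        ring
  · rw [if_neg hn, if_neg (by omega : ¬ n = r)]
    by_cases h0 : n = 0
    · simp [h0]
    · rw [if_neg h0, if_neg fun h => hn (Nat.le_of_dvd (Nat.pos_of_ne_zero h0) h)]
      ring

lemma isPlethysticExp_geomPow (r : ℕ) (hr : 0 < r) (c : R) :
    IsPlethysticExp (fun n => if r ∣ n then (r : R) * c ^ (n / r) else 0) (geomPow r c) := by
  refine ((isPlethysticExp_one_sub r hr c).inv (one_sub_mul_geomPow r hr c)).congr fun n _ => ?_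
  split_ifs <;> simp

lemma IsPlethysticExp.coeff_rec {γ : ℕ → R} {F : PowerSeries R} (hF : IsPlethysticExp γ F)
    (n : ℕ) : (n : R) * PowerSeries.coeff n F =
      ∑ j ∈ Finset.range n, γ (j + 1) * PowerSeries.coeff (n - (j + 1)) F := by
  have h := congrArg (PowerSeries.coeff n) hF.2
  cases n with
  | zero => simp
  | succ n =>
    rw [PowerSeries.coeff_succ_X_mul, PowerSeries.coeff_derivative, PowerSeries.coeff_mul,
      Finset.Nat.sum_antidiagonal_eq_sum_range_succ_mk, Finset.sum_range_succ'] at h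
    push_cast
    rw [mul_comm, h]
    simp [logDerivSeries]

variable [Algebra ℂ R]

lemma natCast_mul_injective {n : ℕ} (hn : n ≠ 0) {a b : R} (h : (n : R) * a = n * b) : a = b := by
  have h1 : ((n : ℂ)⁻¹) • ((n : R) * a) = a := by
    rw [← map_natCast (algebraMap ℂ R), ← Algebra.smul_def, smul_smul,
      inv_mul_cancel₀ (Nat.cast_ne_zero.mpr hn), one_smul]
  have h2 : ((n : ℂ)⁻¹) • ((n : R) * b) = b := by
    rw [← map_natCast (algebraMap ℂ R), ← Algebra.smul_def, smul_smul,
      inv_mul_cancel₀ (Nat.cast_ne_zero.mpr hn), one_smul]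
  rw [← h1, h, h2]

/-- The product `∏_i i^{m_i} m_i!` for a multiset. -/
def multisetZ (s : Multiset ℕ) : ℕ := ∏ i ∈ s.toFinset, i ^ s.count i * (s.count i).factorial

lemma multisetZ_eq {s : Multiset ℕ} {T : Finset ℕ} (h : s.toFinset ⊆ T) :
    multisetZ s = ∏ i ∈ T, i ^ s.count i * (s.count i).factorial := by
  refine Finset.prod_subset h fun i _ hi => ?_
  rw [Multiset.mem_toFinset, ← Multiset.count_eq_zero] at hi
  simp [hi]

lemma multisetZ_cons (j : ℕ) (s : Multiset ℕ) :
    multisetZ (j ::ₘ s) = j * (s.count j + 1) * multisetZ s := by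
  rw [multisetZ_eq (T := insert j s.toFinset) (by simp),
    multisetZ_eq (s := s) (T := insert j s.toFinset) (by simp),
    ← Finset.mul_prod_erase _ _ (Finset.mem_insert_self j _),
    ← Finset.mul_prod_erase (insert j s.toFinset)
      (fun i => i ^ s.count i * (s.count i).factorial) (Finset.mem_insert_self j _)]
  have : ∏ x ∈ (insert j s.toFinset).erase j,
      x ^ (j ::ₘ s).count x * ((j ::ₘ s).count x).factorial =
      ∏ x ∈ (insert j s.toFinset).erase j, x ^ s.count x * (s.count x).factorial := by
    refine Finset.prod_congr rfl fun x hx => ?_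
    rw [Multiset.count_cons_of_ne (Finset.ne_of_mem_erase hx)]
  rw [this, Multiset.count_cons_self, Nat.factorial_succ, pow_succ]
  ring

lemma multisetZ_ne_zero {s : Multiset ℕ} (h : ∀ i ∈ s, 0 < i) : multisetZ s ≠ 0 := by
  refine Finset.prod_ne_zero_iff.mpr fun i hi => ?_
  have := h i (Multiset.mem_toFinset.mp hi)
  positivity

lemma zFactor_ne_zero {n : ℕ} (ν : n.Partition) : (zFactor ν : ℂ) ≠ 0 :=
  Nat.cast_ne_zero.mpr (multisetZ_ne_zero fun _ hi => ν.parts_pos hi)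

/-- The sum `∑_{ν ⊢ n} γ_ν / z_ν`, where `γ_ν` is the product of `γ_i` over the parts `i` of `ν`. -/
def cycleSum (γ : ℕ → R) (n : ℕ) : R :=
  ∑ ν : n.Partition, (zFactor ν : ℂ)⁻¹ • (ν.parts.map γ).prod

/-- Removing a part of a partition. -/
def removePart {n : ℕ} (ν : n.Partition) (j : ℕ) (hj : j ∈ ν.parts) : (n - j).Partition where
  parts := ν.parts.erase j
  parts_pos h := ν.parts_pos (Multiset.mem_of_mem_erase h)
  parts_sum := by
    have h1 := ν.parts_sum
    rw [← Multiset.cons_erase hj, Multiset.sum_cons] at h1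
    omega

/-- Adding a part to a partition. -/
def addPart {n j : ℕ} (hj : 0 < j) (hjn : j ≤ n) (κ : (n - j).Partition) : n.Partition where
  parts := j ::ₘ κ.parts
  parts_pos h := by
    rcases Multiset.mem_cons.mp h with rfl | h
    · exact hj
    · exact κ.parts_pos h
  parts_sum := by rw [Multiset.sum_cons, κ.parts_sum]; omega

/-- Count the pairs of a partition of `n` and one of its parts: the parts of `ν` sum to `n`, and
removing a part `j` divides `z_ν` by `j m_j(ν)`. -/
lemma cycleSum_rec (γ : ℕ → R) (n : ℕ) :
    (n : R) * cycleSum γ n =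
      ∑ j ∈ Finset.range n, γ (j + 1) * cycleSum γ (n - (j + 1)) := by
  have h1 : (n : R) * cycleSum γ n = ∑ ν : n.Partition, ∑ j ∈ ν.parts.toFinset,
      ((ν.parts.count j * j : ℕ) : ℂ) • ((zFactor ν : ℂ)⁻¹ • (ν.parts.map γ).prod) := by
    rw [cycleSum, Finset.mul_sum]
    refine Finset.sum_congr rfl fun ν _ => ?_
    rw [← Finset.sum_smul, ← Nat.cast_sum]
    have h2 := Finset.sum_multiset_count ν.parts
    rw [ν.parts_sum] at h2
    simp only [smul_eq_mul] at h2
    rw [← h2, Algebra.smul_def (n : ℂ), map_natCast]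
  have h2 : ∑ j ∈ Finset.range n, γ (j + 1) * cycleSum γ (n - (j + 1)) =
      ∑ j ∈ Finset.range n, ∑ κ : (n - (j + 1)).Partition,
        (zFactor κ : ℂ)⁻¹ • (γ (j + 1) * (κ.parts.map γ).prod) := by
    refine Finset.sum_congr rfl fun j _ => ?_
    rw [cycleSum, Finset.mul_sum]
    refine Finset.sum_congr rfl fun κ _ => ?_
    rw [mul_smul_comm]
  rw [h1, h2, Finset.sum_sigma', Finset.sum_sigma']
  symm
  refine Finset.sum_bij
    (fun x hx => ⟨addPart (Nat.succ_pos x.1) (by simp at hx; omega) x.2, x.1 + 1⟩) ?_ ?_ ?_ ?_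
  · rintro ⟨j, κ⟩ hx
    simp [addPart]
  · rintro ⟨j, κ⟩ hx ⟨j', κ'⟩ hx' heq
    simp only [Sigma.mk.injEq, heq_eq_eq, Nat.add_right_cancel_iff] at heq
    obtain ⟨h1, rfl⟩ := heq
    have h3 := congrArg Nat.Partition.parts h1
    simp only [addPart, Multiset.cons_inj_right] at h3
    rw [Nat.Partition.ext h3]
  · rintro ⟨ν, j⟩ hx
    simp only [Finset.mem_sigma, Finset.mem_univ, Multiset.mem_toFinset, true_and] at hx
    have hpos := ν.parts_pos hx
    have hle : j ≤ n := by
      rw [← ν.parts_sum]; exact Multiset.le_sum_of_mem hx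
    obtain ⟨i, rfl⟩ := Nat.exists_eq_succ_of_ne_zero hpos.ne'
    refine ⟨⟨i, removePart ν (i + 1) hx⟩, by simp; omega, ?_⟩
    simp only [Sigma.mk.injEq, heq_eq_eq, and_true]
    refine Nat.Partition.ext ?_
    simp only [addPart, removePart]
    exact Multiset.cons_erase hx
  · rintro ⟨j, κ⟩ hx
    simp only [addPart, Multiset.map_cons, Multiset.prod_cons, Multiset.count_cons_self]
    rw [smul_smul]
    congr 1
    have hj : j + 1 ≤ n := by simp at hx; omega
    have hz : ∀ μ : n.Partition, μ.parts = (j + 1) ::ₘ κ.parts → zFactor μ =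
        (j + 1) * (κ.parts.count (j + 1) + 1) * zFactor κ := by
      intro μ hμ
      show multisetZ μ.parts = _
      rw [hμ]
      exact multisetZ_cons _ _
    rw [hz _ rfl]
    have := zFactor_ne_zero κ
    push_cast
    have h3 : (j : ℂ) + 1 ≠ 0 := by exact_mod_cast Nat.succ_ne_zero j
    have h4 : (Multiset.count (j + 1) κ.parts : ℂ) + 1 ≠ 0 := by
      exact Nat.cast_add_one_ne_zero _
    field_simp

/-- The coefficients of `exp (∑ γ_n t^n / n)` are `∑_{ν ⊢ n} γ_ν / z_ν`. -/
lemma IsPlethysticExp.coeff_eq_cycleSum {γ : ℕ → R} {F : PowerSeries R}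
    (hF : IsPlethysticExp γ F) (n : ℕ) : PowerSeries.coeff n F = cycleSum γ n := by
  induction n using Nat.strong_induction_on with
  | _ n ih =>
    by_cases hn : n = 0
    · subst hn
      rw [PowerSeries.coeff_zero_eq_constantCoeff_apply, hF.1, cycleSum,
        Fintype.sum_unique]
      simp [zFactor]
    · refine natCast_mul_injective hn ?_
      rw [hF.coeff_rec, cycleSum_rec]
      refine Finset.sum_congr rfl fun j hj => ?_
      rw [ih _ (by simp at hj; omega)]

end PlethysticExp

/-! ### Power sums and generating series of product type -/

section PowerSums

variable {R : Type*} [CommRing R]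

/-- The power sum `p_n` of a finite alphabet given as a multiset. -/
def psum (n : ℕ) (S : Multiset R) : R := (S.map fun x => x ^ n).sum

@[simp] lemma psum_zero (n : ℕ) : psum n (0 : Multiset R) = 0 := by simp [psum]

lemma psum_add (n : ℕ) (S T : Multiset R) : psum n (S + T) = psum n S + psum n T := by
  simp [psum]

lemma psum_cons (n : ℕ) (x : R) (S : Multiset R) : psum n (x ::ₘ S) = x ^ n + psum n S := by
  simp [psum]

lemma psum_map {S : Type*} [CommRing S] (f : R →+* S) (n : ℕ) (A : Multiset R) :
    psum n (A.map f) = f (psum n A) := by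
  simp [psum, map_multiset_sum]

/-- `∏ 1 / (1 - x y t)`. -/
def cauchySeries (A B : Multiset R) : PowerSeries R :=
  (A.map fun x => (B.map fun y => geomPow 1 (x * y)).prod).prod

/-- `∏ (1 - x y t^r)`. -/
def dualSeries (r : ℕ) (A B : Multiset R) : PowerSeries R :=
  (A.map fun x => (B.map fun y =>
    (1 - PowerSeries.C (x * y) * PowerSeries.X ^ r)).prod).prod

/-- `∏_{i < j} 1 / (1 - x_i x_j t^2)`. -/
def pairSeries (A : Multiset R) : PowerSeries R :=
  ((A.powersetCard 2).map fun s => geomPow 2 s.prod).prod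

/-- `∏ 1 / (1 - y^2 t^2)`. -/
def squareSeries (A : Multiset R) : PowerSeries R :=
  (A.map fun y => geomPow 2 (y ^ 2)).prod

/-- `∏ 1 / (1 - y^2)`. -/
def squareProd (A : Multiset R) : R := (A.map fun y => Ring.inverse (1 - y ^ 2)).prod

lemma sum_map_sum_map_pow (A B : Multiset R) (n : ℕ) :
    (A.map fun x => (B.map fun y => (x * y) ^ n).sum).sum = psum n A * psum n B := by
  simp only [mul_pow, Multiset.sum_map_mul_left, Multiset.sum_map_mul_right, psum]

lemma isPlethysticExp_cauchySeries (A B : Multiset R) :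
    IsPlethysticExp (fun n => psum n A * psum n B) (cauchySeries A B) := by
  refine (IsPlethysticExp.multiset_prod A _ _ fun x _ => IsPlethysticExp.multiset_prod B _ _
    fun y _ => isPlethysticExp_geomPow 1 one_pos (x * y)).congr fun n _ => ?_
  simp [sum_map_sum_map_pow]

lemma isPlethysticExp_dualSeries (r : ℕ) (hr : 0 < r) (A B : Multiset R) :
    IsPlethysticExp (fun n => if r ∣ n then -((r : R) * (psum (n / r) A * psum (n / r) B)) else 0)
      (dualSeries r A B) := by
  refine (IsPlethysticExp.multiset_prod A _ _ fun x _ => IsPlethysticExp.multiset_prod B _ _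
    fun y _ => isPlethysticExp_one_sub r hr (x * y)).congr fun n _ => ?_
  split_ifs
  · rw [← sum_map_sum_map_pow]
    simp [Multiset.sum_map_mul_left]
  · simp

lemma sum_powersetCard_two_pow (A : Multiset R) (n : ℕ) :
    ((A.powersetCard 2).map fun s => 2 * s.prod ^ n).sum = psum n A ^ 2 - psum (2 * n) A := by
  induction A using Multiset.induction_on with
  | empty => simp [Multiset.powersetCard_zero_right]
  | cons x A ih =>
    rw [Multiset.powersetCard_cons, Multiset.map_add, Multiset.sum_add, ih, psum_cons, psum_cons]
    simp only [Multiset.powersetCard_one, Multiset.map_map, Function.comp_def, Multiset.prod_cons,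
      Multiset.prod_singleton, mul_pow, Multiset.sum_map_mul_left]
    change _ + 2 * (x ^ n * psum n A) = _
    ring

lemma isPlethysticExp_pairSeries (A : Multiset R) :
    IsPlethysticExp (fun n => if 2 ∣ n then psum (n / 2) A ^ 2 - psum n A else 0)
      (pairSeries A) := by
  refine (IsPlethysticExp.multiset_prod _ _ _
    fun s _ => isPlethysticExp_geomPow 2 two_pos s.prod).congr fun n _ => ?_
  split_ifs with h
  · have := sum_powersetCard_two_pow A (n / 2)
    rw [Nat.mul_div_cancel' h] at this
    simpa using this
  · simp

lemma isPlethysticExp_squareSeries (A : Multiset R) :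
    IsPlethysticExp (fun n => if 2 ∣ n then 2 * psum n A else 0) (squareSeries A) := by
  refine (IsPlethysticExp.multiset_prod _ _ _
    fun y _ => isPlethysticExp_geomPow 2 two_pos (y ^ 2)).congr fun n _ => ?_
  split_ifs with h
  · obtain ⟨k, rfl⟩ := h
    simp [Multiset.sum_map_mul_left, psum, pow_mul]
  · simp

/-- The exponents of `∏_{i < j} 1 / (1 - x_i x_j) ∏ 1 / (1 - x_i p) ∏ (1 - x_i q)`, where `β` are
the power sums of the alphabet `x` and `α` the power sums of `p` minus those of `q`. -/
def gaussExponent (α β : ℕ → R) (n : ℕ) : R :=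
  α n * β n + if 2 ∣ n then β (n / 2) ^ 2 - β n else 0

/-- The graded form of `∏_{i < j} 1 / (1 - x_i x_j) ∏ 1 / (1 - x_i p) ∏ (1 - x_i q)` on the formal
difference `A' - B'` of alphabets. -/
def gaussSeries (A B A' B' : Multiset R) : PowerSeries R :=
  cauchySeries A A' * cauchySeries B B' * dualSeries 1 A B' * dualSeries 1 B A' *
    (pairSeries A' * pairSeries B' * squareSeries B' * dualSeries 2 A' B')

/-- The value at `t = 1` of `gaussSeries`. -/
def gaussValue (A B A' B' : Multiset R) : R :=
  cauchyProd A A' * cauchyProd B B' * dualProd A B' * dualProd B A' *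
    (pairProd A' * pairProd B' * squareProd B' * dualProd A' B')

lemma isPlethysticExp_gaussSeries (A B A' B' : Multiset R) :
    IsPlethysticExp (gaussExponent (fun n => psum n A - psum n B) fun n => psum n A' - psum n B')
      (gaussSeries A B A' B') := by
  refine ((((isPlethysticExp_cauchySeries A A').mul (isPlethysticExp_cauchySeries B B')).mul
    (isPlethysticExp_dualSeries 1 one_pos A B')).mul
    (isPlethysticExp_dualSeries 1 one_pos B A')).mul
    ((((isPlethysticExp_pairSeries A').mul (isPlethysticExp_pairSeries B')).mul
    (isPlethysticExp_squareSeries B')).mul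
    (isPlethysticExp_dualSeries 2 two_pos A' B')) |>.congr fun n _ => ?_
  simp only [gaussExponent, one_dvd, if_true, Nat.div_one, Nat.cast_one, Nat.cast_ofNat]
  split_ifs <;> ring

variable [TopologicalSpace R] [IsTopologicalRing R] [T2Space R] {P : Set (RingSeminorm R)}

lemma hasEval_cauchySeries (hP : IsSummabilityFamily P) (A B : Multiset R)
    (h : ∀ x ∈ A, ∀ y ∈ B, Small P (x * y)) :
    HasEval P (cauchySeries A B) (cauchyProd A B) :=
  HasEval.multiset_prod hP _ _ _ fun x hx => HasEval.multiset_prod hP _ _ _ fun y hy =>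
    hasEval_geomPow hP (h x hx y hy) 1 one_pos

lemma hasEval_dualSeries (hP : IsSummabilityFamily P) (r : ℕ) (hr : 0 < r) (A B : Multiset R) :
    HasEval P (dualSeries r A B) (dualProd A B) :=
  HasEval.multiset_prod hP _ _ _ fun x _ => HasEval.multiset_prod hP _ _ _ fun y _ =>
    hasEval_one_sub P (x * y) r hr

lemma hasEval_pairSeries (hP : IsSummabilityFamily P) (A : Multiset R)
    (h : ∀ x ∈ A, Small P x) : HasEval P (pairSeries A) (pairProd A) := by
  refine HasEval.multiset_prod hP _ _ _ fun s hs => hasEval_geomPow hP ?_ 2 two_pos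
  rw [Multiset.mem_powersetCard] at hs
  obtain ⟨x, y, rfl⟩ := Multiset.card_eq_two.mp hs.2
  rw [Multiset.insert_eq_cons, Multiset.prod_cons, Multiset.prod_singleton]
  exact (h x (Multiset.mem_of_le hs.1 (by simp))).mul (h y (Multiset.mem_of_le hs.1 (by simp)))

lemma hasEval_squareSeries (hP : IsSummabilityFamily P) (A : Multiset R)
    (h : ∀ x ∈ A, Small P x) : HasEval P (squareSeries A) (squareProd A) :=
  HasEval.multiset_prod hP _ _ _ fun x hx => hasEval_geomPow hP
    (by rw [sq]; exact (h x hx).mul (h x hx)) 2 two_pos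

/-- The graded series may be evaluated at `t = 1` factor by factor. -/
lemma hasEval_gaussSeries (hP : IsSummabilityFamily P) (A B A' B' : Multiset R)
    (hA : ∀ x ∈ A, ∀ y ∈ A', Small P (x * y)) (hB : ∀ x ∈ B, ∀ y ∈ B', Small P (x * y))
    (hA' : ∀ x ∈ A', Small P x) (hB' : ∀ x ∈ B', Small P x) :
    HasEval P (gaussSeries A B A' B') (gaussValue A B A' B') :=
  ((((hasEval_cauchySeries hP A A' hA).mul hP (hasEval_cauchySeries hP B B' hB)).mul hP
    (hasEval_dualSeries hP 1 one_pos A B')).mul hP (hasEval_dualSeries hP 1 one_pos B A')).mul hP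
    ((((hasEval_pairSeries hP A' hA').mul hP (hasEval_pairSeries hP B' hB')).mul hP
    (hasEval_squareSeries hP B' hB')).mul hP (hasEval_dualSeries hP 2 two_pos A' B'))

end PowerSums

/-! ### Universal power sum coefficients -/

section Universal

/-- The span of the monomials `∏_{i ∈ ν} X_i` over the partitions `ν` of `n`. -/
def weightSpace (n : ℕ) : Submodule ℂ (MvPolynomial ℕ ℂ) :=
  Submodule.span ℂ (Set.range fun ν : n.Partition => (ν.parts.map MvPolynomial.X).prod)

lemma prod_X_mem_weightSpace (s : Multiset ℕ) (hs : ∀ i ∈ s, 0 < i) (n : ℕ) (hn : s.sum = n) :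
    (s.map (MvPolynomial.X : ℕ → MvPolynomial ℕ ℂ)).prod ∈ weightSpace n :=
  Submodule.subset_span ⟨⟨s, fun h => hs _ h, hn⟩, rfl⟩

lemma weightSpace_mul {m n : ℕ} {a b : MvPolynomial ℕ ℂ} (ha : a ∈ weightSpace m)
    (hb : b ∈ weightSpace n) : a * b ∈ weightSpace (m + n) := by
  have h : weightSpace m * weightSpace n ≤ weightSpace (m + n) := by
    rw [weightSpace, weightSpace, Submodule.span_mul_span, Submodule.span_le]
    rintro _ ⟨_, ⟨ν, rfl⟩, _, ⟨κ, rfl⟩, rfl⟩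
    simp only
    rw [← Multiset.prod_add, ← Multiset.map_add]
    refine prod_X_mem_weightSpace _ (fun i hi => ?_) _ (by simp [ν.parts_sum, κ.parts_sum])
    rcases Multiset.mem_add.mp hi with hi | hi
    · exact ν.parts_pos hi
    · exact κ.parts_pos hi
  exact h (Submodule.mul_mem_mul ha hb)

lemma one_mem_weightSpace : (1 : MvPolynomial ℕ ℂ) ∈ weightSpace 0 := by
  simpa using prod_X_mem_weightSpace 0 (by simp) 0 (by simp)

lemma multiset_prod_mem_weightSpace (γ : ℕ → MvPolynomial ℕ ℂ) (s : Multiset ℕ)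
    (h : ∀ i ∈ s, γ i ∈ weightSpace i) : (s.map γ).prod ∈ weightSpace s.sum := by
  induction s using Multiset.induction_on with
  | empty => simpa using one_mem_weightSpace
  | cons i s ih =>
    rw [Multiset.map_cons, Multiset.prod_cons, Multiset.sum_cons]
    exact weightSpace_mul (h i (by simp)) (ih fun j hj => h j (Multiset.mem_cons_of_mem hj))

lemma cycleSum_mem_weightSpace (γ : ℕ → MvPolynomial ℕ ℂ)
    (h : ∀ i, 0 < i → γ i ∈ weightSpace i) (n : ℕ) : cycleSum γ n ∈ weightSpace n := by
  refine Submodule.sum_mem _ fun ν _ => Submodule.smul_mem _ _ ?_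
  have := multiset_prod_mem_weightSpace γ ν.parts fun i hi => h i (ν.parts_pos hi)
  rwa [ν.parts_sum] at this

/-- The `n`-th exponent is a weighted homogeneous polynomial of weight `n` in `β_1, β_2, …`. -/
lemma gaussExponent_mem_weightSpace (α : ℕ → ℂ) (n : ℕ) (hn : 0 < n) :
    gaussExponent (fun n => MvPolynomial.C (α n)) MvPolynomial.X n ∈ weightSpace n := by
  have hX : ∀ k, 0 < k → (MvPolynomial.X k : MvPolynomial ℕ ℂ) ∈ weightSpace k := fun k hk => by
    simpa using prod_X_mem_weightSpace {k} (by simpa using hk) k (by simp)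
  refine Submodule.add_mem _ ?_ ?_
  · rw [← MvPolynomial.smul_eq_C_mul]
    exact Submodule.smul_mem _ _ (hX n hn)
  · split_ifs with h
    · obtain ⟨k, rfl⟩ := h
      refine Submodule.sub_mem _ ?_ (hX _ hn)
      rw [Nat.mul_div_cancel_left _ two_pos, sq, two_mul]
      exact weightSpace_mul (hX k (by omega)) (hX k (by omega))
    · exact Submodule.zero_mem _

lemma map_cycleSum {R S : Type*} [CommRing R] [CommRing S] [Algebra ℂ R] [Algebra ℂ S]
    (f : R →ₐ[ℂ] S) (γ : ℕ → R) (n : ℕ) : f (cycleSum γ n) = cycleSum (fun i => f (γ i)) n := by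
  simp [cycleSum, map_sum, map_multiset_prod]

/-- The coefficients of a Gaussian series as polynomials in `β`, uniformly in the ring. -/
lemma exists_universal_gauss (α : ℕ → ℂ) : ∃ c : (k : ℕ) → k.Partition → ℂ,
    ∀ {A : Type} [CommRing A] [Algebra ℂ A] (β : ℕ → A) (F : PowerSeries A),
      IsPlethysticExp (gaussExponent (fun n => algebraMap ℂ A (α n)) β) F →
        ∀ k, PowerSeries.coeff k F = ∑ ν : k.Partition, c k ν • (ν.parts.map β).prod := by
  have h : ∀ k, ∃ c : k.Partition → ℂ, ∑ ν, c ν • (ν.parts.map MvPolynomial.X).prod =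
      cycleSum (gaussExponent (fun n => MvPolynomial.C (α n)) MvPolynomial.X) k := fun k =>
    Submodule.mem_span_range_iff_exists_fun ℂ |>.mp
      (cycleSum_mem_weightSpace _ (gaussExponent_mem_weightSpace α) k)
  choose c hc using h
  refine ⟨c, fun β F hF k => ?_⟩
  have h1 := congrArg (MvPolynomial.aeval β) (hc k)
  rw [map_cycleSum] at h1
  rw [hF.coeff_eq_cycleSum]
  have h2 : (fun i => MvPolynomial.aeval β (gaussExponent (fun n => MvPolynomial.C (α n))
      MvPolynomial.X i)) = gaussExponent (fun n => algebraMap ℂ _ (α n)) β := by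
    funext i
    simp only [gaussExponent]
    split_ifs <;> simp
  rw [h2] at h1
  rw [← h1]
  simp [map_sum, map_multiset_prod]

end Universal

/-! ### The degree grading of formal power series -/

section Grading

variable {σ A : Type*} [CommRing A]

/-- The homogeneous part of degree `k` of a formal power series. -/
def homPart (k : ℕ) (f : MvPowerSeries σ A) : MvPowerSeries σ A :=
  fun e => if e.degree = k then MvPowerSeries.coeff e f else 0

lemma coeff_homPart (k : ℕ) (f : MvPowerSeries σ A) (e : σ →₀ ℕ) :
    MvPowerSeries.coeff e (homPart k f) = if e.degree = k then MvPowerSeries.coeff e f else 0 :=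
  rfl

/-- The ring homomorphism `f(ξ) ↦ f(t ξ)`, which sorts a series by degree. -/
def gradeHom (σ A : Type*) [CommRing A] :
    MvPowerSeries σ A →+* PowerSeries (MvPowerSeries σ A) where
  toFun f := PowerSeries.mk fun k => homPart k f
  map_zero' := by
    ext k e
    rw [PowerSeries.coeff_mk, coeff_homPart]
    simp
  map_one' := by
    classical
    ext k e
    rw [PowerSeries.coeff_mk, PowerSeries.coeff_one, coeff_homPart, MvPowerSeries.coeff_one]
    by_cases he : e = 0
    · subst he
      by_cases hk : k = 0
      · simp [hk]
      · simp [hk, Ne.symm hk]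
    · rw [if_neg he]
      split_ifs <;> simp [MvPowerSeries.coeff_one, he]
  map_add' f g := by
    ext k e
    rw [map_add, PowerSeries.coeff_mk, PowerSeries.coeff_mk, PowerSeries.coeff_mk, map_add,
      coeff_homPart, coeff_homPart, coeff_homPart, map_add]
    split_ifs <;> simp
  map_mul' f g := by
    classical
    ext k e
    rw [PowerSeries.coeff_mul, map_sum, PowerSeries.coeff_mk, coeff_homPart]
    simp_rw [PowerSeries.coeff_mk, MvPowerSeries.coeff_mul, coeff_homPart]
    rw [Finset.sum_comm]
    by_cases h : e.degree = k
    · rw [if_pos h]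
      refine Finset.sum_congr rfl fun y hy => ?_
      rw [Finset.HasAntidiagonal.mem_antidiagonal] at hy
      rw [Finset.sum_eq_single (y.1.degree, y.2.degree)]
      · simp
      · intro x _ hx
        by_cases h1 : y.1.degree = x.1
        · rw [if_neg (fun h2 : y.2.degree = x.2 => hx (Prod.ext h1.symm h2.symm)), mul_zero]
        · rw [if_neg h1, zero_mul]
      · intro hn
        rw [Finset.HasAntidiagonal.mem_antidiagonal, ← map_add, hy] at hn
        exact absurd h hn
    · rw [if_neg h]
      refine (Finset.sum_eq_zero fun y hy => Finset.sum_eq_zero fun x hx => ?_).symm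
      rw [Finset.HasAntidiagonal.mem_antidiagonal] at hx hy
      by_cases h1 : y.1.degree = x.1
      · rw [if_neg (fun h2 : y.2.degree = x.2 => h (by rw [← hy, map_add, h1, h2, hx])), mul_zero]
      · rw [if_neg h1, zero_mul]

lemma coeff_gradeHom (k : ℕ) (f : MvPowerSeries σ A) :
    PowerSeries.coeff k (gradeHom σ A f) = homPart k f := by
  simp only [gradeHom, RingHom.coe_mk, MonoidHom.coe_mk, OneHom.coe_mk, PowerSeries.coeff_mk]

lemma coeff_eq_coeff_gradeHom (f : MvPowerSeries σ A) (e : σ →₀ ℕ) :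
    MvPowerSeries.coeff e f =
      MvPowerSeries.coeff e (PowerSeries.coeff e.degree (gradeHom σ A f)) := by
  rw [coeff_gradeHom, coeff_homPart, if_pos rfl]

lemma coeff_coeff_gradeHom (f : MvPowerSeries σ A) (e : σ →₀ ℕ) (k : ℕ) (h : e.degree ≠ k) :
      MvPowerSeries.coeff e (PowerSeries.coeff k (gradeHom σ A f)) = 0 := by
  rw [coeff_gradeHom, coeff_homPart, if_neg h]

lemma gradeHom_C (a : A) :
    gradeHom σ A (MvPowerSeries.C a) = PowerSeries.C (MvPowerSeries.C a) := by
  classical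
  ext k e
  by_cases h : e.degree = k
  · subst h
    rw [← coeff_eq_coeff_gradeHom, PowerSeries.coeff_C, MvPowerSeries.coeff_C]
    by_cases he : e = 0
    · subst he; simp
    · rw [if_neg he]
      split_ifs <;> simp [MvPowerSeries.coeff_C, he]
  · rw [coeff_coeff_gradeHom _ _ _ h, PowerSeries.coeff_C]
    split_ifs with hk
    · rw [MvPowerSeries.coeff_C, if_neg]
      rintro rfl
      simp [hk] at h
    · simp

lemma gradeHom_X (i : σ) :
    gradeHom σ A (MvPowerSeries.X i) = PowerSeries.C (MvPowerSeries.X i) * PowerSeries.X := by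
  classical
  ext k e
  rw [PowerSeries.coeff_C_mul, PowerSeries.coeff_X]
  by_cases h : e.degree = k
  · subst h
    rw [← coeff_eq_coeff_gradeHom, MvPowerSeries.coeff_X]
    by_cases he : e = Finsupp.single i 1
    · subst he; simp
    · rw [if_neg he]
      split_ifs <;> simp [MvPowerSeries.coeff_X, he]
  · rw [coeff_coeff_gradeHom _ _ _ h]
    split_ifs with hk
    · rw [mul_one, MvPowerSeries.coeff_X, if_neg]
      rintro rfl
      simp [hk] at h
    · simp

/-- The formal variables, as an alphabet. -/
def vars (σ A : Type*) [Fintype σ] [CommRing A] : Multiset (MvPowerSeries σ A) :=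
  Finset.univ.val.map MvPowerSeries.X

lemma gradeHom_inverse {f : MvPowerSeries σ A} {F : PowerSeries (MvPowerSeries σ A)}
    (hf : MvPowerSeries.constantCoeff f = 1) (h : gradeHom σ A f * F = 1) :
    gradeHom σ A (Ring.inverse f) = F := by
  have hu : IsUnit f := MvPowerSeries.isUnit_iff_constantCoeff.mpr (by rw [hf]; exact isUnit_one)
  have h1 : gradeHom σ A (Ring.inverse f) * gradeHom σ A f = 1 := by
    rw [← map_mul, Ring.inverse_mul_cancel _ hu, map_one]
  exact left_inv_eq_right_inv h1 h

variable [Fintype σ]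

lemma gradeHom_cauchyProd (B : Multiset A) :
    gradeHom σ A (cauchyProd (vars σ A) (B.map MvPowerSeries.C)) =
      cauchySeries (vars σ A) (B.map MvPowerSeries.C) := by
  simp only [cauchyProd, cauchySeries, vars, map_multiset_prod, Multiset.map_map,
    Function.comp_def]
  refine congrArg Multiset.prod (Multiset.map_congr rfl fun i _ =>
    congrArg Multiset.prod (Multiset.map_congr rfl fun b _ => ?_))
  refine gradeHom_inverse (by simp) ?_
  have h := one_sub_mul_geomPow 1 one_pos
    (MvPowerSeries.X i * MvPowerSeries.C b : MvPowerSeries σ A)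
  rw [map_mul, pow_one] at h
  rw [map_sub, map_one, map_mul, gradeHom_C, gradeHom_X]
  linear_combination h

lemma gradeHom_dualProd (B : Multiset A) :
    gradeHom σ A (dualProd (vars σ A) (B.map MvPowerSeries.C)) =
      dualSeries 1 (vars σ A) (B.map MvPowerSeries.C) := by
  simp only [dualProd, dualSeries, vars, map_multiset_prod, Multiset.map_map,
    Function.comp_def]
  refine congrArg Multiset.prod (Multiset.map_congr rfl fun i _ =>
    congrArg Multiset.prod (Multiset.map_congr rfl fun b _ => ?_))
  rw [map_sub, map_one, map_mul, gradeHom_C, gradeHom_X]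
  simp only [map_mul, pow_one]
  ring

lemma gradeHom_pairProd :
    gradeHom σ A (pairProd (vars σ A)) = pairSeries (vars σ A) := by
  simp only [pairProd, pairSeries, vars, map_multiset_prod, Multiset.map_map,
    Multiset.powersetCard_map, Function.comp_def]
  refine congrArg Multiset.prod (Multiset.map_congr rfl fun s hs => ?_)
  obtain ⟨i, j, rfl⟩ := Multiset.card_eq_two.mp (Multiset.mem_powersetCard.mp hs).2
  simp only [Multiset.insert_eq_cons, Multiset.map_cons, Multiset.map_singleton,
    Multiset.prod_cons, Multiset.prod_singleton]
  refine gradeHom_inverse (by simp) ?_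
  have h := one_sub_mul_geomPow 2 two_pos
    (MvPowerSeries.X i * MvPowerSeries.X j : MvPowerSeries σ A)
  rw [map_mul] at h
  rw [map_sub, map_one, map_mul, gradeHom_X, gradeHom_X]
  linear_combination h

end Grading

/-! ### Power sum expansions of Gaussian series and Cauchy kernels -/

section Expansions

open MvPolynomial in
lemma isHomogeneous_psumPart (σ A : Type*) [Fintype σ] [CommSemiring A] {k : ℕ}
    (ν : k.Partition) : (psumPart σ A ν).IsHomogeneous k := by
  have h : ∀ s : Multiset ℕ, ((s.map (MvPolynomial.psum σ A)).prod).IsHomogeneous s.sum := by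
    intro s
    induction s using Multiset.induction_on with
    | empty => simpa using isHomogeneous_one σ A
    | cons j s ih =>
      rw [Multiset.map_cons, Multiset.prod_cons, Multiset.sum_cons]
      refine IsHomogeneous.mul (IsHomogeneous.sum _ _ _ fun i _ => ?_) ih
      simpa using (isHomogeneous_X A i).pow j
  have := h ν.parts
  rwa [ν.parts_sum] at this

lemma coeff_psumPart {σ A : Type*} [Fintype σ] [CommRing A] {k : ℕ} (ν : k.Partition)
    (e : σ →₀ ℕ) : MvPolynomial.coeff e (MvPolynomial.psumPart σ A ν) =
      MvPowerSeries.coeff e (ν.parts.map fun n => psum n (vars σ A)).prod := by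
  rw [← MvPolynomial.coeff_coe, ← MvPolynomial.coeToMvPowerSeries.ringHom_apply,
    MvPolynomial.psumPart, map_multiset_prod, Multiset.map_map]
  congr 3
  funext n
  simp [MvPolynomial.psum, psum, vars]

variable {A : Type*} [CommRing A] {u : ℕ}

/-- A power sum expansion may be checked degree by degree. -/
lemma isPowerSumExpansion_of_grade {f : MvPowerSeries (Fin u) A}
    {c : (k : ℕ) → k.Partition → A}
    (h : ∀ k, PowerSeries.coeff k (gradeHom (Fin u) A f) =
      ∑ ν : k.Partition, MvPowerSeries.C (c k ν) *
        (ν.parts.map fun n => psum n (vars (Fin u) A)).prod) :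
    IsPowerSumExpansion f c := by
  intro e he
  rw [coeff_eq_coeff_gradeHom, h, map_sum, Finset.sum_eq_single e.degree]
  · refine Finset.sum_congr rfl fun ν _ => ?_
    rw [MvPowerSeries.coeff_C_mul, coeff_psumPart]
  · intro k _ hk
    refine Finset.sum_eq_zero fun ν _ => ?_
    rw [(isHomogeneous_psumPart (Fin u) A ν).coeff_eq_zero hk.symm, mul_zero]
  · intro hk
    simp only [Finset.mem_range] at hk
    omega

variable [Algebra ℂ A]

/-- The expansion of `K ∏ 1 / (1 - ξ p) ∏ (1 - ξ q)` in power sums. -/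
lemma isPowerSumExpansion_kernel (K : A) (B B' : Multiset A) :
    IsPowerSumExpansion (u := u) (MvPowerSeries.C K *
      cauchyProd (vars (Fin u) A) (B.map MvPowerSeries.C) *
      dualProd (vars (Fin u) A) (B'.map MvPowerSeries.C))
      (fun _ ν => (zFactor ν : ℂ)⁻¹ • (K * (ν.parts.map fun n => psum n B - psum n B').prod)) := by
  refine isPowerSumExpansion_of_grade fun k => ?_
  rw [map_mul (gradeHom _ _), map_mul (gradeHom _ _), gradeHom_C, gradeHom_cauchyProd,
    gradeHom_dualProd, mul_assoc,
    PowerSeries.coeff_C_mul]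
  have h := ((isPlethysticExp_cauchySeries (vars (Fin u) A) (B.map MvPowerSeries.C)).mul
    (isPlethysticExp_dualSeries 1 one_pos (vars (Fin u) A) (B'.map MvPowerSeries.C))).congr
    (δ := fun n => MvPowerSeries.C (psum n B - psum n B') * psum n (vars (Fin u) A))
    (fun n _ => by
      simp only [psum_map, one_dvd, if_true, Nat.div_one, map_sub]
      push_cast
      ring)
  rw [h.coeff_eq_cycleSum, cycleSum, Finset.mul_sum]
  refine Finset.sum_congr rfl fun ν _ => ?_
  have hC : ∀ (c : ℂ) (a : A),
      (MvPowerSeries.C (c • a) : MvPowerSeries (Fin u) A) = c • MvPowerSeries.C a := by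
    intro c a
    rw [Algebra.smul_def, map_mul, Algebra.smul_def, MvPowerSeries.algebraMap_apply]
  have hp : (MvPowerSeries.C (ν.parts.map fun n => psum n B - psum n B').prod :
      MvPowerSeries (Fin u) A) =
      (ν.parts.map fun n => MvPowerSeries.C (psum n B - psum n B')).prod := by
    rw [map_multiset_prod, Multiset.map_map]
    rfl
  rw [Multiset.prod_map_mul, hC, map_mul, hp, mul_smul_comm, smul_mul_assoc, mul_assoc]

/-- A Gaussian series `c ∏_{i < j} 1 / (1 - ξ_i ξ_j) ∏ 1 / (1 - ξ p) ∏ (1 - ξ q)`. -/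
def gauss (c : ℂ) (B B' : Multiset ℂ) (v : ℕ) : MvPowerSeries (Fin v) ℂ :=
  MvPowerSeries.C c * pairProd (vars (Fin v) ℂ) *
    cauchyProd (vars (Fin v) ℂ) (B.map MvPowerSeries.C) *
    dualProd (vars (Fin v) ℂ) (B'.map MvPowerSeries.C)

/-- The Gaussian series for all numbers of variables have a common expansion, and the pairing of
this expansion with an arbitrary formal difference of alphabets is the series `gaussSeries`. -/
lemma exists_gauss_expansion (B B' : Multiset ℂ) : ∃ c : (k : ℕ) → k.Partition → ℂ,
    (∀ (C : ℂ) (v : ℕ), IsPowerSumExpansion (gauss C B B' v) fun k ν => C * c k ν) ∧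
    ∀ {A : Type} [CommRing A] [Algebra ℂ A] (D D' : Multiset A) (k : ℕ),
      PowerSeries.coeff k (gaussSeries (B.map (algebraMap ℂ A)) (B'.map (algebraMap ℂ A)) D D') =
        ∑ ν : k.Partition, c k ν • (ν.parts.map fun n => psum n D - psum n D').prod := by
  obtain ⟨c, hc⟩ := exists_universal_gauss fun n => psum n B - psum n B'
  refine ⟨c, fun C v => isPowerSumExpansion_of_grade fun k => ?_, fun D D' k => ?_⟩
  · rw [gauss, map_mul (gradeHom _ _), map_mul (gradeHom _ _), map_mul (gradeHom _ _), gradeHom_C,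
      gradeHom_cauchyProd, gradeHom_dualProd, gradeHom_pairProd, mul_assoc,
      mul_assoc, PowerSeries.coeff_C_mul]
    have h := ((isPlethysticExp_pairSeries (vars (Fin v) ℂ)).mul
      ((isPlethysticExp_cauchySeries (vars (Fin v) ℂ) (B.map MvPowerSeries.C)).mul
      (isPlethysticExp_dualSeries 1 one_pos (vars (Fin v) ℂ) (B'.map MvPowerSeries.C)))).congr
      (δ := gaussExponent (fun n => algebraMap ℂ (MvPowerSeries (Fin v) ℂ)
        (psum n B - psum n B')) fun n => psum n (vars (Fin v) ℂ))
      (fun n _ => by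
        simp only [gaussExponent, psum_map, one_dvd, if_true, Nat.div_one,
          MvPowerSeries.algebraMap_apply, Algebra.algebraMap_self, RingHom.id_apply, map_sub]
        push_cast
        ring)
    rw [hc _ _ h, Finset.mul_sum]
    refine Finset.sum_congr rfl fun ν _ => ?_
    rw [MvPowerSeries.smul_eq_C_mul, ← mul_assoc, ← map_mul]
  · refine hc _ _ ((isPlethysticExp_gaussSeries _ _ D D').congr fun n _ => ?_) k
    simp only [gaussExponent, psum_map, map_sub]

end Expansions

/-! ### Uniqueness of power sum expansions -/

section Uniqueness

/-- The multiset of nonzero exponents of a monomial. -/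
def exponents {σ : Type*} (e : σ →₀ ℕ) : Multiset ℕ := e.support.val.map e

lemma sum_exponents {σ : Type*} (e : σ →₀ ℕ) : (exponents e).sum = e.degree := rfl

lemma exponents_add_single {σ : Type*} {e : σ →₀ ℕ} {i : σ} (hi : i ∉ e.support) {j : ℕ}
    (hj : 0 < j) : exponents (e + Finsupp.single i j) = j ::ₘ exponents e := by
  classical
  have hi' : e i = 0 := by simpa using hi
  have h : (e + Finsupp.single i j).support = e.support.cons i hi := by
    ext k
    by_cases hk : k = i
    · subst hk
      simp [hj.ne']
    · simp [hk]
  rw [exponents, h, Finset.cons_val, Multiset.map_cons]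
  congr 1
  · simp [hi']
  · refine Multiset.map_congr rfl fun k hk => ?_
    have : k ≠ i := by
      rintro rfl
      exact hi hk
    simp [this.symm]

variable {σ : Type*} [Fintype σ]

open MvPolynomial in
lemma coeff_psum_mul [DecidableEq σ] (j : ℕ) (G : MvPolynomial σ ℕ) (e : σ →₀ ℕ) :
    coeff e (MvPolynomial.psum σ ℕ j * G) =
      ∑ i, if Finsupp.single i j ≤ e then coeff (e - Finsupp.single i j) G else 0 := by
  rw [MvPolynomial.psum, Finset.sum_mul, coeff_sum]
  refine Finset.sum_congr rfl fun i _ => ?_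
  rw [X_pow_eq_monomial, coeff_monomial_mul']
  simp

/-- A monomial occurring in a product of power sums has at most as many variables as the product
has factors, with equality only if the factors are its exponents. -/
lemma exponents_of_coeff_ne_zero (s : Multiset ℕ) (hs : ∀ i ∈ s, 0 < i) (e : σ →₀ ℕ)
    (h : MvPolynomial.coeff e (s.map (MvPolynomial.psum σ ℕ)).prod ≠ 0) :
    (exponents e).card ≤ s.card ∧ ((exponents e).card = s.card → exponents e = s) := by
  classical
  induction s using Multiset.induction_on generalizing e with
  | empty =>
    rw [Multiset.map_zero, Multiset.prod_zero, MvPolynomial.coeff_one] at h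
    have : e = 0 := by
      by_contra h'
      exact h (if_neg (Ne.symm h'))
    subst this
    simp [exponents]
  | cons j s ih =>
    rw [Multiset.map_cons, Multiset.prod_cons, coeff_psum_mul] at h
    obtain ⟨i, -, hi⟩ := Finset.exists_ne_zero_of_sum_ne_zero h
    have hle : Finsupp.single i j ≤ e := by
      by_contra h'
      exact hi (if_neg h')
    rw [if_pos hle] at hi
    obtain ⟨e', rfl⟩ : ∃ e', e = e' + Finsupp.single i j := ⟨_, (tsub_add_cancel_of_le hle).symm⟩
    rw [add_tsub_cancel_right] at hi
    have h1 := ih (fun k hk => hs k (Multiset.mem_cons_of_mem hk)) e' hi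
    by_cases hi' : i ∈ e'.support
    · have h2 : (e' + Finsupp.single i j).support ⊆ e'.support := by
        intro k hk
        by_cases hki : k = i
        · rwa [hki]
        · simpa [Finsupp.single_apply, Ne.symm hki] using hk
      have h3 : (exponents (e' + Finsupp.single i j)).card ≤ (exponents e').card := by
        simpa [exponents] using Finset.card_le_card h2
      rw [Multiset.card_cons]
      exact ⟨by omega, fun h4 => by omega⟩
    · rw [exponents_add_single hi' (hs j (by simp)), Multiset.card_cons, Multiset.card_cons]
      exact ⟨by omega, fun h4 => by rw [h1.2 (by omega)]⟩

/-- With enough variables, `p_s` contains a monomial whose exponents are the elements of `s`. -/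
lemma exists_coeff_ne_zero (s : Multiset ℕ) (hs : ∀ i ∈ s, 0 < i)
    (hc : s.card ≤ Fintype.card σ) : ∃ e : σ →₀ ℕ, exponents e = s ∧
      MvPolynomial.coeff e (s.map (MvPolynomial.psum σ ℕ)).prod ≠ 0 := by
  classical
  induction s using Multiset.induction_on with
  | empty => exact ⟨0, by simp [exponents], by simp⟩
  | cons j s ih =>
    rw [Multiset.card_cons] at hc
    obtain ⟨e, he, h⟩ := ih (fun k hk => hs k (Multiset.mem_cons_of_mem hk)) (by omega)
    obtain ⟨i, hi⟩ : ∃ i, i ∉ e.support := by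
      by_contra! h'
      have h1 : e.support = Finset.univ := Finset.eq_univ_iff_forall.mpr h'
      have h2 : (exponents e).card = e.support.card := by simp [exponents]
      rw [he, h1, Finset.card_univ] at h2
      omega
    refine ⟨e + Finsupp.single i j, by rw [exponents_add_single hi (hs j (by simp)), he], ?_⟩
    rw [Multiset.map_cons, Multiset.prod_cons, coeff_psum_mul]
    intro h0
    have h1 := (Finset.sum_eq_zero_iff.mp h0) i (Finset.mem_univ i)
    rw [if_pos le_add_self, add_tsub_cancel_right] at h1
    exact h h1

lemma coeff_psumPart_natCast {A : Type*} [CommRing A] {k : ℕ} (ν : k.Partition) (e : σ →₀ ℕ) :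
    MvPolynomial.coeff e (MvPolynomial.psumPart σ A ν) =
      (MvPolynomial.coeff e (ν.parts.map (MvPolynomial.psum σ ℕ)).prod : ℕ) := by
  have h : MvPolynomial.psumPart σ A ν = MvPolynomial.map (Nat.castRingHom A)
      (ν.parts.map (MvPolynomial.psum σ ℕ)).prod := by
    rw [MvPolynomial.psumPart, map_multiset_prod, Multiset.map_map]
    congr 2
    funext n
    simp [MvPolynomial.psum]
  rw [h, MvPolynomial.coeff_map]
  rfl

lemma card_parts_le {k : ℕ} (ν : k.Partition) : ν.parts.card ≤ k := by
  have h := Multiset.card_nsmul_le_sum (s := ν.parts) (a := 1) fun i hi => ν.parts_pos hi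
  rwa [ν.parts_sum, smul_eq_mul, mul_one] at h

variable {A : Type*} [CommRing A] {u : ℕ}

lemma IsPowerSumExpansion.map {B : Type*} [CommRing B] (φ : A →+* B)
    {f : MvPowerSeries (Fin u) A} {c : (k : ℕ) → k.Partition → A} (h : IsPowerSumExpansion f c) :
    IsPowerSumExpansion (MvPowerSeries.map φ f) fun k ν => φ (c k ν) := by
  intro e he
  rw [MvPowerSeries.coeff_map, h e he]
  simp only [map_sum, map_mul, coeff_psumPart_natCast, map_natCast]

lemma IsPowerSumExpansion.congr {f g : MvPowerSeries (Fin u) A} {c : (k : ℕ) → k.Partition → A}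
    (h : IsPowerSumExpansion f c)
    (hfg : ∀ e : Fin u →₀ ℕ, e.degree ≤ u → MvPowerSeries.coeff e f = MvPowerSeries.coeff e g) :
    IsPowerSumExpansion g c := fun e he => (hfg e he).symm.trans (h e he)

variable [Algebra ℂ A]

/-- The power sum products `p_ν`, `|ν| ≤ u`, in `u` variables are linearly independent: if `μ` has
the maximal number of parts among the `ν` with nonzero coefficient, then a monomial whose exponents
are the parts of `μ` occurs in `p_μ` only. -/
lemma IsPowerSumExpansion.unique {f : MvPowerSeries (Fin u) A} {c c' : (k : ℕ) → k.Partition → A}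
    (h : IsPowerSumExpansion f c) (h' : IsPowerSumExpansion f c') {k : ℕ} (hk : k ≤ u)
    (ν : k.Partition) : c k ν = c' k ν := by
  classical
  by_contra hne
  have hz : ∀ e : Fin u →₀ ℕ, e.degree = k → ∑ κ : k.Partition, (c k κ - c' k κ) *
      MvPolynomial.coeff e (MvPolynomial.psumPart (Fin u) A κ) = 0 := by
    intro e he
    have h1 := (h e (he.trans_le hk)).symm.trans (h' e (he.trans_le hk))
    have h2 : ∀ d : (k : ℕ) → k.Partition → A, ∑ j ∈ Finset.range (u + 1), ∑ κ : j.Partition,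
        d j κ * MvPolynomial.coeff e (MvPolynomial.psumPart (Fin u) A κ) =
        ∑ κ : k.Partition, d k κ * MvPolynomial.coeff e (MvPolynomial.psumPart (Fin u) A κ) := by
      intro d
      refine Finset.sum_eq_single k (fun j _ hj => Finset.sum_eq_zero fun κ _ => ?_) fun hk' => ?_
      · rw [(isHomogeneous_psumPart (Fin u) A κ).coeff_eq_zero (by omega), mul_zero]
      · simp only [Finset.mem_range] at hk'
        omega
    rw [h2, h2] at h1
    simp only [sub_mul, Finset.sum_sub_distrib, h1, sub_self]
  obtain ⟨μ, hμ, hmax⟩ := Finset.exists_max_image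
    (Finset.univ.filter fun κ : k.Partition => c k κ - c' k κ ≠ 0) (fun κ => κ.parts.card)
    ⟨ν, by simpa [sub_eq_zero] using hne⟩
  simp only [Finset.mem_filter, Finset.mem_univ, true_and] at hμ hmax
  obtain ⟨e, he, hco⟩ := exists_coeff_ne_zero (σ := Fin u) μ.parts (fun i hi => μ.parts_pos hi)
    (by simpa using (card_parts_le μ).trans hk)
  have h3 := hz e (by rw [← sum_exponents, he, μ.parts_sum])
  rw [Finset.sum_eq_single μ] at h3
  · rw [coeff_psumPart_natCast, mul_comm] at h3
    exact hμ (natCast_mul_injective hco (h3.trans (mul_zero _).symm))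
  · intro κ _ hκ
    by_contra h4
    have h5 : c k κ - c' k κ ≠ 0 := left_ne_zero_of_mul h4
    have h6 := right_ne_zero_of_mul h4
    rw [coeff_psumPart_natCast] at h6
    have h7 := exponents_of_coeff_ne_zero κ.parts (fun i hi => κ.parts_pos hi) e
      fun h => h6 (by rw [h, Nat.cast_zero])
    rw [he] at h7
    exact hκ (Nat.Partition.ext (h7.2 (le_antisymm h7.1 (hmax κ h5))).symm)
  · simp

lemma IsPowerSumExpansion.powerSumCoeff_eq {f : MvPowerSeries (Fin u) A}
    {c : (k : ℕ) → k.Partition → A} (h : IsPowerSumExpansion f c) {k : ℕ} (hk : k ≤ u)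
    (ν : k.Partition) : powerSumCoeff f k ν = c k ν := by
  have hex : ∃ c, IsPowerSumExpansion f c := ⟨c, h⟩
  rw [powerSumCoeff, dif_pos hex]
  exact hex.choose_spec.unique h hk ν

lemma finiteInner_eq {f g : MvPowerSeries (Fin u) A} {c c' : (k : ℕ) → k.Partition → A}
    (hf : IsPowerSumExpansion f c) (hg : IsPowerSumExpansion g c') :
    finiteInner f g =
      ∑ k ∈ Finset.range (u + 1), ∑ ν : k.Partition, (zFactor ν : A) * (c k ν * c' k ν) := by
  refine Finset.sum_congr rfl fun k hk => Finset.sum_congr rfl fun ν _ => ?_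
  have hk' : k ≤ u := by
    simp only [Finset.mem_range] at hk
    omega
  rw [hf.powerSumCoeff_eq hk', hg.powerSumCoeff_eq hk']

/-- The pairing with a Cauchy kernel substitutes the alphabet `B - B'` into the power sums. -/
lemma finiteInner_kernel {f : MvPowerSeries (Fin u) ℂ} {c : (k : ℕ) → k.Partition → ℂ}
    (hf : IsPowerSumExpansion f c) (φ : ℂ →+* A) (hφ : φ = algebraMap ℂ A) (K : A)
    (B B' : Multiset A) :
    finiteInner (MvPowerSeries.map φ f) (MvPowerSeries.C K *
      cauchyProd (vars (Fin u) A) (B.map MvPowerSeries.C) *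
      dualProd (vars (Fin u) A) (B'.map MvPowerSeries.C)) =
    K * ∑ k ∈ Finset.range (u + 1), ∑ ν : k.Partition,
      c k ν • (ν.parts.map fun n => psum n B - psum n B').prod := by
  subst hφ
  rw [finiteInner_eq (hf.map _) (isPowerSumExpansion_kernel K B B'), Finset.mul_sum]
  refine Finset.sum_congr rfl fun k _ => ?_
  rw [Finset.mul_sum]
  refine Finset.sum_congr rfl fun ν _ => ?_
  have hz : ((zFactor ν : ℕ) : A) = algebraMap ℂ A (zFactor ν : ℂ) := by simp
  rw [hz, ← Algebra.smul_def, ← Algebra.smul_def, mul_smul_comm,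
    smul_comm (c k ν), smul_smul, mul_inv_cancel₀ (zFactor_ne_zero ν), one_smul]

end Uniqueness

/-! ### Series with a power sum expansion -/

section Expandable

variable {u : ℕ}

/-- The series which up to degree `u` are polynomials in the power sums. -/
def IsExpandable (f : MvPowerSeries (Fin u) ℂ) : Prop := ∃ c, IsPowerSumExpansion f c

/-- The algebra generated by the power sums. -/
def powerSumAlgebra (u : ℕ) : Subalgebra ℂ (MvPowerSeries (Fin u) ℂ) :=
  Algebra.adjoin ℂ ((fun n => psum n (vars (Fin u) ℂ)) '' {n | 0 < n})

lemma isPowerSumExpansion_prod (s : Multiset ℕ) (hs : ∀ i ∈ s, 0 < i) :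
    IsExpandable (s.map fun n => psum n (vars (Fin u) ℂ)).prod := by
  classical
  let μ : s.sum.Partition := ⟨s, fun h => hs _ h, rfl⟩
  refine ⟨fun k ν => if k = s.sum ∧ ν.parts = s then 1 else 0, fun e he => ?_⟩
  have h1 : MvPowerSeries.coeff e (s.map fun n => psum n (vars (Fin u) ℂ)).prod =
      MvPolynomial.coeff e (MvPolynomial.psumPart (Fin u) ℂ μ) := (coeff_psumPart μ e).symm
  by_cases hsu : s.sum ≤ u
  · rw [h1, Finset.sum_eq_single s.sum, Finset.sum_eq_single μ]
    · simp [μ]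
    · intro ν _ hν
      have hne : ν.parts ≠ s := fun h => hν (Nat.Partition.ext h)
      simp [hne]
    · simp
    · intro k _ hk
      simp [hk]
    · intro h
      simp only [Finset.mem_range] at h
      omega
  · rw [h1, (isHomogeneous_psumPart (Fin u) ℂ μ).coeff_eq_zero (by omega)]
    refine (Finset.sum_eq_zero fun k hk => Finset.sum_eq_zero fun ν _ => ?_).symm
    simp only [Finset.mem_range] at hk
    have hne : k ≠ s.sum := by omega
    simp [hne]

lemma isExpandable_zero : IsExpandable (0 : MvPowerSeries (Fin u) ℂ) :=
  ⟨0, fun e _ => by simp⟩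

lemma IsExpandable.add {f g : MvPowerSeries (Fin u) ℂ} (hf : IsExpandable f)
    (hg : IsExpandable g) : IsExpandable (f + g) := by
  obtain ⟨c, hc⟩ := hf
  obtain ⟨d, hd⟩ := hg
  refine ⟨fun k ν => c k ν + d k ν, fun e he => ?_⟩
  simp only [map_add, hc e he, hd e he, add_mul, Finset.sum_add_distrib]

lemma IsExpandable.smul {f : MvPowerSeries (Fin u) ℂ} (hf : IsExpandable f) (a : ℂ) :
    IsExpandable (a • f) := by
  obtain ⟨c, hc⟩ := hf
  refine ⟨fun k ν => a * c k ν, fun e he => ?_⟩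
  rw [MvPowerSeries.coeff_smul, hc e he]
  simp only [Finset.mul_sum, mul_assoc]

lemma isExpandable_of_mem {f : MvPowerSeries (Fin u) ℂ} (hf : f ∈ powerSumAlgebra u) :
    IsExpandable f := by
  rw [powerSumAlgebra, ← Subalgebra.mem_toSubmodule, Algebra.adjoin_eq_span] at hf
  induction hf using Submodule.span_induction with
  | mem x hx =>
    obtain ⟨l, hl, rfl⟩ := Submonoid.exists_multiset_of_mem_closure hx
    have : ∃ s : Multiset ℕ, (∀ i ∈ s, 0 < i) ∧ l = s.map fun n => psum n (vars (Fin u) ℂ) := by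
      clear hx
      induction l using Multiset.induction_on with
      | empty => exact ⟨0, by simp, rfl⟩
      | cons a l ih =>
        obtain ⟨s, hs, rfl⟩ := ih fun y hy => hl y (Multiset.mem_cons_of_mem hy)
        obtain ⟨n, hn, rfl⟩ := hl a (by simp)
        refine ⟨n ::ₘ s, ?_, by simp⟩
        intro i hi
        rcases Multiset.mem_cons.mp hi with rfl | hi
        · exact hn
        · exact hs i hi
    obtain ⟨s, hs, rfl⟩ := this
    exact isPowerSumExpansion_prod s hs
  | zero => exact isExpandable_zero
  | add f g _ _ hf hg => exact hf.add hg
  | smul a f _ hf => exact hf.smul a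

lemma isExpandable_iff {f : MvPowerSeries (Fin u) ℂ} : IsExpandable f ↔
    ∃ F ∈ powerSumAlgebra u, ∀ e : Fin u →₀ ℕ, e.degree ≤ u →
      MvPowerSeries.coeff e F = MvPowerSeries.coeff e f := by
  constructor
  · rintro ⟨c, hc⟩
    refine ⟨∑ k ∈ Finset.range (u + 1), ∑ ν : k.Partition, c k ν •
      (ν.parts.map fun n => psum n (vars (Fin u) ℂ)).prod, ?_, fun e he => ?_⟩
    · refine Subalgebra.sum_mem _ fun k _ => Subalgebra.sum_mem _ fun ν _ =>
        Subalgebra.smul_mem _ (Subalgebra.multiset_prod_mem _ fun x hx => ?_) _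
      obtain ⟨n, hn, rfl⟩ := Multiset.mem_map.mp hx
      exact Algebra.subset_adjoin ⟨n, ν.parts_pos hn, rfl⟩
    · rw [hc e he]
      simp only [map_sum, MvPowerSeries.coeff_smul, coeff_psumPart]
  · rintro ⟨F, hF, h⟩
    obtain ⟨c, hc⟩ := isExpandable_of_mem hF
    exact ⟨c, hc.congr h⟩

lemma IsExpandable.mul {f g : MvPowerSeries (Fin u) ℂ} (hf : IsExpandable f)
    (hg : IsExpandable g) : IsExpandable (f * g) := by
  classical
  obtain ⟨F, hF, hfF⟩ := isExpandable_iff.mp hf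
  obtain ⟨G, hG, hgG⟩ := isExpandable_iff.mp hg
  refine isExpandable_iff.mpr ⟨F * G, Subalgebra.mul_mem _ hF hG, fun e he => ?_⟩
  rw [MvPowerSeries.coeff_mul, MvPowerSeries.coeff_mul]
  refine Finset.sum_congr rfl fun x hx => ?_
  rw [Finset.HasAntidiagonal.mem_antidiagonal] at hx
  rw [← hx, map_add] at he
  rw [hfF _ (by omega), hgG _ (by omega)]

lemma isExpandable_one : IsExpandable (1 : MvPowerSeries (Fin u) ℂ) :=
  isExpandable_of_mem (Subalgebra.one_mem _)

lemma isExpandable_C (a : ℂ) : IsExpandable (MvPowerSeries.C a : MvPowerSeries (Fin u) ℂ) := by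
  have := (isExpandable_one (u := u)).smul a
  rwa [MvPowerSeries.smul_eq_C_mul, mul_one] at this

lemma isExpandable_psum_vars (n : ℕ) (hn : 0 < n) : IsExpandable (psum n (vars (Fin u) ℂ)) :=
  isExpandable_of_mem (Algebra.subset_adjoin ⟨n, hn, rfl⟩)

lemma IsExpandable.sub {f g : MvPowerSeries (Fin u) ℂ} (hf : IsExpandable f)
    (hg : IsExpandable g) : IsExpandable (f - g) := by
  have := hf.add (hg.smul (-1))
  rwa [neg_one_smul, ← sub_eq_add_neg] at this

lemma isExpandable_multiset_prod (s : Multiset (MvPowerSeries (Fin u) ℂ))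
    (h : ∀ f ∈ s, IsExpandable f) : IsExpandable s.prod := by
  induction s using Multiset.induction_on with
  | empty => simpa using isExpandable_one
  | cons f s ih =>
    rw [Multiset.prod_cons]
    exact (h f (by simp)).mul (ih fun g hg => h g (Multiset.mem_cons_of_mem hg))

lemma isExpandable_sum {ι : Type*} (s : Finset ι) (f : ι → MvPowerSeries (Fin u) ℂ)
    (h : ∀ i ∈ s, IsExpandable (f i)) : IsExpandable (∑ i ∈ s, f i) := by
  classical
  induction s using Finset.induction_on with
  | empty => simpa using isExpandable_zero
  | insert a s ha ih =>
    rw [Finset.sum_insert ha]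
    exact (h a (by simp)).add (ih fun i hi => h i (Finset.mem_insert_of_mem hi))

/-- On expandable series the coefficients `c_ν` are linear functionals of the coefficients of
degree at most `u`. -/
lemma exists_powerSumCoeff_linear {k : ℕ} (hk : k ≤ u) (ν : k.Partition) :
    ∃ ℓ : ({e : Fin u →₀ ℕ // e.degree ≤ u} → ℂ) →ₗ[ℂ] ℂ,
      ∀ f : MvPowerSeries (Fin u) ℂ, IsExpandable f →
        powerSumCoeff f k ν = ℓ fun e => MvPowerSeries.coeff e.1 f := by
  let T : ((k : ℕ) → k.Partition → ℂ) →ₗ[ℂ] ({e : Fin u →₀ ℕ // e.degree ≤ u} → ℂ) :=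
    { toFun := fun c e => ∑ k ∈ Finset.range (u + 1), ∑ ν : k.Partition,
        c k ν * MvPolynomial.coeff e.1 (MvPolynomial.psumPart (Fin u) ℂ ν)
      map_add' := fun c d => by
        funext e
        simp [add_mul, Finset.sum_add_distrib]
      map_smul' := fun a c => by
        funext e
        simp [Finset.mul_sum, mul_assoc] }
  let ev : Module.Dual ℂ ((k : ℕ) → k.Partition → ℂ) :=
    (LinearMap.proj (R := ℂ) (φ := fun _ : k.Partition => ℂ) ν).comp
      (LinearMap.proj (R := ℂ) (φ := fun k : ℕ => k.Partition → ℂ) k)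
  have hev : ev ∈ LinearMap.range T.dualMap := by
    rw [LinearMap.range_dualMap_eq_dualAnnihilator_ker, Submodule.mem_dualAnnihilator]
    intro c hc
    have h0 : IsPowerSumExpansion (0 : MvPowerSeries (Fin u) ℂ) c := fun e he => by
      have := congrFun (LinearMap.mem_ker.mp hc) ⟨e, he⟩
      simpa [T] using this.symm
    exact h0.unique (c' := 0) (fun e _ => by simp) hk ν
  obtain ⟨ℓ, hℓ⟩ := hev
  refine ⟨ℓ, fun f hf => ?_⟩
  obtain ⟨c, hc⟩ := hf
  rw [hc.powerSumCoeff_eq hk]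
  have h1 : c k ν = ev c := rfl
  rw [h1, ← hℓ, LinearMap.dualMap_apply]
  congr 1
  funext e
  exact (hc e.1 e.2).symm

lemma tendsto_powerSumCoeff {ι : Type*} {l : Filter ι} {F : ι → MvPowerSeries (Fin u) ℂ}
    {f : MvPowerSeries (Fin u) ℂ} (hF : ∀ i, IsExpandable (F i)) (hf : IsExpandable f)
    (h : Tendsto F l (𝓝 f)) {k : ℕ} (hk : k ≤ u) (ν : k.Partition) :
    Tendsto (fun i => powerSumCoeff (F i) k ν) l (𝓝 (powerSumCoeff f k ν)) := by
  have hfin : Finite {e : Fin u →₀ ℕ // e.degree ≤ u} := (Finsupp.finite_of_degree_le u).to_subtype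
  obtain ⟨ℓ, hℓ⟩ := exists_powerSumCoeff_linear hk ν
  simp only [hℓ f hf, fun i => hℓ (F i) (hF i)]
  refine (ℓ.continuous_of_finiteDimensional.tendsto _).comp (tendsto_pi_nhds.mpr fun e => ?_)
  exact ((MvPowerSeries.WithPiTopology.continuous_coeff ℂ e.1).tendsto f).comp h

lemma powerSumCoeff_map {A : Type*} [CommRing A] [Algebra ℂ A] (φ : ℂ →+* A)
    {f : MvPowerSeries (Fin u) ℂ} (hf : IsExpandable f) {k : ℕ} (hk : k ≤ u) (ν : k.Partition) :
    powerSumCoeff (MvPowerSeries.map φ f) k ν = φ (powerSumCoeff f k ν) := by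
  obtain ⟨c, hc⟩ := hf
  rw [(hc.map φ).powerSumCoeff_eq hk, hc.powerSumCoeff_eq hk]

lemma tendsto_finiteInner {ι : Type*} {l : Filter ι} {F : ι → MvPowerSeries (Fin u) ℂ}
    {f : MvPowerSeries (Fin u) ℂ} (hF : ∀ i, IsExpandable (F i)) (hf : IsExpandable f)
    (h : Tendsto F l (𝓝 f)) {w : ℕ} (g : MvPowerSeries (Fin u) (MvPowerSeries (Fin w) ℂ)) :
    Tendsto (fun i => finiteInner (MvPowerSeries.map MvPowerSeries.C (F i)) g) l
      (𝓝 (finiteInner (MvPowerSeries.map MvPowerSeries.C f) g)) := by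
  refine tendsto_finsetSum _ fun k hk => tendsto_finsetSum _ fun ν _ => ?_
  have hk' : k ≤ u := by
    simp only [Finset.mem_range] at hk
    omega
  refine Tendsto.const_mul _ (Tendsto.mul_const _ ?_)
  rw [powerSumCoeff_map _ hf hk',
    tendsto_congr fun i => powerSumCoeff_map MvPowerSeries.C (hF i) hk' ν]
  exact (MvPowerSeries.WithPiTopology.continuous_C.tendsto _).comp
    (tendsto_powerSumCoeff hF hf h hk' ν)

/-- The finite inner product depends only on the terms of degree at most `u`. -/
lemma finiteInner_congr {f f' : MvPowerSeries (Fin u) ℂ} (hf : IsExpandable f)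
    (h : ∀ e : Fin u →₀ ℕ, e.degree ≤ u → MvPowerSeries.coeff e f = MvPowerSeries.coeff e f')
    {w : ℕ} (g : MvPowerSeries (Fin u) (MvPowerSeries (Fin w) ℂ)) :
    finiteInner (MvPowerSeries.map MvPowerSeries.C f) g =
      finiteInner (MvPowerSeries.map MvPowerSeries.C f') g := by
  obtain ⟨c, hc⟩ := hf
  have hc' := hc.congr h
  refine Finset.sum_congr rfl fun k hk => Finset.sum_congr rfl fun ν _ => ?_
  have hk' : k ≤ u := by
    simp only [Finset.mem_range] at hk
    omega
  rw [(hc.map _).powerSumCoeff_eq hk', (hc'.map _).powerSumCoeff_eq hk']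

end Expandable

/-! ### The entries of the nested inner products in product form -/

section Entries

lemma inverse_C {σ A : Type*} [CommRing A] (a : A) :
    Ring.inverse (MvPowerSeries.C a : MvPowerSeries σ A) = MvPowerSeries.C (Ring.inverse a) := by
  by_cases h : IsUnit a
  · refine inverse_eq_of_mul_eq_one ?_
    rw [← map_mul, Ring.mul_inverse_cancel _ h, map_one]
  · rw [Ring.inverse_non_unit _ h, map_zero, Ring.inverse_non_unit]
    intro h'
    exact h (by simpa using MvPowerSeries.isUnit_iff_constantCoeff.mp h')

lemma cauchyProd_map_C {σ A : Type*} [CommRing A] (B D : Multiset A) :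
    cauchyProd (B.map (MvPowerSeries.C : A →+* MvPowerSeries σ A)) (D.map MvPowerSeries.C) =
      MvPowerSeries.C (cauchyProd B D) := by
  simp [cauchyProd, map_multiset_prod, ← map_mul, ← inverse_C]

lemma dualProd_map_C {σ A : Type*} [CommRing A] (B D : Multiset A) :
    dualProd (B.map (MvPowerSeries.C : A →+* MvPowerSeries σ A)) (D.map MvPowerSeries.C) =
      MvPowerSeries.C (dualProd B D) := by
  simp [dualProd, map_multiset_prod]

lemma pairProd_map_C {σ A : Type*} [CommRing A] (B : Multiset A) :
    pairProd (B.map (MvPowerSeries.C : A →+* MvPowerSeries σ A)) =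
      MvPowerSeries.C (pairProd B) := by
  simp [pairProd, map_multiset_prod, Multiset.powersetCard_map, ← inverse_C]

lemma squareProd_map_C {σ A : Type*} [CommRing A] (B : Multiset A) :
    squareProd (B.map (MvPowerSeries.C : A →+* MvPowerSeries σ A)) =
      MvPowerSeries.C (squareProd B) := by
  simp [squareProd, map_multiset_prod, ← inverse_C]

lemma algebraMap_eq_C (σ : Type*) : algebraMap ℂ (MvPowerSeries σ ℂ) = MvPowerSeries.C :=
  RingHom.ext fun c => by rw [MvPowerSeries.algebraMap_apply, Algebra.algebraMap_self_apply]

/-- The multiset of entries of a finite list. -/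
def alph {R : Type*} {a : ℕ} (x : Fin a → R) : Multiset R := Finset.univ.val.map x

lemma mem_alph {R : Type*} {a : ℕ} {x : Fin a → R} {r : R} : r ∈ alph x ↔ ∃ i, x i = r := by
  simp [alph]

lemma map_const {R : Type*} [CommRing R] [Algebra ℂ R] {a : ℕ} (x : Fin a → ℂ) :
    Finset.univ.val.map (const R x) = (alph x).map (algebraMap ℂ R) := by
  rw [alph, Multiset.map_map]
  rfl

lemma map_sumElim {R ι κ : Type*} [Fintype ι] [Fintype κ] (X : ι → R) (Y : κ → R) :
    Finset.univ.val.map (Sum.elim X Y) =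
      Finset.univ.val.map X + Finset.univ.val.map Y := by
  rw [← Finset.univ_disjSum_univ, Finset.val_disjSum, Multiset.disjSum, Multiset.map_add,
    Multiset.map_map, Multiset.map_map]
  rfl

lemma prod_H1 {R : Type*} [CommRing R] [Algebra ℂ R] {d : ℕ} (z q : Fin d → ℂ) {ι : Type*}
    [Fintype ι] (X : ι → R) : ∏ j, H1 (q j) (z j) X =
      dualProd (Finset.univ.val.map X) ((alph z).map (algebraMap ℂ R)) *
      cauchyProd (Finset.univ.val.map X)
        ((alph fun j => q j * z j).map (algebraMap ℂ R)) := by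
  simp only [H1, dualProd, cauchyProd, alph, Multiset.map_map, Function.comp_def,
    Finset.prod_map_val, Algebra.smul_def]
  rw [Finset.prod_comm, ← Finset.prod_mul_distrib]
  refine Finset.prod_congr rfl fun i _ => ?_
  rw [← Finset.prod_mul_distrib]
  refine Finset.prod_congr rfl fun j _ => ?_
  rw [mul_comm (X i), mul_comm (X i)]

lemma prod_H2 {R : Type*} [CommRing R] [Algebra ℂ R] {d : ℕ} (z q : Fin d → ℂ) {ι : Type*}
    [Fintype ι] (X : ι → R) : ∏ j, H2 (q j) (z j) X =
      dualProd (Finset.univ.val.map X)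
        (((alph fun j => q j * z j).map (·⁻¹)).map (algebraMap ℂ R)) *
      cauchyProd (Finset.univ.val.map X) (((alph z).map (·⁻¹)).map (algebraMap ℂ R)) := by
  simp only [H2, dualProd, cauchyProd, alph, Multiset.map_map, Function.comp_def,
    Finset.prod_map_val, Algebra.smul_def]
  rw [Finset.prod_comm, ← Finset.prod_mul_distrib]
  refine Finset.prod_congr rfl fun i _ => ?_
  rw [← Finset.prod_mul_distrib]
  refine Finset.prod_congr rfl fun j _ => ?_
  rw [mul_comm (X i), mul_comm (X i)]

/-- The alphabets `ρ⁺`, `ρ⁻`, `(z_j)_j` and `(q_j z_j)_j` of one level. -/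
structure LevelData where
  /-- the alphabet `ρ⁺` -/
  x : Multiset ℂ
  /-- the alphabet `ρ⁻` -/
  y : Multiset ℂ
  /-- the alphabet `(z_j)_j` -/
  z : Multiset ℂ
  /-- the alphabet `(q_j z_j)_j` -/
  w : Multiset ℂ

/-- The level with specializations `x`, `y` and parameters `z`, `q`. -/
def levelData {a b d : ℕ} (x : Fin a → ℂ) (y : Fin b → ℂ) (z q : Fin d → ℂ) : LevelData :=
  ⟨alph x, alph y, alph z, alph fun j => q j * z j⟩

/-- The parameters of the Gaussian series
`c ∏_{i < j} 1 / (1 - ξ_i ξ_j) ∏ 1 / (1 - ξ p) ∏ (1 - ξ q)`. -/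
structure GaussData where
  /-- the constant factor -/
  c : ℂ
  /-- the alphabet of the poles -/
  p : Multiset ℂ
  /-- the alphabet of the zeros -/
  q : Multiset ℂ

/-- The series with the given parameters, in `v` variables. -/
def GaussData.series (s : GaussData) (v : ℕ) : MvPowerSeries (Fin v) ℂ := gauss s.c s.p s.q v

/-- The Gaussian series which is the innermost entry. -/
def LevelData.start (D : LevelData) : GaussData where
  c := pairProd D.x * cauchyProd D.x D.y * dualProd (D.x + D.y) D.z * cauchyProd (D.x + D.y) D.w *
    dualProd D.x (D.w.map (·⁻¹)) * cauchyProd D.x (D.z.map (·⁻¹))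
  p := D.x + D.y + D.w + D.z.map (·⁻¹)
  q := D.z + D.w.map (·⁻¹)

/-- The factors of the right entry of a level which do not involve formal variables. -/
def LevelData.const (D : LevelData) : ℂ :=
  cauchyProd D.x D.y * dualProd D.y D.z * cauchyProd D.y D.w * dualProd D.x (D.w.map (·⁻¹)) *
    cauchyProd D.x (D.z.map (·⁻¹))

/-- The factors of the right entry of a level which do not involve `ξ⁺`, as a series in `ξ⁻`. -/
def LevelData.prefactor (D : LevelData) (v : ℕ) : MvPowerSeries (Fin v) ℂ :=
  MvPowerSeries.C D.const *
    cauchyProd (vars (Fin v) ℂ) ((D.y + D.z.map (·⁻¹)).map MvPowerSeries.C) *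
    dualProd (vars (Fin v) ℂ) ((D.w.map (·⁻¹)).map MvPowerSeries.C)

/-- The alphabet `ρ⁺, ξ⁻, (q_j z_j)_j` with which `ξ⁺` is paired. -/
def LevelData.poles (D : LevelData) (v : ℕ) : Multiset (MvPowerSeries (Fin v) ℂ) :=
  D.x.map MvPowerSeries.C + vars (Fin v) ℂ + D.w.map MvPowerSeries.C

/-- The parameters of the limit of a level. -/
def LevelData.step (D : LevelData) (s : GaussData) : GaussData where
  c := s.c * D.const * (cauchyProd s.p D.x * cauchyProd s.p D.w * cauchyProd s.q D.z *
    dualProd s.p D.z * dualProd s.q D.x * dualProd s.q D.w *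
    (pairProd D.x * pairProd D.w * cauchyProd D.x D.w * pairProd D.z * squareProd D.z *
      dualProd D.x D.z * dualProd D.w D.z))
  p := s.p + D.x + D.w + D.y + D.z.map (·⁻¹)
  q := s.q + D.z + D.w.map (·⁻¹)

/-- The seminorms used for series in one set of formal variables. -/
abbrev seriesFamily (σ : Type) : Set (RingSeminorm (MvPowerSeries σ ℂ)) :=
  boxFamily {normRingSeminorm ℂ} (1 / 2) one_half_pos

/-- Littlewood's and Cauchy's identities for the innermost entry. -/
lemma firstEntry_eq {a b d : ℕ} (x : Fin a → ℂ) (y : Fin b → ℂ) (z q : Fin d → ℂ) (v : ℕ)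
    (hx : ∀ i, ‖x i‖ < 1) (hy : ∀ i, ‖y i‖ < 1) :
    firstEntry x y z q v = (levelData x y z q).start.series v := by
  have hP := isSummabilityFamily_box (σ := Fin v) isSummabilityFamily_complex (1 / 2) one_half_pos
  have hC : ∀ c : ℂ, ‖c‖ < 1 →
      Small (seriesFamily (Fin v)) (algebraMap ℂ (MvPowerSeries (Fin v) ℂ) c) := by
    intro c hc
    rw [algebraMap_eq_C]
    exact ((small_complex_iff c).mpr hc).box_C
  have hX : ∀ i, Small (seriesFamily (Fin v))
      (Sum.elim (const (MvPowerSeries (Fin v) ℂ) x) MvPowerSeries.X i) := by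
    rintro (i | i)
    · exact hC _ (hx i)
    · exact small_box_X isSummabilityFamily_complex (by norm_num) i
  simp only [firstEntry]
  rw [partitionZ_eq hP _ (const (MvPowerSeries (Fin v) ℂ) y) hX fun i => hC _ (hy i),
    Finset.prod_mul_distrib, prod_H1, prod_H2]
  simp only [map_sumElim, map_const, algebraMap_eq_C]
  change pairProd (_ + vars (Fin v) ℂ) * cauchyProd (_ + vars (Fin v) ℂ) _ *
    (dualProd (_ + vars (Fin v) ℂ + _) _ * cauchyProd (_ + vars (Fin v) ℂ + _) _ *
    (dualProd (_ + vars (Fin v) ℂ) _ * cauchyProd (_ + vars (Fin v) ℂ) _)) = _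
  simp only [GaussData.series, gauss, LevelData.start, levelData, pairProd_add,
    cauchyProd_add_left, cauchyProd_add_right, dualProd_add_left, dualProd_add_right,
    Multiset.map_add, map_mul, cauchyProd_map_C, dualProd_map_C, pairProd_map_C]
  rw [cauchyProd_comm (Multiset.map _ (alph x)) (vars (Fin v) ℂ)]
  ring

lemma linkEntry_eq (v w : ℕ) : linkEntry v w =
    MvPowerSeries.C 1 * cauchyProd (vars (Fin v) (MvPowerSeries (Fin w) ℂ))
      ((vars (Fin w) ℂ).map MvPowerSeries.C) *
      dualProd (vars (Fin v) (MvPowerSeries (Fin w) ℂ))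
        ((0 : Multiset (MvPowerSeries (Fin w) ℂ)).map MvPowerSeries.C) := by
  have hP := isSummabilityFamily_box (σ := Fin w) isSummabilityFamily_complex (1 / 2) one_half_pos
  have hP' := isSummabilityFamily_box (σ := Fin v) hP (1 / 2) one_half_pos
  simp only [linkEntry]
  rw [partitionF_eq hP' _ _ (fun i => small_box_X hP (by norm_num) i)
    (fun i => (small_box_X isSummabilityFamily_complex (by norm_num) i).box_C)]
  simp [vars, Function.comp_def]

/-- As a series in `ξ⁺`, the right entry of a level is a Cauchy kernel. -/
lemma levelEntry_eq {a b d : ℕ} (x : Fin a → ℂ) (y : Fin b → ℂ) (z q : Fin d → ℂ) (w v : ℕ)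
    (hx : ∀ i, ‖x i‖ < 1) (hy : ∀ i, ‖y i‖ < 1) :
    levelEntry x y z q w v =
      MvPowerSeries.C ((levelData x y z q).prefactor v) *
      cauchyProd (vars (Fin w) (MvPowerSeries (Fin v) ℂ))
        (((levelData x y z q).poles v).map MvPowerSeries.C) *
      dualProd (vars (Fin w) (MvPowerSeries (Fin v) ℂ))
        (((levelData x y z q).z.map MvPowerSeries.C).map MvPowerSeries.C) := by
  have hP := isSummabilityFamily_box (σ := Fin v) isSummabilityFamily_complex (1 / 2) one_half_pos
  have hP' := isSummabilityFamily_box (σ := Fin w) hP (1 / 2) one_half_pos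
  have halg : ∀ B : Multiset ℂ,
      B.map (algebraMap ℂ (MvPowerSeries (Fin w) (MvPowerSeries (Fin v) ℂ))) =
      (B.map (MvPowerSeries.C : ℂ →+* MvPowerSeries (Fin v) ℂ)).map MvPowerSeries.C := by
    intro B
    rw [Multiset.map_map]
    refine Multiset.map_congr rfl fun c _ => ?_
    rw [MvPowerSeries.algebraMap_apply, algebraMap_eq_C]
    rfl
  have hC : ∀ c : ℂ, ‖c‖ < 1 →
      Small (boxFamily (seriesFamily (Fin v)) (1 / 2) one_half_pos)
        (algebraMap ℂ (MvPowerSeries (Fin w) (MvPowerSeries (Fin v) ℂ)) c) := by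
    intro c hc
    rw [MvPowerSeries.algebraMap_apply, algebraMap_eq_C]
    exact ((small_complex_iff c).mpr hc).box_C.box_C
  have hX : ∀ i, Small (boxFamily (seriesFamily (Fin v)) (1 / 2) one_half_pos)
      (Sum.elim (const (MvPowerSeries (Fin w) (MvPowerSeries (Fin v) ℂ)) x)
        (fun j => MvPowerSeries.C (MvPowerSeries.X j)) i) := by
    rintro (i | i)
    · exact hC _ (hx i)
    · exact (small_box_X isSummabilityFamily_complex (by norm_num) i).box_C
  have hY : ∀ i, Small (boxFamily (seriesFamily (Fin v)) (1 / 2) one_half_pos)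
      (Sum.elim (const (MvPowerSeries (Fin w) (MvPowerSeries (Fin v) ℂ)) y)
        MvPowerSeries.X i) := by
    rintro (i | i)
    · exact hC _ (hy i)
    · exact small_box_X hP (by norm_num) i
  have hvars : Finset.univ.val.map (fun j : Fin v => (MvPowerSeries.C (MvPowerSeries.X j) :
      MvPowerSeries (Fin w) (MvPowerSeries (Fin v) ℂ))) =
      (vars (Fin v) ℂ).map MvPowerSeries.C := by
    simp [vars, Function.comp_def]
  simp only [levelEntry]
  rw [partitionF_eq hP' _ _ hX hY, Finset.prod_mul_distrib, prod_H1, prod_H2]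
  simp only [map_sumElim, map_const, halg, hvars]
  change cauchyProd (_ + _) (_ + vars (Fin w) (MvPowerSeries (Fin v) ℂ)) *
    (dualProd (_ + vars (Fin w) (MvPowerSeries (Fin v) ℂ)) _ *
      cauchyProd (_ + vars (Fin w) (MvPowerSeries (Fin v) ℂ)) _ * _) = _
  simp only [LevelData.prefactor, LevelData.poles, LevelData.const, levelData,
    cauchyProd_add_left, cauchyProd_add_right, dualProd_add_left,
    Multiset.map_add, map_mul, ← cauchyProd_map_C, ← dualProd_map_C]
  rw [cauchyProd_comm ((Multiset.map _ (alph x)).map _)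
      (vars (Fin w) (MvPowerSeries (Fin v) ℂ)),
    cauchyProd_comm ((vars (Fin v) ℂ).map _) (vars (Fin w) (MvPowerSeries (Fin v) ℂ))]
  ring

/-- The product form of the limit of a level is again a Gaussian series. -/
lemma LevelData.prefactor_mul_gaussValue (D : LevelData) (s : GaussData) (v : ℕ) :
    D.prefactor v * (MvPowerSeries.C s.c * gaussValue (s.p.map MvPowerSeries.C)
      (s.q.map MvPowerSeries.C) (D.poles v) (D.z.map MvPowerSeries.C)) =
      (D.step s).series v := by
  simp only [LevelData.prefactor, LevelData.poles, gaussValue, GaussData.series, LevelData.step,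
    gauss, pairProd_add, cauchyProd_add_left, cauchyProd_add_right, dualProd_add_left,
    dualProd_add_right, Multiset.map_add, map_mul, cauchyProd_map_C, dualProd_map_C,
    pairProd_map_C, squareProd_map_C]
  rw [cauchyProd_comm (Multiset.map _ s.p) (vars (Fin v) ℂ),
    dualProd_comm (Multiset.map _ s.q) (vars (Fin v) ℂ),
    cauchyProd_comm (Multiset.map _ D.x) (vars (Fin v) ℂ)]
  ring

end Entries

/-! ### One level: the pairings of a Gaussian series and their limits -/

section Level

lemma GaussData.isExpandable (s : GaussData) (v : ℕ) : IsExpandable (s.series v) := by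
  obtain ⟨c, hc, -⟩ := exists_gauss_expansion s.p s.q
  exact ⟨_, hc s.c v⟩

lemma isExpandable_kernel (K : ℂ) (B B' : Multiset ℂ) (u : ℕ) :
    IsExpandable (MvPowerSeries.C K * cauchyProd (vars (Fin u) ℂ) (B.map MvPowerSeries.C) *
      dualProd (vars (Fin u) ℂ) (B'.map MvPowerSeries.C)) :=
  ⟨_, isPowerSumExpansion_kernel K B B'⟩

lemma LevelData.isExpandable_prefactor (D : LevelData) (v : ℕ) :
    IsExpandable (D.prefactor v) := isExpandable_kernel _ _ _ _

/-- The pairing with `F(ξ⁻; ξ⁺)` replaces the variables `ξ⁻` by `ξ⁺`. -/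
lemma finiteInner_linkEntry {v : ℕ} {f : MvPowerSeries (Fin v) ℂ}
    {c : (k : ℕ) → k.Partition → ℂ} (hf : IsPowerSumExpansion f c) (w : ℕ) :
    finiteInner (MvPowerSeries.map MvPowerSeries.C f) (linkEntry v w) =
      ∑ k ∈ Finset.range (v + 1), ∑ ν : k.Partition,
        c k ν • (ν.parts.map fun n => psum n (vars (Fin w) ℂ)).prod := by
  rw [linkEntry_eq, finiteInner_kernel hf _ (algebraMap_eq_C _).symm, one_mul]
  simp

/-- Power sums in `ξ⁻` are turned into power sums in `ξ⁺`. -/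
lemma isExpandable_link {v : ℕ} {f : MvPowerSeries (Fin v) ℂ} (hf : IsExpandable f) (w : ℕ) :
    IsExpandable (finiteInner (MvPowerSeries.map MvPowerSeries.C f) (linkEntry v w)) := by
  obtain ⟨c, hc⟩ := hf
  rw [finiteInner_linkEntry hc]
  refine isExpandable_sum _ _ fun k _ => isExpandable_sum _ _ fun ν _ =>
    IsExpandable.smul (isExpandable_multiset_prod _ fun x hx => ?_) _
  obtain ⟨n, hn, rfl⟩ := Multiset.mem_map.mp hx
  exact isExpandable_psum_vars n (ν.parts_pos hn)

/-- If `v ≥ w`, replacing `v` variables by `w` variables in a Gaussian series gives the Gaussian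
series in `w` variables, up to degree `w`. -/
lemma coeff_link_gauss (s : GaussData) {v w : ℕ} (hvw : w ≤ v) (e : Fin w →₀ ℕ)
    (he : e.degree ≤ w) : MvPowerSeries.coeff e
      (finiteInner (MvPowerSeries.map MvPowerSeries.C (s.series v)) (linkEntry v w)) =
      MvPowerSeries.coeff e (s.series w) := by
  obtain ⟨c, hc, -⟩ := exists_gauss_expansion s.p s.q
  have h1 := hc s.c v
  have h2 := hc s.c w
  rw [GaussData.series, GaussData.series, finiteInner_linkEntry h1, h2 e he, map_sum]
  simp only [map_sum, MvPowerSeries.coeff_smul, ← coeff_psumPart]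
  symm
  refine Finset.sum_subset (by simpa using hvw) fun k _ hk =>
    Finset.sum_eq_zero fun ν _ => ?_
  simp only [Finset.mem_range] at hk
  rw [(isHomogeneous_psumPart (Fin w) ℂ ν).coeff_eq_zero (by omega), mul_zero]

variable {a b d : ℕ} (x : Fin a → ℂ) (y : Fin b → ℂ) (z q : Fin d → ℂ)

/-- The pairing of a series in `w` variables `ξ⁺` with the right entry of a level. -/
def pairLevel (w v : ℕ) (f : MvPowerSeries (Fin w) ℂ) : MvPowerSeries (Fin v) ℂ :=
  finiteInner (MvPowerSeries.map MvPowerSeries.C f) (levelEntry x y z q w v)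

/-- The pairing of a series in `v` variables `ξ⁻` with `F(ξ⁻; ξ⁺)`. -/
def pairLink (v w : ℕ) (f : MvPowerSeries (Fin v) ℂ) : MvPowerSeries (Fin w) ℂ :=
  finiteInner (MvPowerSeries.map MvPowerSeries.C f) (linkEntry v w)

lemma pairLevel_eq (hx : ∀ i, ‖x i‖ < 1) (hy : ∀ i, ‖y i‖ < 1)
    {w : ℕ} {f : MvPowerSeries (Fin w) ℂ} {c : (k : ℕ) → k.Partition → ℂ}
    (hf : IsPowerSumExpansion f c) (v : ℕ) :
    pairLevel x y z q w v f = (levelData x y z q).prefactor v *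
      ∑ k ∈ Finset.range (w + 1), ∑ ν : k.Partition, c k ν •
        (ν.parts.map fun n => psum n ((levelData x y z q).poles v) -
          psum n ((levelData x y z q).z.map MvPowerSeries.C)).prod := by
  rw [pairLevel, levelEntry_eq x y z q w v hx hy,
    finiteInner_kernel hf _ (algebraMap_eq_C _).symm]

lemma isExpandable_pairLevel (hx : ∀ i, ‖x i‖ < 1) (hy : ∀ i, ‖y i‖ < 1)
    {w : ℕ} {f : MvPowerSeries (Fin w) ℂ} (hf : IsExpandable f) (v : ℕ) :
    IsExpandable (pairLevel x y z q w v f) := by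
  obtain ⟨c, hc⟩ := hf
  rw [pairLevel_eq x y z q hx hy hc]
  refine (LevelData.isExpandable_prefactor _ v).mul <|
    isExpandable_sum _ _ fun k _ => isExpandable_sum _ _ fun ν _ =>
    IsExpandable.smul (isExpandable_multiset_prod _ fun g hg => ?_) _
  obtain ⟨n, hn, rfl⟩ := Multiset.mem_map.mp hg
  simp only [LevelData.poles, psum_add, psum_map]
  exact (((isExpandable_C _).add (isExpandable_psum_vars n (ν.parts_pos hn))).add
    (isExpandable_C _)).sub (isExpandable_C _)

/-- The limit in the number of variables `ξ⁺` of the pairing of a Gaussian series with the right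
entry of a level. -/
lemma tendsto_pairLevel (hx : ∀ i, ‖x i‖ < 1) (hy : ∀ i, ‖y i‖ < 1)
    (s : GaussData)
    (hz : ∀ j, ‖z j‖ < 1) (hqz : ∀ j, ‖q j * z j‖ < 1)
    (hpx : ∀ p ∈ s.p, ∀ i, ‖p * x i‖ < 1) (hpw : ∀ p ∈ s.p, ∀ j, ‖p * (q j * z j)‖ < 1)
    (hqz' : ∀ r ∈ s.q, ∀ j, ‖r * z j‖ < 1) (v : ℕ) :
    Tendsto (fun w => pairLevel x y z q w v (s.series w)) atTop
      (𝓝 (((levelData x y z q).step s).series v)) := by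
  set D := levelData x y z q
  -- the weight of the formal variables has to be small compared with the poles
  obtain ⟨ρ, hρ0, hρ1, hρ⟩ : ∃ ρ : ℝ, 0 < ρ ∧ ρ < 1 ∧ ∀ p ∈ s.p, ‖p‖ * ρ < 1 := by
    obtain ⟨M, hM⟩ : ∃ M : ℝ, ∀ p ∈ s.p, ‖p‖ ≤ M := by
      obtain ⟨M, hM⟩ := (s.p.toFinset.image (‖·‖)).bddAbove
      exact ⟨M, fun p hp => hM (by simpa using ⟨p, hp, rfl⟩)⟩
    have hpos : 0 < |M| + 2 := by positivity
    refine ⟨(|M| + 2)⁻¹, by positivity, inv_lt_one_of_one_lt₀ (by linarith [abs_nonneg M]),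
      fun p hp => ?_⟩
    rw [← div_eq_mul_inv, div_lt_one hpos]
    linarith [hM p hp, le_abs_self M]
  have hP := isSummabilityFamily_box (σ := Fin v) isSummabilityFamily_complex ρ hρ0
  have hC : ∀ c : ℂ, ‖c‖ < 1 → Small (boxFamily (σ := Fin v) {normRingSeminorm ℂ} ρ hρ0)
      (MvPowerSeries.C c) := fun c hc => ((small_complex_iff c).mpr hc).box_C
  have hX : ∀ i, Small (boxFamily (σ := Fin v) {normRingSeminorm ℂ} ρ hρ0)
      (MvPowerSeries.X i) := fun i => small_box_X isSummabilityFamily_complex hρ1 i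
  have hpoles : ∀ r ∈ D.poles v, (∃ i, r = MvPowerSeries.C (x i)) ∨
      (∃ i, r = MvPowerSeries.X i) ∨ ∃ j, r = MvPowerSeries.C (q j * z j) := by
    intro r hr
    simp only [LevelData.poles, D, levelData, Multiset.mem_add, Multiset.mem_map, mem_alph,
      vars] at hr
    rcases hr with (⟨_, ⟨i, rfl⟩, rfl⟩ | ⟨i, _, rfl⟩) | ⟨_, ⟨j, rfl⟩, rfl⟩
    · exact Or.inl ⟨i, rfl⟩
    · exact Or.inr (Or.inl ⟨i, rfl⟩)
    · exact Or.inr (Or.inr ⟨j, rfl⟩)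
  have hzs : ∀ r ∈ D.z.map (MvPowerSeries.C : ℂ →+* MvPowerSeries (Fin v) ℂ),
      ∃ j, r = MvPowerSeries.C (z j) := by
    intro r hr
    obtain ⟨_, h, rfl⟩ := Multiset.mem_map.mp hr
    obtain ⟨j, rfl⟩ := mem_alph.mp h
    exact ⟨j, rfl⟩
  have hev := hasEval_gaussSeries hP (s.p.map MvPowerSeries.C) (s.q.map MvPowerSeries.C)
    (D.poles v) (D.z.map MvPowerSeries.C) (by
      intro r hr t ht
      obtain ⟨p, hp, rfl⟩ := Multiset.mem_map.mp hr
      rcases hpoles t ht with ⟨i, rfl⟩ | ⟨i, rfl⟩ | ⟨j, rfl⟩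
      · rw [← map_mul]
        exact hC _ (hpx p hp i)
      · rintro _ ⟨n, rfl, E, rfl⟩
        refine (map_mul_le_mul _ _ _).trans_lt ?_
        rw [boxSeminorm_C]
        exact (mul_le_mul_of_nonneg_left (boxSeminorm_X_le _
          (isSummabilityFamily_complex.one_le _ rfl) ρ hρ0 E i) (norm_nonneg p)).trans_lt (hρ p hp)
      · rw [← map_mul]
        exact hC _ (hpw p hp j)) (by
      intro r hr t ht
      obtain ⟨p, hp, rfl⟩ := Multiset.mem_map.mp hr
      obtain ⟨j, rfl⟩ := hzs t ht
      rw [← map_mul]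
      exact hC _ (hqz' p hp j)) (by
      intro t ht
      rcases hpoles t ht with ⟨i, rfl⟩ | ⟨i, rfl⟩ | ⟨j, rfl⟩
      · exact hC _ (hx i)
      · exact hX i
      · exact hC _ (hqz j)) (by
      intro t ht
      obtain ⟨j, rfl⟩ := hzs t ht
      exact hC _ (hz j))
  obtain ⟨c, hc, hc'⟩ := exists_gauss_expansion s.p s.q
  have hsum := hev.2.tendsto_sum_nat
  have h1 : ∀ w, pairLevel x y z q w v (s.series w) = D.prefactor v * (MvPowerSeries.C s.c *
      ∑ k ∈ Finset.range (w + 1), PowerSeries.coeff k (gaussSeries (s.p.map MvPowerSeries.C)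
        (s.q.map MvPowerSeries.C) (D.poles v) (D.z.map MvPowerSeries.C))) := by
    intro w
    have hcw : IsPowerSumExpansion (s.series w) fun k ν => s.c * c k ν := hc s.c w
    rw [pairLevel_eq x y z q hx hy hcw, ← algebraMap_eq_C]
    simp only [hc', Finset.mul_sum, Algebra.smul_def, map_mul, mul_assoc]
    rfl
  simp only [h1]
  rw [← D.prefactor_mul_gaussValue s v]
  exact ((hsum.comp (tendsto_add_atTop_nat 1)).const_mul _).const_mul _

end Level

/-! ### The iterated limit -/

section IteratedLimit

/-- The nested pairings started from a series in the first group of variables. -/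
def nestedFrom {n n' d : ℕ → ℕ} (x : (i : ℕ) → Fin (n i) → ℂ) (y : (i : ℕ) → Fin (n' i) → ℂ)
    (z q : (i : ℕ) → Fin (d i) → ℂ) (w₁ w₂ : ℕ → ℕ) (S : (v : ℕ) → MvPowerSeries (Fin v) ℂ) :
    (r : ℕ) → MvPowerSeries (Fin (w₁ r)) ℂ
  | 0 => S (w₁ 0)
  | r + 1 => pairLevel (x r) (y r) (z r) (q r) (w₂ r) (w₁ (r + 1))
      (pairLink (w₁ r) (w₂ r) (nestedFrom x y z q w₁ w₂ S r))

lemma nested_eq_nestedFrom {n n' d : ℕ → ℕ} (x : (i : ℕ) → Fin (n i) → ℂ)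
    (y : (i : ℕ) → Fin (n' i) → ℂ) (z q : (i : ℕ) → Fin (d i) → ℂ) (u₁ u₂ : ℕ → ℕ) (r : ℕ) :
    nested x y z q u₁ u₂ r = nestedFrom (fun i => x (i + 2)) (fun i => y (i + 1))
      (fun i => z (i + 2)) (fun i => q (i + 2)) (fun i => u₁ (i + 1)) (fun i => u₂ (i + 1))
      (firstEntry (x 1) (y 0) (z 1) (q 1)) r := by
  induction r with
  | zero => rfl
  | succ r ih => rw [nested, ih]; rfl

/-- The pairing of a series in `a` variables `ξ⁻` with `F(ξ⁻; ξ⁺)` and then, in `b` variables `ξ⁺`,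
with the right entry of a level. -/
def pairBoth {n n' d : ℕ} (x : Fin n → ℂ) (y : Fin n' → ℂ) (z q : Fin d → ℂ)
    (S : (v : ℕ) → MvPowerSeries (Fin v) ℂ) (a b v : ℕ) : MvPowerSeries (Fin v) ℂ :=
  pairLevel x y z q b v (pairLink a b (S a))

/-- The pairing of a Gaussian series in `b` variables with the right entry of a level. -/
def pairGauss {n n' d : ℕ} (x : Fin n → ℂ) (y : Fin n' → ℂ) (z q : Fin d → ℂ)
    (s : GaussData) (b v : ℕ) : MvPowerSeries (Fin v) ℂ :=
  pairLevel x y z q b v (s.series b)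

/-- The pairing with `F(ξ⁻; ξ⁺)` has no effect as soon as there are as many variables `ξ⁻`
as `ξ⁺`. -/
lemma pairBoth_series {n n' d : ℕ} (x : Fin n → ℂ) (y : Fin n' → ℂ) (z q : Fin d → ℂ)
    (s : GaussData) {a b : ℕ} (h : b ≤ a) :
    pairBoth x y z q s.series a b = pairGauss x y z q s b :=
  funext fun _ => finiteInner_congr (isExpandable_link (s.isExpandable a) _)
    (fun e he => coeff_link_gauss s h e he) _

/-- The innermost pairings may be absorbed into the starting series. -/
lemma nestedFrom_succ {n n' d : ℕ → ℕ} (x : (i : ℕ) → Fin (n i) → ℂ)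
    (y : (i : ℕ) → Fin (n' i) → ℂ) (z q : (i : ℕ) → Fin (d i) → ℂ) (w₁ w₂ : ℕ → ℕ)
    (S : (v : ℕ) → MvPowerSeries (Fin v) ℂ) (r : ℕ) :
    nestedFrom x y z q w₁ w₂ S (r + 1) =
      nestedFrom (fun i => x (i + 1)) (fun i => y (i + 1)) (fun i => z (i + 1))
        (fun i => q (i + 1)) (fun i => w₁ (i + 1)) (fun i => w₂ (i + 1))
        (pairBoth (x 0) (y 0) (z 0) (q 0) S (w₁ 0) (w₂ 0)) r := by
  induction r with
  | zero => rfl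
  | succ r ih => rw [nestedFrom, ih]; rfl

/-- For fixed truncation parameters the nested pairings depend continuously on the starting series,
since they only involve its power sum coefficients up to some degree. -/
lemma nestedFrom_tendsto {n n' d : ℕ → ℕ} (x : (i : ℕ) → Fin (n i) → ℂ)
    (y : (i : ℕ) → Fin (n' i) → ℂ) (z q : (i : ℕ) → Fin (d i) → ℂ) (w₁ w₂ : ℕ → ℕ)
    {S : ℕ → (v : ℕ) → MvPowerSeries (Fin v) ℂ} {S' : (v : ℕ) → MvPowerSeries (Fin v) ℂ}
    (hS : ∀ b v, IsExpandable (S b v)) (hS' : ∀ v, IsExpandable (S' v))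
    (h : ∀ v, Tendsto (fun b => S b v) atTop (𝓝 (S' v))) (r : ℕ)
    (hx : ∀ i < r, ∀ l, ‖x i l‖ < 1) (hy : ∀ i < r, ∀ l, ‖y i l‖ < 1) :
    (∀ b, IsExpandable (nestedFrom x y z q w₁ w₂ (S b) r)) ∧
      IsExpandable (nestedFrom x y z q w₁ w₂ S' r) ∧
      Tendsto (fun b => nestedFrom x y z q w₁ w₂ (S b) r) atTop
        (𝓝 (nestedFrom x y z q w₁ w₂ S' r)) := by
  induction r with
  | zero => exact ⟨fun b => hS b _, hS' _, h _⟩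
  | succ r ih =>
    obtain ⟨h1, h2, h3⟩ := ih (fun i hi => hx i (by omega)) fun i hi => hy i (by omega)
    have hxr := hx r (by omega)
    have hyr := hy r (by omega)
    refine ⟨fun b => isExpandable_pairLevel _ _ _ _ hxr hyr (isExpandable_link (h1 b) _) _,
      isExpandable_pairLevel _ _ _ _ hxr hyr (isExpandable_link h2 _) _, ?_⟩
    exact tendsto_finiteInner (fun b => isExpandable_link (h1 b) _) (isExpandable_link h2 _)
      (tendsto_finiteInner h1 h2 h3 _) _

/-- A finite sequence of truncation parameters, continued by zero. -/
def extendZero (N : ℕ) (u : Fin N → ℕ) (k : ℕ) : ℕ := if h : k < N then u ⟨k, h⟩ else 0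

lemma extendZero_cons_zero (N a : ℕ) (u : Fin N → ℕ) :
    extendZero (N + 1) (Fin.cons a u) 0 = a := by
  simp [extendZero]

lemma extendZero_cons_succ (N a : ℕ) (u : Fin N → ℕ) (k : ℕ) :
    extendZero (N + 1) (Fin.cons a u) (k + 1) = extendZero N u k := by
  unfold extendZero
  by_cases h : k < N
  · rw [dif_pos h, dif_pos (by omega)]
    exact Fin.cons_succ (α := fun _ => ℕ) a u ⟨k, h⟩
  · rw [dif_neg h, dif_neg (by omega)]

/-- The value of the nested pairings, as a function of the truncation parameters. -/
def valueFrom {n n' d : ℕ → ℕ} (x : (i : ℕ) → Fin (n i) → ℂ) (y : (i : ℕ) → Fin (n' i) → ℂ)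
    (z q : (i : ℕ) → Fin (d i) → ℂ) (t : ℕ → ℕ) (S : (v : ℕ) → MvPowerSeries (Fin v) ℂ)
    (N : ℕ) : ℂ :=
  MvPowerSeries.constantCoeff
    (nestedFrom x y z q (fun r => t (2 * r)) (fun r => t (2 * r + 1)) S N)

lemma valueFrom_succ {n n' d : ℕ → ℕ} (x : (i : ℕ) → Fin (n i) → ℂ)
    (y : (i : ℕ) → Fin (n' i) → ℂ) (z q : (i : ℕ) → Fin (d i) → ℂ) (t : ℕ → ℕ)
    (S : (v : ℕ) → MvPowerSeries (Fin v) ℂ) (N : ℕ) :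
    valueFrom x y z q t S (N + 1) =
      valueFrom (fun i => x (i + 1)) (fun i => y (i + 1)) (fun i => z (i + 1))
        (fun i => q (i + 1)) (fun k => t (k + 2))
        (pairBoth (x 0) (y 0) (z 0) (q 0) S (t 0) (t 1)) N := by
  rw [valueFrom, nestedFrom_succ]
  rfl

/-- The parameters of the Gaussian series after `r` levels. -/
def gaussIter (D : ℕ → LevelData) (s : GaussData) : ℕ → GaussData
  | 0 => s
  | r + 1 => (D r).step (gaussIter D s r)

lemma gaussIter_succ' (D : ℕ → LevelData) (s : GaussData) (r : ℕ) :
    gaussIter D s (r + 1) = gaussIter (fun i => D (i + 1)) ((D 0).step s) r := by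
  induction r with
  | zero => rfl
  | succ r ih => rw [gaussIter, ih]; rfl

/-- Starting from a Gaussian series, all the iterated limits exist, and each level replaces the
Gaussian series by another one. The inequalities ask for absolute convergence at each level. -/
theorem isIteratedLimit_valueFrom (N : ℕ) : ∀ {n n' d : ℕ → ℕ} (x : (i : ℕ) → Fin (n i) → ℂ)
    (y : (i : ℕ) → Fin (n' i) → ℂ) (z q : (i : ℕ) → Fin (d i) → ℂ) (s : GaussData),
    (∀ i < N, ∀ l, ‖x i l‖ < 1) → (∀ i < N, ∀ l, ‖y i l‖ < 1) → (∀ i < N, ∀ j, ‖z i j‖ < 1) →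
    (∀ i < N, ∀ j, ‖q i j * z i j‖ < 1) →
    (∀ i < N, ∀ p ∈ (gaussIter (fun i => levelData (x i) (y i) (z i) (q i)) s i).p,
      (∀ l, ‖p * x i l‖ < 1) ∧ ∀ j, ‖p * (q i j * z i j)‖ < 1) →
    (∀ i < N, ∀ r ∈ (gaussIter (fun i => levelData (x i) (y i) (z i) (q i)) s i).q,
      ∀ j, ‖r * z i j‖ < 1) →
    IsIteratedLimit (2 * N) (fun u => valueFrom x y z q (extendZero (2 * N) u) s.series N)
      (gaussIter (fun i => levelData (x i) (y i) (z i) (q i)) s N).c := by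
  induction N with
  | zero =>
    intro n n' d x y z q s _ _ _ _ _ _
    change MvPowerSeries.constantCoeff (gauss s.c s.p s.q 0) = s.c
    simp [gauss, vars]
  | succ N ih =>
    intro n n' d x y z q s hx hy hz hqz hp hq
    have hx0 := hx 0 (by omega)
    have hy0 := hy 0 (by omega)
    change IsIteratedLimit (2 * N + 1 + 1)
      (fun u => valueFrom x y z q (extendZero (2 * N + 1 + 1) u) s.series (N + 1)) _
    refine ⟨fun u => valueFrom (fun i => x (i + 1)) (fun i => y (i + 1)) (fun i => z (i + 1))
        (fun i => q (i + 1)) (fun k => extendZero (2 * N + 1) u (k + 1))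
        (pairGauss (x 0) (y 0) (z 0) (q 0) s (extendZero (2 * N + 1) u 0)) N, fun u => ?_,
      fun u => valueFrom (fun i => x (i + 1)) (fun i => y (i + 1)) (fun i => z (i + 1))
        (fun i => q (i + 1)) (extendZero (2 * N) u)
        ((levelData (x 0) (y 0) (z 0) (q 0)).step s).series N, fun u => ?_, ?_⟩
    · -- the limit in the number of variables `ξ⁻` is attained once there are as many as `ξ⁺`
      refine tendsto_const_nhds.congr' ?_
      filter_upwards [eventually_ge_atTop (extendZero (2 * N + 1) u 0)] with a ha
      rw [valueFrom_succ]
      simp only [extendZero_cons_succ, extendZero_cons_zero]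
      rw [pairBoth_series _ _ _ _ _ ha]
    · simp only [extendZero_cons_succ, extendZero_cons_zero]
      have h := (nestedFrom_tendsto (S := pairGauss (x 0) (y 0) (z 0) (q 0) s)
        (S' := ((levelData (x 0) (y 0) (z 0) (q 0)).step s).series) (fun i => x (i + 1))
        (fun i => y (i + 1))
        (fun i => z (i + 1)) (fun i => q (i + 1)) (fun r => extendZero (2 * N) u (2 * r))
        (fun r => extendZero (2 * N) u (2 * r + 1))
        (fun b v => isExpandable_pairLevel (x 0) (y 0) (z 0) (q 0) hx0 hy0 (s.isExpandable b) v)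
        (fun v => GaussData.isExpandable _ v)
        (tendsto_pairLevel (x 0) (y 0) (z 0) (q 0) hx0 hy0 s (hz 0 (by omega))
          (hqz 0 (by omega)) (fun p hp' => (hp 0 (by omega) p hp').1)
          (fun p hp' => (hp 0 (by omega) p hp').2) (hq 0 (by omega))) N
        (fun i hi => hx (i + 1) (by omega)) (fun i hi => hy (i + 1) (by omega))).2.2
      exact ((MvPowerSeries.WithPiTopology.continuous_constantCoeff ℂ).tendsto _).comp h
    · rw [gaussIter_succ']
      refine ih (fun i => x (i + 1)) (fun i => y (i + 1)) (fun i => z (i + 1))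
        (fun i => q (i + 1)) _ (fun i hi => hx (i + 1) (by omega))
        (fun i hi => hy (i + 1) (by omega)) (fun i hi => hz (i + 1) (by omega))
        (fun i hi => hqz (i + 1) (by omega)) (fun i hi => ?_) (fun i hi => ?_)
      · have := hp (i + 1) (by omega)
        rwa [gaussIter_succ'] at this
      · have := hq (i + 1) (by omega)
        rwa [gaussIter_succ'] at this

end IteratedLimit

/-! ### The limit in closed form -/

section ClosedForm

/-- The interaction of the parameters of one level with themselves. -/
def LevelData.selfFactor (D : LevelData) : ℂ :=
  pairProd D.w * pairProd D.z * squareProd D.z * dualProd D.w D.z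

/-- The interaction of the parameters of two levels. -/
def crossFactor (D E : LevelData) : ℂ :=
  cauchyProd D.w E.w * cauchyProd (D.z.map (·⁻¹)) E.w * dualProd D.w E.z *
    dualProd (D.z.map (·⁻¹)) E.z * cauchyProd D.z E.z * cauchyProd (D.w.map (·⁻¹)) E.z *
    dualProd D.z E.w * dualProd (D.w.map (·⁻¹)) E.w

/-- The limit for the levels `1, …, m`, in terms of products over pairs of alphabets. The alphabet
`ρ⁻_j` belongs to the level `j + 1`. -/
def closedProd (L : ℕ → LevelData) (m : ℕ) : ℂ :=
  pairProd (∑ k ∈ Finset.Icc 1 m, (L k).x) *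
  (∏ j ∈ Finset.range m, ∏ k ∈ Finset.Icc (j + 1) m, cauchyProd (L k).x (L (j + 1)).y) *
  (∏ i ∈ Finset.Icc 2 m, (L i).selfFactor) *
  (∏ k ∈ Finset.Icc 1 m, ∏ i ∈ Finset.Icc 1 m,
    dualProd (L i).x (L k).z * cauchyProd (L i).x (L k).w) *
  (∏ k ∈ Finset.Icc 1 m, ∏ i ∈ Finset.range k,
    dualProd (L (i + 1)).y (L k).z * cauchyProd (L (i + 1)).y (L k).w) *
  (∏ k ∈ Finset.Icc 1 m, ∏ i ∈ Finset.Icc k m,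
    dualProd (L i).x ((L k).w.map (·⁻¹)) * cauchyProd (L i).x ((L k).z.map (·⁻¹))) *
  (∏ a ∈ Finset.Icc 1 m, ∏ b ∈ Finset.Icc (a + 1) m, crossFactor (L a) (L b))

lemma cauchyProd_sum_left {ι R : Type*} [CommRing R] (s : Finset ι) (B : ι → Multiset R)
    (D : Multiset R) : cauchyProd (∑ i ∈ s, B i) D = ∏ i ∈ s, cauchyProd (B i) D := by
  classical
  induction s using Finset.induction_on with
  | empty => simp
  | insert a s ha ih =>
    rw [Finset.sum_insert ha, Finset.prod_insert ha, cauchyProd_add_left, ih]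

lemma dualProd_sum_left {ι R : Type*} [CommRing R] (s : Finset ι) (B : ι → Multiset R)
    (D : Multiset R) : dualProd (∑ i ∈ s, B i) D = ∏ i ∈ s, dualProd (B i) D := by
  classical
  induction s using Finset.induction_on with
  | empty => simp
  | insert a s ha ih =>
    rw [Finset.sum_insert ha, Finset.prod_insert ha, dualProd_add_left, ih]

lemma prod_range_add_one (f : ℕ → ℂ) (m : ℕ) :
    ∏ j ∈ Finset.range m, f (j + 1) = ∏ k ∈ Finset.Icc 1 m, f k := by
  induction m with
  | zero => simp
  | succ m ih => rw [Finset.prod_range_succ, Finset.prod_Icc_succ_top (by omega), ih]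

lemma prod_square_succ (f : ℕ → ℕ → ℂ) (m : ℕ) :
    ∏ k ∈ Finset.Icc 1 (m + 1), ∏ i ∈ Finset.Icc 1 (m + 1), f k i =
      (∏ k ∈ Finset.Icc 1 m, ∏ i ∈ Finset.Icc 1 m, f k i) * (∏ k ∈ Finset.Icc 1 m, f k (m + 1)) *
        (∏ i ∈ Finset.Icc 1 m, f (m + 1) i) * f (m + 1) (m + 1) := by
  simp only [Finset.prod_Icc_succ_top (show 1 ≤ m + 1 by omega), Finset.prod_mul_distrib]
  ring

lemma prod_le_succ (f : ℕ → ℕ → ℂ) (m : ℕ) :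
    ∏ k ∈ Finset.Icc 1 (m + 1), ∏ i ∈ Finset.Icc k (m + 1), f k i =
      (∏ k ∈ Finset.Icc 1 m, ∏ i ∈ Finset.Icc k m, f k i) * (∏ k ∈ Finset.Icc 1 m, f k (m + 1)) *
        f (m + 1) (m + 1) := by
  rw [Finset.prod_Icc_succ_top (by omega), Finset.Icc_self, Finset.prod_singleton,
    ← Finset.prod_mul_distrib]
  congr 1
  refine Finset.prod_congr rfl fun k hk => ?_
  rw [Finset.mem_Icc] at hk
  rw [Finset.prod_Icc_succ_top (by omega)]

lemma prod_lt_succ (f : ℕ → ℕ → ℂ) (m : ℕ) :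
    ∏ k ∈ Finset.Icc 1 (m + 1), ∏ i ∈ Finset.Icc (k + 1) (m + 1), f k i =
      (∏ k ∈ Finset.Icc 1 m, ∏ i ∈ Finset.Icc (k + 1) m, f k i) *
        ∏ k ∈ Finset.Icc 1 m, f k (m + 1) := by
  rw [Finset.prod_Icc_succ_top (by omega), Finset.Icc_eq_empty_of_lt (Nat.lt_succ_self (m + 1)),
    Finset.prod_empty,
    mul_one, ← Finset.prod_mul_distrib]
  refine Finset.prod_congr rfl fun k hk => ?_
  rw [Finset.mem_Icc] at hk
  rw [Finset.prod_Icc_succ_top (by omega)]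

lemma prod_range_Icc_succ (f : ℕ → ℕ → ℂ) (m : ℕ) :
    ∏ j ∈ Finset.range (m + 1), ∏ k ∈ Finset.Icc (j + 1) (m + 1), f j k =
      (∏ j ∈ Finset.range m, ∏ k ∈ Finset.Icc (j + 1) m, f j k) *
        (∏ j ∈ Finset.range m, f j (m + 1)) * f m (m + 1) := by
  rw [Finset.prod_range_succ, Finset.Icc_self, Finset.prod_singleton, ← Finset.prod_mul_distrib]
  congr 1
  refine Finset.prod_congr rfl fun j hj => ?_
  rw [Finset.mem_range] at hj
  rw [Finset.prod_Icc_succ_top (by omega)]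

lemma gaussIter_p (L : ℕ → LevelData) (r : ℕ) :
    (gaussIter (fun i => L (i + 2)) (L 1).start r).p =
      ∑ k ∈ Finset.Icc 1 (r + 1), ((L k).x + (L k).y + (L k).w + (L k).z.map (·⁻¹)) := by
  induction r with
  | zero => simp [gaussIter, LevelData.start]
  | succ r ih =>
    rw [Finset.sum_Icc_succ_top (by omega), ← ih]
    simp only [gaussIter, LevelData.step]
    abel

lemma gaussIter_q (L : ℕ → LevelData) (r : ℕ) :
    (gaussIter (fun i => L (i + 2)) (L 1).start r).q =
      ∑ k ∈ Finset.Icc 1 (r + 1), ((L k).z + (L k).w.map (·⁻¹)) := by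
  induction r with
  | zero => simp [gaussIter, LevelData.start]
  | succ r ih =>
    rw [Finset.sum_Icc_succ_top (by omega), ← ih]
    simp only [gaussIter, LevelData.step]
    abel

lemma closedProd_one (L : ℕ → LevelData) : closedProd L 1 = (L 1).start.c := by
  simp [closedProd, LevelData.start, cauchyProd_add_left, dualProd_add_left]
  ring

/-- The new factors of the closed form when a level is added. -/
lemma closedProd_succ (L : ℕ → LevelData) (m : ℕ) (hm : 1 ≤ m) :
    closedProd L (m + 1) = closedProd L m *
      ((pairProd (L (m + 1)).x * ∏ k ∈ Finset.Icc 1 m, cauchyProd (L k).x (L (m + 1)).x) *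
      ((∏ k ∈ Finset.Icc 1 m, cauchyProd (L (m + 1)).x (L k).y) *
        cauchyProd (L (m + 1)).x (L (m + 1)).y) *
      (L (m + 1)).selfFactor *
      ((∏ k ∈ Finset.Icc 1 m,
          dualProd (L (m + 1)).x (L k).z * cauchyProd (L (m + 1)).x (L k).w) *
        (∏ k ∈ Finset.Icc 1 m,
          dualProd (L k).x (L (m + 1)).z * cauchyProd (L k).x (L (m + 1)).w) *
        (dualProd (L (m + 1)).x (L (m + 1)).z * cauchyProd (L (m + 1)).x (L (m + 1)).w)) *
      ((∏ k ∈ Finset.Icc 1 m,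
          dualProd (L k).y (L (m + 1)).z * cauchyProd (L k).y (L (m + 1)).w) *
        (dualProd (L (m + 1)).y (L (m + 1)).z * cauchyProd (L (m + 1)).y (L (m + 1)).w)) *
      ((∏ k ∈ Finset.Icc 1 m, dualProd (L (m + 1)).x ((L k).w.map (·⁻¹)) *
          cauchyProd (L (m + 1)).x ((L k).z.map (·⁻¹))) *
        (dualProd (L (m + 1)).x ((L (m + 1)).w.map (·⁻¹)) *
          cauchyProd (L (m + 1)).x ((L (m + 1)).z.map (·⁻¹)))) *
      ∏ k ∈ Finset.Icc 1 m, crossFactor (L k) (L (m + 1))) := by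
  have h1 : pairProd (∑ k ∈ Finset.Icc 1 (m + 1), (L k).x) =
      pairProd (∑ k ∈ Finset.Icc 1 m, (L k).x) * (pairProd (L (m + 1)).x *
        ∏ k ∈ Finset.Icc 1 m, cauchyProd (L k).x (L (m + 1)).x) := by
    rw [Finset.sum_Icc_succ_top (by omega), pairProd_add, cauchyProd_sum_left, mul_assoc]
  have h2 := prod_range_Icc_succ (fun j k => cauchyProd (L k).x (L (j + 1)).y) m
  rw [prod_range_add_one (fun k => cauchyProd (L (m + 1)).x (L k).y)] at h2
  have h3 : ∏ i ∈ Finset.Icc 2 (m + 1), (L i).selfFactor =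
      (∏ i ∈ Finset.Icc 2 m, (L i).selfFactor) * (L (m + 1)).selfFactor :=
    Finset.prod_Icc_succ_top (by omega) _
  have h4 := prod_square_succ
    (fun k i => dualProd (L i).x (L k).z * cauchyProd (L i).x (L k).w) m
  have h5 : ∏ k ∈ Finset.Icc 1 (m + 1), ∏ i ∈ Finset.range k,
        dualProd (L (i + 1)).y (L k).z * cauchyProd (L (i + 1)).y (L k).w =
      (∏ k ∈ Finset.Icc 1 m, ∏ i ∈ Finset.range k,
        dualProd (L (i + 1)).y (L k).z * cauchyProd (L (i + 1)).y (L k).w) *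
      ((∏ k ∈ Finset.Icc 1 m,
          dualProd (L k).y (L (m + 1)).z * cauchyProd (L k).y (L (m + 1)).w) *
        (dualProd (L (m + 1)).y (L (m + 1)).z * cauchyProd (L (m + 1)).y (L (m + 1)).w)) := by
    rw [Finset.prod_Icc_succ_top (by omega), Finset.prod_range_succ, prod_range_add_one
      (fun k => dualProd (L k).y (L (m + 1)).z * cauchyProd (L k).y (L (m + 1)).w)]
  have h6 := prod_le_succ (fun k i => dualProd (L i).x ((L k).w.map (·⁻¹)) *
    cauchyProd (L i).x ((L k).z.map (·⁻¹))) m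
  have h7 := prod_lt_succ (fun a b => crossFactor (L a) (L b)) m
  rw [closedProd, closedProd, h1, h2, h3, h4, h5, h6, h7]
  ring

/-- The constant of the Gaussian series after all levels. -/
lemma gaussIter_c (L : ℕ → LevelData) (r : ℕ) :
    (gaussIter (fun i => L (i + 2)) (L 1).start r).c = closedProd L (r + 1) := by
  induction r with
  | zero => exact (closedProd_one L).symm
  | succ r ih =>
    have h1 : ∀ k, cauchyProd (L k).y (L (r + 2)).x = cauchyProd (L (r + 2)).x (L k).y :=
      fun k => cauchyProd_comm _ _
    have h2 : ∀ k, cauchyProd (L k).w (L (r + 2)).x = cauchyProd (L (r + 2)).x (L k).w :=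
      fun k => cauchyProd_comm _ _
    have h3 : ∀ k, cauchyProd ((L k).z.map (·⁻¹)) (L (r + 2)).x =
      cauchyProd (L (r + 2)).x ((L k).z.map (·⁻¹)) := fun k => cauchyProd_comm _ _
    have h4 : ∀ k, dualProd (L k).z (L (r + 2)).x = dualProd (L (r + 2)).x (L k).z :=
      fun k => dualProd_comm _ _
    have h5 : ∀ k, dualProd ((L k).w.map (·⁻¹)) (L (r + 2)).x =
      dualProd (L (r + 2)).x ((L k).w.map (·⁻¹)) := fun k => dualProd_comm _ _
    have hr : r + 1 + 1 = r + 2 := rfl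
    rw [gaussIter, LevelData.step]
    simp only [ih, gaussIter_p, gaussIter_q, cauchyProd_sum_left, dualProd_sum_left,
      cauchyProd_add_left, dualProd_add_left, Finset.prod_mul_distrib, h1, h2, h3, h4, h5]
    rw [closedProd_succ L (r + 1) (by omega)]
    simp only [hr, crossFactor, LevelData.const, LevelData.selfFactor, Finset.prod_mul_distrib]
    ring

end ClosedForm

/-! ### Products over entries of finite lists -/

section Entrywise

lemma pairProd_map_finset {ι : Type*} [LinearOrder ι] (s : Finset ι) (X : ι → ℂ) :
    pairProd (s.val.map X) = ∏ i ∈ s, ∏ j ∈ s, if i < j then (1 - X i * X j)⁻¹ else 1 := by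
  induction s using Finset.induction_on_max with
  | empty => simp
  | insert a s hs ih =>
    have ha : a ∉ s := fun h => lt_irrefl a (hs a h)
    have h1 : ∏ j ∈ s, (if a < j then (1 - X a * X j)⁻¹ else 1) = 1 :=
      Finset.prod_eq_one fun j hj => if_neg (hs j hj).not_gt
    have h2 : cauchyProd {X a} (s.val.map X) =
        ∏ i ∈ s, if i < a then (1 - X i * X a)⁻¹ else 1 := by
      simp only [cauchyProd, Multiset.map_singleton, Multiset.prod_singleton, Multiset.map_map,
        Function.comp_def, Finset.prod_map_val, Ring.inverse_eq_inv']
      refine Finset.prod_congr rfl fun i hi => ?_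
      rw [if_pos (hs i hi), mul_comm]
    rw [Finset.insert_val_of_notMem ha, Multiset.map_cons, pairProd_cons, ih,
      Finset.prod_insert ha, Finset.prod_insert ha, if_neg (lt_irrefl a), h1, h2]
    simp only [Finset.prod_insert ha, Finset.prod_mul_distrib]
    ring

lemma prod_filter_lt {ι : Type*} [Fintype ι] [LinearOrder ι] (g : ι → ι → ℂ) :
    ∏ p ∈ Finset.univ.filter (fun p : ι × ι => p.1 < p.2), g p.1 p.2 =
      ∏ i, ∏ j, if i < j then g i j else 1 := by
  rw [Finset.prod_filter, Fintype.prod_prod_type]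

lemma H0_eq_pairProd {ι : Type*} [Fintype ι] [LinearOrder ι] (X : ι → ℂ) :
    H0 X = pairProd (Finset.univ.val.map X) := by
  rw [pairProd_map_finset, H0, prod_filter_lt (fun i j => 1 / (1 - X i * X j))]
  simp only [one_div]

lemma prod_prod_eq_diag {ι : Type*} [Fintype ι] [LinearOrder ι] (f : ι → ι → ℂ) :
    ∏ i, ∏ j, f i j = (∏ i, f i i) * ∏ i, ∏ j, if i < j then f i j * f j i else 1 := by
  have h : ∀ i j, f i j = (if i = j then f i j else 1) * (if i < j then f i j else 1) *
      (if j < i then f i j else 1) := by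
    intro i j
    rcases lt_trichotomy i j with h | h | h
    · simp [h, h.ne, h.not_gt]
    · simp [h]
    · simp [h, h.ne', h.not_gt]
  have h1 : ∏ i, ∏ j, (if j < i then f i j else 1) = ∏ i, ∏ j, if i < j then f j i else 1 :=
    Finset.prod_comm
  have h2 : ∀ i j, (if i < j then f i j * f j i else 1) =
      (if i < j then f i j else 1) * if i < j then f j i else 1 := by
    intro i j
    split_ifs <;> simp
  rw [Finset.prod_congr rfl fun i _ => Finset.prod_congr rfl fun j _ => h i j]
  simp only [Finset.prod_mul_distrib, h1, h2, Finset.prod_ite_eq, Finset.mem_univ, if_true]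
  ring

lemma map_val_eq_sum {ι : Type*} (s : Finset ι) (f : ι → ℂ) :
    s.val.map f = ∑ i ∈ s, {f i} := by
  rw [Finset.sum, ← Multiset.sum_map_singleton (s.val.map f), Multiset.map_map]
  rfl

/-- The entries of the concatenation `(ρ⁺_1, …, ρ⁺_m)`. -/
lemma map_univ_sigmaLex (m : ℕ) (n : ℕ → ℕ) (x : (i : ℕ) → Fin (n i) → ℂ) :
    (Finset.univ : Finset (Σₗ i : Fin m, Fin (n (i + 1)))).val.map
      (fun p => x ((ofLex p).1 + 1) (ofLex p).2) = ∑ k ∈ Finset.Icc 1 m, alph (x k) := by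
  have h1 : (Finset.univ : Finset (Σₗ i : Fin m, Fin (n (i + 1)))).val.map
      (fun p => x ((ofLex p).1 + 1) (ofLex p).2) =
      (Finset.univ : Finset (Σ i : Fin m, Fin (n (i + 1)))).val.map
        (fun p => x (p.1 + 1) p.2) := rfl
  have h2 : (Finset.univ : Finset (Σ i : Fin m, Fin (n (i + 1)))).val.map
        (fun p => x (p.1 + 1) p.2) = ∑ i : Fin m, alph (x (i + 1)) := by
    rw [map_val_eq_sum, Fintype.sum_sigma]
    exact Finset.sum_congr rfl fun i _ => (map_val_eq_sum _ _).symm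
  rw [h1, h2, Fin.sum_univ_eq_sum_range (fun k => alph (x (k + 1))) m]
  clear h1 h2
  induction m with
  | zero => simp
  | succ m ih => rw [Finset.sum_range_succ, Finset.sum_Icc_succ_top (by omega), ih]

lemma dualProd_alph {a b : ℕ} (x : Fin a → ℂ) (y : Fin b → ℂ) :
    dualProd (alph x) (alph y) = ∏ i, ∏ j, (1 - x i * y j) := by
  simp only [dualProd, alph, Multiset.map_map, Function.comp_def, Finset.prod_map_val]

lemma cauchyProd_alph {a b : ℕ} (x : Fin a → ℂ) (y : Fin b → ℂ) :
    cauchyProd (alph x) (alph y) = ∏ i, ∏ j, (1 - x i * y j)⁻¹ := by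
  simp only [cauchyProd, alph, Multiset.map_map, Function.comp_def, Finset.prod_map_val,
    Ring.inverse_eq_inv']

lemma map_inv_alph {a : ℕ} (x : Fin a → ℂ) : (alph x).map (·⁻¹) = alph fun i => (x i)⁻¹ := by
  rw [alph, Multiset.map_map]
  rfl

lemma prod_H1_complex {a d : ℕ} (z q : Fin d → ℂ) (x : Fin a → ℂ) :
    ∏ j, H1 (q j) (z j) x =
      dualProd (alph x) (alph z) * cauchyProd (alph x) (alph fun j => q j * z j) := by
  rw [prod_H1]
  simp [alph]

lemma prod_H2_complex {a d : ℕ} (z q : Fin d → ℂ) (x : Fin a → ℂ) :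
    ∏ j, H2 (q j) (z j) x = dualProd (alph x) ((alph fun j => q j * z j).map (·⁻¹)) *
      cauchyProd (alph x) ((alph z).map (·⁻¹)) := by
  rw [prod_H2]
  simp only [Algebra.algebraMap_self, RingHom.coe_id, Multiset.map_id]
  rfl

lemma partitionF_complex {a b : ℕ} (x : Fin a → ℂ) (y : Fin b → ℂ) (hx : ∀ i, ‖x i‖ < 1)
    (hy : ∀ i, ‖y i‖ < 1) : partitionF x y = cauchyProd (alph x) (alph y) :=
  partitionF_eq isSummabilityFamily_complex x y (fun i => (small_complex_iff _).mpr (hx i))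
    fun i => (small_complex_iff _).mpr (hy i)

lemma selfFactor_levelData {a b d : ℕ} (x : Fin a → ℂ) (y : Fin b → ℂ) (z q : Fin d → ℂ) :
    (levelData x y z q).selfFactor =
      (∏ j, (1 - q j * z j ^ 2) / (1 - z j ^ 2)) *
      ∏ p ∈ Finset.univ.filter (fun p : Fin d × Fin d => p.1 < p.2),
        (1 - q p.1 * z p.1 * z p.2) * (1 - q p.2 * z p.2 * z p.1) /
          ((1 - q p.1 * z p.1 * (q p.2 * z p.2)) * (1 - z p.1 * z p.2)) := by
  rw [prod_filter_lt (fun i j => (1 - q i * z i * z j) * (1 - q j * z j * z i) /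
    ((1 - q i * z i * (q j * z j)) * (1 - z i * z j)))]
  simp only [LevelData.selfFactor, levelData, dualProd_alph, squareProd]
  rw [prod_prod_eq_diag]
  simp only [alph, pairProd_map_finset, Multiset.map_map, Function.comp_def, Finset.prod_map_val,
    Ring.inverse_eq_inv']
  have h : ∀ i j, (if i < j then (1 - q i * z i * z j) * (1 - q j * z j * z i) /
      ((1 - q i * z i * (q j * z j)) * (1 - z i * z j)) else 1) =
      (if i < j then (1 - q i * z i * (q j * z j))⁻¹ else 1) *
      (if i < j then (1 - z i * z j)⁻¹ else 1) *
      (if i < j then (1 - q i * z i * z j) * (1 - q j * z j * z i) else 1) := by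
    intro i j
    split_ifs
    · rw [div_eq_mul_inv, mul_inv]
      ring
    · simp
  have hd : ∏ j, (1 - q j * z j * z j) = ∏ j, (1 - q j * z j ^ 2) :=
    Finset.prod_congr rfl fun j _ => by ring
  simp only [h]
  simp only [Finset.prod_mul_distrib, div_eq_mul_inv]
  rw [hd]
  ring

/-- The factors `1 - z⁻¹ s` and `1 - (q z)⁻¹ s` of `crossFactor` become differences, and the powers
of `z` and `q z` cancel. -/
lemma crossFactor_levelData {a b d a' b' d' : ℕ} (x : Fin a → ℂ) (y : Fin b → ℂ)
    (z q : Fin d → ℂ) (x' : Fin a' → ℂ) (y' : Fin b' → ℂ) (z' q' : Fin d' → ℂ)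
    (hz : ∀ j, z j ≠ 0) (hq : ∀ j, q j ≠ 0) :
    crossFactor (levelData x y z q) (levelData x' y' z' q') =
      (∏ j, ∏ k, (q j * z j - q' k * z' k) * (z j - z' k) /
        ((z j - q' k * z' k) * (q j * z j - z' k))) *
      ∏ j, ∏ k, (1 - q j * z j * z' k) * (1 - q' k * z' k * z j) /
        ((1 - q j * z j * (q' k * z' k)) * (1 - z' k * z j)) := by
  simp only [crossFactor, levelData, map_inv_alph, dualProd_alph, cauchyProd_alph,
    ← Finset.prod_mul_distrib]
  refine Finset.prod_congr rfl fun j _ => Finset.prod_congr rfl fun k _ => ?_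
  have hw : q j * z j ≠ 0 := mul_ne_zero (hq j) (hz j)
  generalize q j * z j = w at hw ⊢
  generalize q' k * z' k = w'
  have hz' := hz j
  generalize z j = t at hz' ⊢
  generalize z' k = t'
  have e : ∀ r s : ℂ, r ≠ 0 → 1 - r⁻¹ * s = r⁻¹ * (r - s) := fun r s hr => by
    rw [mul_sub, inv_mul_cancel₀ hr]
  rw [e t w' hz', e t t' hz', e w t' hw, e w w' hw, mul_comm w' t, mul_comm t' t]
  simp only [mul_inv, inv_inv, div_eq_mul_inv]
  have h1 := mul_inv_cancel₀ hz'
  have h2 := mul_inv_cancel₀ hw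
  calc _ = (t * t⁻¹) * (w * w⁻¹) * ((w - w') * (t - t') * ((t - w')⁻¹ * (w - t')⁻¹) *
      ((1 - w * t') * (1 - t * w') * ((1 - w * w')⁻¹ * (1 - t * t')⁻¹))) := by ring
    _ = _ := by rw [h1, h2, one_mul, one_mul]

end Entrywise

/-! ### The limit of the nested inner products -/

section Conclusion

variable {n n' d : ℕ → ℕ} (x : (i : ℕ) → Fin (n i) → ℂ) (y : (i : ℕ) → Fin (n' i) → ℂ)
  (z q : (i : ℕ) → Fin (d i) → ℂ)

/-- The level `k` consists of `ρ⁺_k`, `ρ⁻_{k-1}`, `z_k` and `q_k`. -/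
def level (k : ℕ) : LevelData := levelData (x k) (y (k - 1)) (z k) (q k)

lemma nestedValue_eq (m : ℕ) (hx : ∀ l, ‖x 1 l‖ < 1) (hy : ∀ l, ‖y 0 l‖ < 1)
    (u : Fin (2 * (m - 1)) → ℕ) :
    nestedValue m x y z q u =
      valueFrom (fun i => x (i + 2)) (fun i => y (i + 1)) (fun i => z (i + 2))
        (fun i => q (i + 2)) (extendZero (2 * (m - 1)) u) (level x y z q 1).start.series
        (m - 1) := by
  have h : firstEntry (x 1) (y 0) (z 1) (q 1) = (level x y z q 1).start.series :=
    funext fun v => firstEntry_eq (x 1) (y 0) (z 1) (q 1) v hx hy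
  rw [nestedValue, nested_eq_nestedFrom, h]
  rfl

end Conclusion

end PfaffianSchur

end

open PfaffianSchur in
theorem theorem6p3 (m : ℕ) (hm : 1 ≤ m) (n n' d : ℕ → ℕ)
    (x : (i : ℕ) → Fin (n i) → ℂ) (y : (i : ℕ) → Fin (n' i) → ℂ)
    (z q : (i : ℕ) → Fin (d i) → ℂ) (Υ : ℝ) (hΥ0 : 0 < Υ) (hΥ1 : Υ < 1)
    -- `x i` is `ρ⁺_i` for `1 ≤ i ≤ m`, and `y i` is `ρ⁻_i` for `0 ≤ i ≤ m - 1`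
    (hx : ∀ i ∈ Finset.Icc 1 m, ∀ l, ‖x i l‖ < 1)
    (hy : ∀ i ∈ Finset.range m, ∀ l, ‖y i l‖ < 1)
    (hz : ∀ i ∈ Finset.Icc 1 m, ∀ j, ‖z i j‖ ≤ Υ)
    (hz0 : ∀ i ∈ Finset.Icc 1 m, ∀ j, z i j ≠ 0)
    (hq0 : ∀ i ∈ Finset.Icc 1 m, ∀ j, q i j ≠ 0)
    (hqz : ∀ i ∈ Finset.Icc 1 m, ∀ j, ‖q i j * z i j‖ < 1)
    -- the factors `H^{(2)}(ρ⁺_i; z_{i,j})` have no pole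
    (hzx : ∀ i ∈ Finset.Icc 1 m, ∀ j l, z i j ≠ x i l)
    -- the series defining the limits converge
    (hxz : ∀ i ∈ Finset.Icc 1 m, ∀ k ∈ Finset.Icc (i + 1) m, ∀ j l, ‖x k l‖ < ‖z i j‖)
    (hzz : ∀ i ∈ Finset.Icc 1 m, ∀ k ∈ Finset.Icc (i + 1) m, ∀ j l,
      ‖z k l‖ < ‖q i j * z i j‖ ∧ ‖q k l * z k l‖ < ‖z i j‖) :
    IsIteratedLimit (2 * (m - 1)) (nestedValue m x y z q)
      (H0 (fun p : Σₗ i : Fin m, Fin (n (i + 1)) => x ((ofLex p).1 + 1) (ofLex p).2)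
        * (∏ j ∈ Finset.range m, ∏ k ∈ Finset.Icc (j + 1) m, partitionF (x k) (y j))
        * (∏ i ∈ Finset.Icc 2 m, ∏ j, (1 - q i j * z i j ^ 2) / (1 - z i j ^ 2))
        * (∏ i ∈ Finset.Icc 2 m, ∏ p ∈ Finset.univ.filter
            (fun p : Fin (d i) × Fin (d i) => p.1 < p.2),
            (1 - q i p.1 * z i p.1 * z i p.2) * (1 - q i p.2 * z i p.2 * z i p.1) /
              ((1 - q i p.1 * z i p.1 * (q i p.2 * z i p.2)) * (1 - z i p.1 * z i p.2)))
        * (∏ k ∈ Finset.Icc 1 m, ∏ i ∈ Finset.Icc 1 m, ∏ j, H1 (q k j) (z k j) (x i))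
        * (∏ k ∈ Finset.Icc 1 m, ∏ i ∈ Finset.range k, ∏ j, H1 (q k j) (z k j) (y i))
        * (∏ k ∈ Finset.Icc 1 m, ∏ i ∈ Finset.Icc k m, ∏ j, H2 (q k j) (z k j) (x i))
        * (∏ a ∈ Finset.Icc 1 m, ∏ b ∈ Finset.Icc (a + 1) m, ∏ j, ∏ k,
            (q a j * z a j - q b k * z b k) * (z a j - z b k) /
              ((z a j - q b k * z b k) * (q a j * z a j - z b k)))
        * (∏ a ∈ Finset.Icc 1 m, ∏ b ∈ Finset.Icc (a + 1) m, ∏ j, ∏ k,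
            (1 - q a j * z a j * z b k) * (1 - q b k * z b k * z a j) /
              ((1 - q a j * z a j * (q b k * z b k)) * (1 - z b k * z a j)))) := by
  set L := level x y z q with hL
  have hm' : m - 1 + 1 = m := by omega
  have hIcc : ∀ {i}, 1 ≤ i → i ≤ m → i ∈ Finset.Icc 1 m := fun h h' => Finset.mem_Icc.mpr ⟨h, h'⟩
  have hz1 : ∀ i ∈ Finset.Icc 1 m, ∀ j, ‖z i j‖ < 1 := fun i hi j => (hz i hi j).trans_lt hΥ1
  -- the closed form
  have e1 : H0 (fun p : Σₗ i : Fin m, Fin (n (i + 1)) => x ((ofLex p).1 + 1) (ofLex p).2) =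
      pairProd (∑ k ∈ Finset.Icc 1 m, (L k).x) := by
    rw [H0_eq_pairProd, map_univ_sigmaLex]
    rfl
  have e2 : ∏ j ∈ Finset.range m, ∏ k ∈ Finset.Icc (j + 1) m, partitionF (x k) (y j) =
      ∏ j ∈ Finset.range m, ∏ k ∈ Finset.Icc (j + 1) m, cauchyProd (L k).x (L (j + 1)).y := by
    refine Finset.prod_congr rfl fun j hj => Finset.prod_congr rfl fun k hk => ?_
    rw [Finset.mem_Icc] at hk
    exact partitionF_complex _ _ (hx k (hIcc (by omega) hk.2)) (hy j hj)
  have e3 : (∏ i ∈ Finset.Icc 2 m, ∏ j, (1 - q i j * z i j ^ 2) / (1 - z i j ^ 2)) *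
      (∏ i ∈ Finset.Icc 2 m, ∏ p ∈ Finset.univ.filter
        (fun p : Fin (d i) × Fin (d i) => p.1 < p.2),
        (1 - q i p.1 * z i p.1 * z i p.2) * (1 - q i p.2 * z i p.2 * z i p.1) /
          ((1 - q i p.1 * z i p.1 * (q i p.2 * z i p.2)) * (1 - z i p.1 * z i p.2))) =
      ∏ i ∈ Finset.Icc 2 m, (L i).selfFactor := by
    rw [← Finset.prod_mul_distrib]
    exact Finset.prod_congr rfl fun i _ => (selfFactor_levelData _ _ _ _).symm
  have e4 : ∏ k ∈ Finset.Icc 1 m, ∏ i ∈ Finset.Icc 1 m, ∏ j, H1 (q k j) (z k j) (x i) =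
      ∏ k ∈ Finset.Icc 1 m, ∏ i ∈ Finset.Icc 1 m,
        dualProd (L i).x (L k).z * cauchyProd (L i).x (L k).w :=
    Finset.prod_congr rfl fun k _ => Finset.prod_congr rfl fun i _ => prod_H1_complex _ _ _
  have e5 : ∏ k ∈ Finset.Icc 1 m, ∏ i ∈ Finset.range k, ∏ j, H1 (q k j) (z k j) (y i) =
      ∏ k ∈ Finset.Icc 1 m, ∏ i ∈ Finset.range k,
        dualProd (L (i + 1)).y (L k).z * cauchyProd (L (i + 1)).y (L k).w :=
    Finset.prod_congr rfl fun k _ => Finset.prod_congr rfl fun i _ => prod_H1_complex _ _ _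
  have e6 : ∏ k ∈ Finset.Icc 1 m, ∏ i ∈ Finset.Icc k m, ∏ j, H2 (q k j) (z k j) (x i) =
      ∏ k ∈ Finset.Icc 1 m, ∏ i ∈ Finset.Icc k m,
        dualProd (L i).x ((L k).w.map (·⁻¹)) * cauchyProd (L i).x ((L k).z.map (·⁻¹)) :=
    Finset.prod_congr rfl fun k _ => Finset.prod_congr rfl fun i _ => prod_H2_complex _ _ _
  have e7 : (∏ a ∈ Finset.Icc 1 m, ∏ b ∈ Finset.Icc (a + 1) m, ∏ j, ∏ k,
        (q a j * z a j - q b k * z b k) * (z a j - z b k) /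
          ((z a j - q b k * z b k) * (q a j * z a j - z b k))) *
      (∏ a ∈ Finset.Icc 1 m, ∏ b ∈ Finset.Icc (a + 1) m, ∏ j, ∏ k,
        (1 - q a j * z a j * z b k) * (1 - q b k * z b k * z a j) /
          ((1 - q a j * z a j * (q b k * z b k)) * (1 - z b k * z a j))) =
      ∏ a ∈ Finset.Icc 1 m, ∏ b ∈ Finset.Icc (a + 1) m, crossFactor (L a) (L b) := by
    simp only [← Finset.prod_mul_distrib]
    refine Finset.prod_congr rfl fun a ha => Finset.prod_congr rfl fun b _ => ?_
    simp only [Finset.prod_mul_distrib]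
    exact (crossFactor_levelData _ _ _ _ _ _ _ _ (hz0 a ha) (hq0 a ha)).symm
  have hclosed := gaussIter_c L (m - 1)
  rw [hm'] at hclosed
  have hval : nestedValue m x y z q = fun u => valueFrom (fun i => x (i + 2))
      (fun i => y (i + 1)) (fun i => z (i + 2)) (fun i => q (i + 2)) (extendZero (2 * (m - 1)) u)
      (L 1).start.series (m - 1) :=
    funext fun u => nestedValue_eq x y z q m (hx 1 (hIcc le_rfl hm))
      (hy 0 (Finset.mem_range.mpr hm)) u
  have key := isIteratedLimit_valueFrom (m - 1) (fun i => x (i + 2)) (fun i => y (i + 1))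
    (fun i => z (i + 2)) (fun i => q (i + 2)) (L 1).start
    (fun i hi => hx _ (hIcc (by omega) (by omega)))
    (fun i hi => hy _ (by rw [Finset.mem_range]; omega))
    (fun i hi => hz1 _ (hIcc (by omega) (by omega)))
    (fun i hi => hqz _ (hIcc (by omega) (by omega)))
    (fun i hi p hp => by
      have hi2 : i + 2 ∈ Finset.Icc 1 m := hIcc (by omega) (by omega)
      -- two alphabets of modulus less than one cause no trouble
      have hsmall : ‖p‖ < 1 →
          (∀ l, ‖p * x (i + 2) l‖ < 1) ∧ ∀ j, ‖p * (q (i + 2) j * z (i + 2) j)‖ < 1 :=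
        fun h => ⟨fun l => by
            rw [norm_mul]
            exact mul_lt_one_of_nonneg_of_lt_one_left (norm_nonneg _) h (hx _ hi2 l).le,
          fun j => by
            rw [norm_mul]
            exact mul_lt_one_of_nonneg_of_lt_one_left (norm_nonneg _) h (hqz _ hi2 j).le⟩
      have hp' : p ∈ (gaussIter (fun i => L (i + 2)) (L 1).start i).p := hp
      rw [gaussIter_p, Multiset.mem_sum] at hp'
      obtain ⟨k, hk, hp'⟩ := hp'
      rw [Finset.mem_Icc] at hk
      have hk1 : k ∈ Finset.Icc 1 m := hIcc hk.1 (by omega)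
      simp only [Multiset.mem_add, or_assoc] at hp'
      rcases hp' with h | h | h | h
      · obtain ⟨l, rfl⟩ := mem_alph.mp h
        exact hsmall (hx k hk1 l)
      · obtain ⟨l, rfl⟩ := mem_alph.mp h
        exact hsmall (hy (k - 1) (by rw [Finset.mem_range]; omega) l)
      · obtain ⟨l, rfl⟩ := mem_alph.mp h
        exact hsmall (hqz k hk1 l)
      · obtain ⟨t, ht, rfl⟩ := Multiset.mem_map.mp h
        obtain ⟨l, rfl⟩ := mem_alph.mp ht
        have hpos := norm_pos_iff.mpr (hz0 k hk1 l)
        have hki : i + 2 ∈ Finset.Icc (k + 1) m := Finset.mem_Icc.mpr ⟨by omega, by omega⟩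
        refine ⟨fun j => ?_, fun j => ?_⟩
        · rw [norm_mul, norm_inv, inv_mul_lt_one₀ hpos]
          exact hxz k hk1 (i + 2) hki l j
        · rw [norm_mul, norm_inv, inv_mul_lt_one₀ hpos]
          exact (hzz k hk1 (i + 2) hki l j).2)
    (fun i hi r hr j => by
      have hi2 : i + 2 ∈ Finset.Icc 1 m := hIcc (by omega) (by omega)
      have hr' : r ∈ (gaussIter (fun i => L (i + 2)) (L 1).start i).q := hr
      rw [gaussIter_q, Multiset.mem_sum] at hr'
      obtain ⟨k, hk, hr'⟩ := hr'
      rw [Finset.mem_Icc] at hk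
      have hk1 : k ∈ Finset.Icc 1 m := hIcc hk.1 (by omega)
      rcases Multiset.mem_add.mp hr' with h | h
      · obtain ⟨l, rfl⟩ := mem_alph.mp h
        rw [norm_mul]
        exact mul_lt_one_of_nonneg_of_lt_one_left (norm_nonneg _) (hz1 k hk1 l) (hz1 _ hi2 j).le
      · obtain ⟨t, ht, rfl⟩ := Multiset.mem_map.mp h
        obtain ⟨l, rfl⟩ := mem_alph.mp ht
        have hpos := norm_pos_iff.mpr (mul_ne_zero (hq0 k hk1 l) (hz0 k hk1 l))
        rw [norm_mul, norm_inv, inv_mul_lt_one₀ hpos]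
        exact (hzz k hk1 (i + 2) (Finset.mem_Icc.mpr ⟨by omega, by omega⟩) l j).1)
  rw [hval]
  convert key using 1
  refine Eq.trans ?_ hclosed.symm
  rw [closedProd, ← e1, ← e2, ← e3, ← e4, ← e5, ← e6, ← e7]
  ring
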